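/- Let $\mu$ be a $\sigma$-finite measure without atoms on $\mathbb{R}$ (for instance Lebesgue measure), and let $W$ be a real centred Gaussian random measure on $\mathbb{R}$ with control measure $\mu$, i.e. $(W(A))_{\mu(A)<\infty}$ is a centred Gaussian family, on some probability space, with $\mathbb{E}[W(A)W(B)]=\mu(A\cap B)$. For $q\ge 0$ and $f\in L^2(\mathbb{R}^q,\mu^{\otimes q})$ real-valued, let $I_q(f)$ be the $q$-fold Wiener–Itô integral of $f$ with respect to $W$: for pairwise disjoint Borel sets $A_1,\dots,A_q$ of finite measure $I_q(1_{A_1\times\cdots\times A_q})=W(A_1)\cdots W(A_q)$, and $I_q$ is extended by linearity and $L^2$-limits. For symmetric $f\in L^2(\mu^{\otimes p})$, $g\in L^2(\mu^{\otimes q})$ and $0\le r\le p\wedge q$ put $$(f\otimes_r g)(x_1,\dots,x_{p-r},y_1,\dots,y_{q-r})=\int_{\mathbb{R}^r} f(x_1,\dots,x_{p-r},s_1,\dots,s_r)\,g(y_1,\dots,y_{q-r},s_1,\dots,s_r)\,\mu(ds_1)\cdots\mu(ds_r),$$ and let $\|\cdot\|$ be the norm of $L^2(\mu^{\otimes (p+q-2r)})$.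 Let $J\ge 0$, $I_1,\dots,I_J\ge 0$ and orders $q_{i,j}\ge 0$ ($1\le j\le J$, $1\le i\le I_j$) be integers, let $f_{i,j,N}\in L^2(\mu^{\otimes q_{i,j}})$, $N\in\mathbb{N}$, be symmetric and real-valued, and set $$\mathbf{U}_{j,N}=\bigl(I_{q_{1,j}}(f_{1,j,N}),\dots,I_{q_{I_j,j}}(f_{I_j,j,N})\bigr).$$ Suppose that, as $N\to\infty$, $(\mathbf{U}_{1,N},\dots,\mathbf{U}_{J,N})$ converges jointly in distribution to a random vector $(\mathbf{U}_1,\dots,\mathbf{U}_J)$, and that $$\lim_{N\to\infty}\|f_{i_1,j_1,N}\otimes_r f_{i_2,j_2,N}\|=0$$ for all $j_1\ne j_2$, all $i_1\le I_{j_1}$, $i_2\le I_{j_2}$ and all $r=1,\dots,q_{i_1,j_1}\wedge q_{i_2,j_2}$. Then, with $\mathbf{u}^{\mathbf{k}}=u_1^{k_1}\cdots u_m^{k_m}$, for all $\mathbf{k}_j\in\mathbb{N}^{I_j}$ ($0\in\mathbb{N}$) the following moments exist and satisfy $$\mathbb{E}[\mathbf{U}_1^{\mathbf{k}_1}\cdots\mathbf{U}_J^{\mathbf{k}_J}]=\mathbb{E}[\mathbf{U}_1^{\mathbf{k}_1}]\cdots\mathbb{E}[\mathbf{U}_J^{\mathbf{k}_J}].$$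 If moreover the law of every component of every $\mathbf{U}_j$ is moment-determinate (it has moments of all orders and is the only probability measure on $\mathbb{R}$ with these moments), then the random vectors $\mathbf{U}_1,\dots,\mathbf{U}_J$ are independent. -/

import Mathlib

open MeasureTheory ProbabilityTheory Filter Topology
open scoped ENNReal

/-- `W` is a real centred Gaussian random measure on `ℝ` with control measure `μ`, defined on the
probability space `(Ω, P)`: the family `W A`, indexed by the Borel sets `A` of finite `μ`-measure,
is a centred Gaussian family with `E[W A * W B] = μ (A ∩ B)`. For `μ` the Lebesgue measure this is
the white noise `A ↦ ∫_A dB` of a two-sided Brownian motion `B`. -/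
structure IsGaussianRandomMeasure {Ω : Type*} [MeasurableSpace Ω]
    (W : Set ℝ → Ω → ℝ) (μ : Measure ℝ) (P : Measure Ω) : Prop where
  gaussian : IsGaussianProcess
    (fun A : {A : Set ℝ // MeasurableSet A ∧ μ A < ∞} => W A.1) P
  centred : ∀ A : Set ℝ, MeasurableSet A → μ A < ∞ → ∫ ω, W A ω ∂P = 0
  covariance : ∀ A B : Set ℝ, MeasurableSet A → μ A < ∞ → MeasurableSet B → μ B < ∞ →
    ∫ ω, W A ω * W B ω ∂P = μ.real (A ∩ B)

/-- `f` is an elementary (off-diagonal step) function of `q` variables and `X` its multiple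
integral: `f = ∑ₘ cₘ 1_{A_{m,1} × ⋯ × A_{m,q}}` and `X = ∑ₘ cₘ W(A_{m,1}) ⋯ W(A_{m,q})`, where for
each `m` the sets `A_{m,1}, …, A_{m,q}` are pairwise disjoint Borel sets of finite measure. -/
def IsElementaryIntegral {Ω : Type*} (W : Set ℝ → Ω → ℝ) (μ : Measure ℝ) (q : ℕ)
    (f : (Fin q → ℝ) → ℝ) (X : Ω → ℝ) : Prop :=
  ∃ (n : ℕ) (c : Fin n → ℝ) (A : Fin n → Fin q → Set ℝ),
    (∀ m k, MeasurableSet (A m k) ∧ μ (A m k) < ∞) ∧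
    (∀ m k l, k ≠ l → Disjoint (A m k) (A m l)) ∧
    (f = fun x => ∑ m, c m * ∏ k, (A m k).indicator (fun _ => (1 : ℝ)) (x k)) ∧
    (X = fun ω => ∑ m, c m * ∏ k, W (A m k) ω)

/-- `X` is (a version of) the `q`-fold Wiener–Itô integral `I_q(f)` of `f ∈ L²(μ^q)` with respect
to `W`: the `L²(P)`-limit of the integrals of elementary functions converging to `f` in `L²(μ^q)`.
-/
def IsWienerItoIntegral {Ω : Type*} [MeasurableSpace Ω] (W : Set ℝ → Ω → ℝ) (μ : Measure ℝ)
    (P : Measure Ω) (q : ℕ) (f : (Fin q → ℝ) → ℝ) (X : Ω → ℝ) : Prop :=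
  MemLp f 2 (Measure.pi fun _ : Fin q => μ) ∧ MemLp X 2 P ∧
  ∃ (fn : ℕ → (Fin q → ℝ) → ℝ) (Xn : ℕ → Ω → ℝ),
    (∀ n, IsElementaryIntegral W μ q (fn n) (Xn n)) ∧
    Tendsto (fun n => eLpNorm (fn n - f) 2 (Measure.pi fun _ : Fin q => μ)) atTop (𝓝 0) ∧
    Tendsto (fun n => eLpNorm (Xn n - X) 2 P) atTop (𝓝 0)

/-- `f` is symmetric in its `q` variables, up to `μ^q`-null sets. -/
def IsSymmetricKernel (μ : Measure ℝ) (q : ℕ) (f : (Fin q → ℝ) → ℝ) : Prop :=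
  ∀ σ : Equiv.Perm (Fin q),
    (fun x => f (fun k => x (σ k))) =ᵐ[Measure.pi fun _ : Fin q => μ] f

/-- For `r ≤ p`, the point `(x₁, …, x_{p-r}, s₁, …, s_r)` of `ℝ^p`. -/
def joinArgs (p r : ℕ) (x : Fin (p - r) → ℝ) (s : Fin r → ℝ) : Fin p → ℝ :=
  fun k => if h : k.1 < p - r then x ⟨k.1, h⟩ else s ⟨k.1 - (p - r), by omega⟩

/-- The contraction `f ⊗_r g` (for `r ≤ p` and `r ≤ q`), a function of `(x, y)` with
`x ∈ ℝ^(p-r)` and `y ∈ ℝ^(q-r)`. -/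
noncomputable def contraction (μ : Measure ℝ) (p q r : ℕ)
    (f : (Fin p → ℝ) → ℝ) (g : (Fin q → ℝ) → ℝ) :
    (Fin (p - r) → ℝ) × (Fin (q - r) → ℝ) → ℝ :=
  fun z => ∫ s : Fin r → ℝ, f (joinArgs p r z.1 s) * g (joinArgs q r z.2 s)
    ∂(Measure.pi fun _ : Fin r => μ)

/-- The `L²`-norm of `f ⊗_r g`. -/
noncomputable def contractionNorm (μ : Measure ℝ) (p q r : ℕ)
    (f : (Fin p → ℝ) → ℝ) (g : (Fin q → ℝ) → ℝ) : ℝ≥0∞ :=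
  eLpNorm (contraction μ p q r f g) 2
    ((Measure.pi fun _ : Fin (p - r) => μ).prod (Measure.pi fun _ : Fin (q - r) => μ))

/-- A law on `ℝ` is moment-determinate: it has moments of all orders, and it is the only
probability measure with these moments. -/
def MomentDeterminate (ν : Measure ℝ) : Prop :=
  (∀ n : ℕ, Integrable (fun x => x ^ n) ν) ∧
  ∀ ν' : Measure ℝ, IsProbabilityMeasure ν' → (∀ n : ℕ, Integrable (fun x => x ^ n) ν') →
    (∀ n : ℕ, ∫ x, x ^ n ∂ν' = ∫ x, x ^ n ∂ν) → ν' = ν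

/-!
Each multiple integral is within a small `L²`-distance of an elementary integral
`∑ₘ cₘ W(A_{m,1}) ⋯ W(A_{m,q})` whose step kernel is symmetric at every point
(`IsWienerItoIntegral.exists_stepIntegral`), and contraction norms depend continuously on the kernels
(`contractionNorm_le_add`). For such integrals only finitely many Gaussian variables matter: they are
polynomials on a finite-dimensional Gaussian space, of a form in which no product has two equal or
correlated factors.

*Decoupling.* For a centred Gaussian vector `X` with independent copy `Y`, differentiating
`θ ↦ E[F(X) G(X cos θ + Y sin θ)]` between `0` and `π / 2` and integrating by parts bounds the
covariance of `F(X)` and `G(X)` by the expected pairing of the gradients of `F` and `G`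
(`norm_covariance_le_of_fderiv`). It is applied to `F = exp (i ∑ αₜ Xₜ)` and `G = exp (i ∑ βₜ Xₜ)`,
where the `Xₜ` are elementary integrals, so that the pairings of the gradients of the `Xₜ` have to be
small when `t` carries weight in `α` and `t'` in `β`. The second moment of such a pairing is expanded
over diagrams, that is, pairings of the arguments of the kernels
(`integral_prod_form_eq_sum_pairings`). Every diagram that contributes joins the two
kernels by at least one edge, and a Cauchy–Schwarz inequality on the graph bounds its value by the
norm of a contraction of positive order of the two kernels times their norms
(`enorm_integral_prod_comp_le_contractionNorm`, `eLpNorm_gradPairing_sq_le`). Hence the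
characteristic function at `α + β` nearly factorizes when the contractions between the supports of
`α` and `β` are small (`norm_integral_phase_mul_sub_le`).

*Boundedness.* The same expansion bounds every moment of an integral by a power of the norm of its
kernel, and symmetry of the kernel bounds the second moment from below. Comparing second and
fourth moments as in the Paley–Zygmund inequality, convergence in distribution keeps the second
moments bounded (`exists_eventually_integral_sq_le`), hence the kernels, hence all moments. The limit
therefore has moments of all orders.

*Conclusion.* The characteristic function of the limit is the product of those of its blocks
(`vectorCharFun_add`, `memLp_and_vectorCharFun_eq_prod`), which is independence of the blocks; since
all moments are finite, the expectation of the product of monomials factorizes.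
-/


/-! ### Polarization and the Wick formula -/

section Polarization

open Finset

variable {S : Type*} [Fintype S] [DecidableEq S]

/-- Inclusion–exclusion over the set of values avoided by a map: only the surjective maps
`φ : T → S` survive the alternating sum. -/
lemma sum_neg_one_pow_mul_sum_piFinset_compl {T : Type*} [Fintype T] [DecidableEq T]
    (F : (T → S) → ℝ) :
    ∑ B : Finset S, (-1 : ℝ) ^ #B * ∑ φ ∈ Fintype.piFinset (fun _ : T => Bᶜ), F φ =
      ∑ φ : T → S with Function.Surjective φ, F φ := by
  have h1 : ∀ B : Finset S, (-1 : ℝ) ^ #B * ∑ φ ∈ Fintype.piFinset (fun _ : T => Bᶜ), F φ =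
      ∑ φ : T → S, if B ⊆ (univ.image φ)ᶜ then (-1 : ℝ) ^ #B * F φ else 0 := by
    intro B
    rw [Finset.mul_sum, ← Finset.sum_filter]
    refine Finset.sum_congr ?_ fun _ _ => rfl
    ext φ
    simp only [Fintype.mem_piFinset, mem_compl, mem_filter, mem_univ, true_and, subset_iff,
      mem_image, not_exists]
    grind
  simp_rw [h1]
  rw [Finset.sum_comm, Finset.sum_filter]
  refine Finset.sum_congr rfl fun φ _ => ?_
  rw [← Finset.sum_filter, ← Finset.sum_mul]
  have h2 : (univ.filter fun B : Finset S => B ⊆ (univ.image φ)ᶜ) = ((univ.image φ)ᶜ).powerset := by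
    ext B; simp
  have h3 := Finset.sum_powerset_neg_one_pow_card (x := (univ.image φ)ᶜ)
  have h4 : (∑ B ∈ ((univ.image φ)ᶜ).powerset, (-1 : ℝ) ^ #B)
      = if (univ.image φ)ᶜ = ∅ then 1 else 0 := by
    exact_mod_cast h3
  rw [h2, h4]
  have : (univ.image φ)ᶜ = ∅ ↔ Function.Surjective φ := by
    rw [Finset.compl_eq_empty_iff, Finset.eq_univ_iff_forall]; simp [Function.Surjective]
  simp only [this]
  split_ifs <;> simp

/-- Between finite types of the same cardinality, summing over surjective maps is summing over
bijections. -/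
lemma sum_surjective_eq_sum_equiv {T : Type*} [Fintype T] [DecidableEq T]
    (h : Fintype.card T = Fintype.card S) (F : (T → S) → ℝ) :
    ∑ φ : T → S with Function.Surjective φ, F φ = ∑ e : T ≃ S, F e := by
  symm
  refine Finset.sum_bij (fun e _ => (e : T → S)) ?_ ?_ ?_ ?_
  · intro e _; simpa using e.surjective
  · intro e _ e' _ h; exact DFunLike.coe_injective h
  · intro φ hφ
    have hs : Function.Surjective φ := by simpa using hφ
    exact ⟨Equiv.ofBijective φ ((Fintype.bijective_iff_surjective_and_card φ).2 ⟨hs, h⟩),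
      mem_univ _, rfl⟩
  · intro e _; rfl

/-- Polarization: a product of `m` numbers is an alternating sum of `m`-th powers of
partial sums. -/
lemma sum_neg_one_pow_mul_sum_compl_pow (z : S → ℝ) {m : ℕ} (hm : Fintype.card S = m) :
    ∑ B : Finset S, (-1 : ℝ) ^ #B * (∑ s ∈ Bᶜ, z s) ^ m = m.factorial * ∏ s, z s := by
  have h1 : ∀ B : Finset S, (∑ s ∈ Bᶜ, z s) ^ m =
      ∑ φ ∈ Fintype.piFinset (fun _ : Fin m => Bᶜ), ∏ i, z (φ i) := by
    intro B
    rw [← Finset.prod_univ_sum]; simp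
  simp_rw [h1]
  rw [sum_neg_one_pow_mul_sum_piFinset_compl (T := Fin m) (fun φ => ∏ i, z (φ i)),
    sum_surjective_eq_sum_equiv (by simp [hm])]
  have h2 : ∀ e : Fin m ≃ S, ∏ i, z (e i) = ∏ s, z s := fun e => e.prod_comp z
  simp_rw [h2]
  have e0 : Fin m ≃ S := (Fintype.equivFinOfCardEq hm).symm
  simp [Fintype.card_equiv e0]

/-- Polarization of the powers of a quadratic form. -/
lemma sum_neg_one_pow_mul_sum_sum_compl_pow (σ : S → S → ℝ) {n : ℕ}
    (hn : Fintype.card S = 2 * n) :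
    ∑ B : Finset S, (-1 : ℝ) ^ #B * (∑ s ∈ Bᶜ, ∑ t ∈ Bᶜ, σ s t) ^ n =
      ∑ e : Fin n × Bool ≃ S, ∏ i, σ (e (i, false)) (e (i, true)) := by
  have h1 : ∀ B : Finset S, (∑ s ∈ Bᶜ, ∑ t ∈ Bᶜ, σ s t) ^ n =
      ∑ φ ∈ Fintype.piFinset (fun _ : Fin n × Bool => Bᶜ), ∏ i, σ (φ (i, false)) (φ (i, true)) := by
    intro B
    rw [← Finset.sum_product']
    have : (∑ x ∈ Bᶜ ×ˢ Bᶜ, σ x.1 x.2) ^ n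
        = ∑ φ ∈ Fintype.piFinset (fun _ : Fin n => Bᶜ ×ˢ Bᶜ), ∏ i, σ (φ i).1 (φ i).2 := by
      rw [← Finset.prod_univ_sum (fun _ : Fin n => Bᶜ ×ˢ Bᶜ) (fun _ x => σ x.1 x.2)]; simp
    rw [this]
    refine Finset.sum_bij' (fun φ _ p => if p.2 then (φ p.1).2 else (φ p.1).1)
      (fun φ _ i => (φ (i, false), φ (i, true))) ?_ ?_ ?_ ?_ ?_
    · intro φ hφ
      simp only [Fintype.mem_piFinset, mem_product] at hφ ⊢
      rintro ⟨i, b⟩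
      cases b <;> simp [-mem_compl, hφ i]
    · intro φ hφ
      simp only [Fintype.mem_piFinset, mem_product] at hφ ⊢
      exact fun i => ⟨hφ _, hφ _⟩
    · intro φ _; simp
    · intro φ _; ext ⟨i, b⟩; cases b <;> simp
    · intro φ _; simp
  simp_rw [h1]
  rw [sum_neg_one_pow_mul_sum_piFinset_compl
      (fun φ : Fin n × Bool → S => ∏ i, σ (φ (i, false)) (φ (i, true))),
    sum_surjective_eq_sum_equiv (by simp [hn, mul_comm])]

end Polarization

section Wick

variable {E : Type*} [NormedAddCommGroup E] [NormedSpace ℝ E] [MeasurableSpace E] [BorelSpace E]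
  {Q : Measure E} [IsGaussian Q]

/-- The combinatorial constant of the Wick formula indexed by labelled oriented pairings of `2n`
points, `E[g ^ (2n)] / (2n)!` for a standard Gaussian `g` (its value is `1 / (2 ^ n * n!)`). -/
noncomputable def wickConst (n : ℕ) : ℝ :=
  (∫ x, x ^ (2 * n) ∂(gaussianReal 0 1)) / (2 * n).factorial

lemma wickConst_pos (n : ℕ) : 0 < wickConst n := by
  refine div_pos ?_ (by positivity)
  refine (integral_pos_iff_support_of_nonneg (fun x => ?_) ?_).2 ?_
  · exact (even_two_mul n).pow_nonneg x
  · have := (memLp_id_gaussianReal (μ := 0) (v := 1) (2 * n : ℕ)).integrable_norm_pow'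
    simp only [id, Real.norm_eq_abs] at this
    refine this.congr (.of_forall fun x => ?_)
    exact (even_two_mul n).pow_abs x
  · have h1 : ({0}ᶜ : Set ℝ) ⊆ Function.support fun x : ℝ => x ^ (2 * n) := by
      exact fun x hx => pow_ne_zero _ hx
    refine lt_of_lt_of_le ?_ (measure_mono h1)
    have : NullSingletonClass (gaussianReal 0 1) := nullSingletonClass_gaussianReal one_ne_zero
    rw [measure_compl (measurableSet_singleton _) (by simp)]
    simp

lemma integral_dual_pow (h0 : ∀ L : StrongDual ℝ E, ∫ x, L x ∂Q = 0) (L : StrongDual ℝ E) (m : ℕ) :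
    ∫ x, L x ^ m ∂Q = √(∫ x, L x * L x ∂Q) ^ m * ∫ x, x ^ m ∂(gaussianReal 0 1) := by
  have hv : Var[L; Q] = ∫ x, L x * L x ∂Q := by
    rw [variance_eq_integral (by fun_prop)]
    simp [h0, sq]
  have hmap : Q.map L = (gaussianReal 0 1).map (√(∫ x, L x * L x ∂Q) * ·) := by
    rw [IsGaussian.map_eq_gaussianReal, h0, hv, gaussianReal_map_const_mul]
    congr 1
    · simp
    · ext
      rw [Real.coe_toNNReal _ (integral_nonneg fun x => mul_self_nonneg _)]
      simp [Real.sq_sqrt (integral_nonneg fun x => mul_self_nonneg (L x))]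
  have h1 : ∫ x, L x ^ m ∂Q = ∫ y, y ^ m ∂(Q.map L) := by
    rw [integral_map (by fun_prop) (by fun_prop)]
  rw [h1, hmap, integral_map (by fun_prop) (by fun_prop), ← integral_const_mul]
  simp [mul_pow]

/-- Functions with moments of all orders are stable under products. -/
lemma memLp_finsetProd {α S : Type*} [MeasurableSpace α] {ν : Measure α} [IsFiniteMeasure ν]
    (T : Finset S) {f : S → α → ℝ} (hf : ∀ s ∈ T, ∀ p : ℝ≥0∞, p ≠ ∞ → MemLp (f s) p ν)
    (p : ℝ≥0∞) (hp : p ≠ ∞) : MemLp (fun x => ∏ s ∈ T, f s x) p ν := by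
  classical
  induction T using Finset.induction_on generalizing p with
  | empty => simpa using memLp_const (1 : ℝ)
  | insert a T ha ih =>
    simp_rw [Finset.prod_insert ha]
    have h2p : 2 * p ≠ ∞ := ENNReal.mul_ne_top (by simp) hp
    exact MemLp.mul' (p := 2 * p) (q := 2 * p)
      (ih (fun s hs => hf s (Finset.mem_insert_of_mem hs)) _ h2p)
      (hf a (Finset.mem_insert_self a T) _ h2p)
      (hpqr := ⟨by
        rw [ENNReal.mul_inv (by simp) (by simp), ← add_mul, ENNReal.inv_two_add_inv_two, one_mul]⟩)

lemma memLp_prod_dual {S : Type*} (T : Finset S) (L : S → StrongDual ℝ E) (p : ℝ≥0∞)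
    (hp : p ≠ ∞) : MemLp (fun x => ∏ s ∈ T, L s x) p Q :=
  memLp_finsetProd T (fun s _ p hp => IsGaussian.memLp_dual Q (L s) p hp) p hp

lemma integrable_prod_dual {S : Type*} (T : Finset S) (L : S → StrongDual ℝ E) :
    Integrable (fun x => ∏ s ∈ T, L s x) Q :=
  memLp_one_iff_integrable.1 (memLp_prod_dual T L 1 (by simp))

variable {S : Type*} [Fintype S] [DecidableEq S]

lemma factorial_mul_integral_prod_dual (L : S → StrongDual ℝ E) {m : ℕ}
    (hm : Fintype.card S = m) :
    m.factorial * ∫ x, ∏ s, L s x ∂Q =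
      ∑ B : Finset S, (-1 : ℝ) ^ B.card * ∫ x, (∑ s ∈ Bᶜ, L s) x ^ m ∂Q := by
  simp_rw [← integral_const_mul]
  rw [← integral_finsetSum]
  · congr with x
    rw [← sum_neg_one_pow_mul_sum_compl_pow (fun s => L s x) hm]
    simp
  · intro B _
    refine Integrable.const_mul ?_ _
    simpa using integrable_prod_dual (Q := Q) (Finset.univ : Finset (Fin m))
      (fun _ => ∑ s ∈ Bᶜ, L s)

/-- **Wick formula** (Isserlis' theorem): the expectation of a product of `2n` centred jointly
Gaussian variables is a sum over pairings. A pairing is listed with its pairs labelled by `Fin n`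
and oriented, that is, as a bijection `Fin n × Bool ≃ S`. -/
theorem integral_prod_dual_eq_sum_pairings (h0 : ∀ L : StrongDual ℝ E, ∫ x, L x ∂Q = 0)
    (L : S → StrongDual ℝ E) {n : ℕ} (hn : Fintype.card S = 2 * n) :
    ∫ x, ∏ s, L s x ∂Q =
      wickConst n * ∑ e : Fin n × Bool ≃ S,
        ∏ i, ∫ x, L (e (i, false)) x * L (e (i, true)) x ∂Q := by
  have h1 := factorial_mul_integral_prod_dual (Q := Q) L hn
  have hcov : ∀ B : Finset S, ∫ x, (∑ s ∈ Bᶜ, L s) x * (∑ s ∈ Bᶜ, L s) x ∂Q =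
      ∑ s ∈ Bᶜ, ∑ t ∈ Bᶜ, ∫ x, L s x * L t x ∂Q := by
    intro B
    have hint : ∀ s t, Integrable (fun x => L s x * L t x) Q := fun s t => by
      simpa using integrable_prod_dual (Q := Q) (Finset.univ : Finset (Fin 2)) ![L s, L t]
    simp_rw [← fun s => integral_finsetSum Bᶜ fun t (_ : t ∈ Bᶜ) => hint s t]
    rw [← integral_finsetSum _ fun s _ => integrable_finsetSum _ fun t _ => hint s t]
    simp [Finset.sum_mul_sum]
  have h2 : ∀ B : Finset S, ∫ x, (∑ s ∈ Bᶜ, L s) x ^ (2 * n) ∂Q =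
      (∑ s ∈ Bᶜ, ∑ t ∈ Bᶜ, ∫ x, L s x * L t x ∂Q) ^ n *
        ∫ x, x ^ (2 * n) ∂(gaussianReal 0 1) := by
    intro B
    rw [integral_dual_pow h0, pow_mul, Real.sq_sqrt (integral_nonneg fun x => mul_self_nonneg _),
      hcov]
  simp_rw [h2, ← mul_assoc] at h1
  rw [← Finset.sum_mul, sum_neg_one_pow_mul_sum_sum_compl_pow _ hn] at h1
  rw [wickConst]
  field_simp
  linarith

lemma integral_prod_dual_eq_zero_of_odd (h0 : ∀ L : StrongDual ℝ E, ∫ x, L x ∂Q = 0)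
    (L : S → StrongDual ℝ E) (hS : Odd (Fintype.card S)) :
    ∫ x, ∏ s, L s x ∂Q = 0 := by
  have h1 := factorial_mul_integral_prod_dual (Q := Q) L rfl
  have h2 : ∫ x, x ^ (Fintype.card S) ∂(gaussianReal 0 1) = 0 := by
    have h3 : ∫ x, x ^ (Fintype.card S) ∂(gaussianReal 0 1)
        = ∫ x, (-x) ^ (Fintype.card S) ∂(gaussianReal 0 1) := by
      rw [← integral_map (f := fun y : ℝ => y ^ (Fintype.card S)) (φ := fun x : ℝ => -x)
        (by fun_prop) (by fun_prop), gaussianReal_map_neg]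
      simp
    simp_rw [hS.neg_pow] at h3
    rw [integral_neg] at h3
    linarith
  simp_rw [integral_dual_pow h0, h2] at h1
  simpa [Nat.factorial_ne_zero] using h1

end Wick

/-! ### A Cauchy–Schwarz inequality for integrals indexed by graphs -/

section Graph

variable {V K X : Type*} [DecidableEq V] [Fintype K] [MeasurableSpace X] {μ : Measure X}

lemma lmarginal_update_eq_of_dependsOn {D t : Finset V} {F : (V → X) → ℝ≥0∞}
    (hF : DependsOn F (D : Set V)) {v : V} (hv : v ∉ D) (x : V → X) (y : X) :
    (∫⋯∫⁻_t, F ∂fun _ => μ) (Function.update x v y) = (∫⋯∫⁻_t, F ∂fun _ => μ) x := by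
  refine lintegral_congr fun z => hF fun w hw => ?_
  have : w ≠ v := fun h => hv (h ▸ hw)
  simp [Function.updateFinset, this]

/-- If every variable of `s` occurs in exactly two of the factors `F k`, the integral of `∏ F k`
over these variables is at most the product of the `L²`-norms: integrate the variables one at a
time and apply the Cauchy–Schwarz inequality to the two factors concerned. -/
theorem lmarginal_prod_le_prod_lmarginal_sq [DecidableEq K] [SigmaFinite μ]
    (D : K → Finset V) (F : K → (V → X) → ℝ≥0∞)
    (hF : ∀ k, Measurable (F k)) (hD : ∀ k, DependsOn (F k) (D k : Set V)) (s : Finset V)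
    (htwo : ∀ v ∈ s, ∃ k l, k ≠ l ∧ v ∈ D k ∧ v ∈ D l ∧ ∀ m, v ∈ D m → m = k ∨ m = l)
    (x : V → X) :
    (∫⋯∫⁻_s, (fun y => ∏ k, F k y) ∂fun _ => μ) x ≤
      ∏ k, ((∫⋯∫⁻_(s ∩ D k), (fun y => F k y ^ (2 : ℝ)) ∂fun _ => μ) x) ^ (1 / 2 : ℝ) := by
  induction s using Finset.induction_on generalizing x with
  | empty =>
    simp only [lmarginal_empty, Finset.empty_inter]
    refine Finset.prod_le_prod' fun k _ => le_of_eq ?_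
    rw [← ENNReal.rpow_mul]; norm_num
  | insert v s hv ih =>
    obtain ⟨k, l, hkl, hk, hl, hm⟩ := htwo v (Finset.mem_insert_self v s)
    have hmeas : Measurable fun y => ∏ k, F k y := by fun_prop
    have hF2 : ∀ k, Measurable fun y => F k y ^ (2 : ℝ) := fun k => (hF k).pow_const _
    rw [lmarginal_insert _ hmeas hv]
    set G : K → (V → X) → ℝ≥0∞ := fun m y =>
      ((∫⋯∫⁻_(s ∩ D m), (fun y => F m y ^ (2 : ℝ)) ∂fun _ => μ) y) ^ (1 / 2 : ℝ) with hG
    have hGm : ∀ m, Measurable (G m) := fun m => (Measurable.lmarginal _ (hF2 m)).pow_const _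
    have hGu : ∀ m, Measurable fun y => G m (Function.update x v y) := fun m =>
      (hGm m).comp (measurable_update x)
    have hGconst : ∀ m, v ∉ D m → ∀ y, G m (Function.update x v y) = G m x := by
      intro m hvm y
      have hd : DependsOn (fun y => F m y ^ (2 : ℝ)) (D m : Set V) := fun a b hab => by
        simp only; rw [hD m hab]
      simp only [hG]
      rw [lmarginal_update_eq_of_dependsOn hd hvm]
    have hins : ∀ m, v ∈ D m → ∫⁻ y, G m (Function.update x v y) ^ (2 : ℝ) ∂μ =
        (∫⋯∫⁻_(insert v s ∩ D m), (fun y => F m y ^ (2 : ℝ)) ∂fun _ => μ) x := by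
      intro m hvm
      rw [Finset.insert_inter_of_mem hvm, lmarginal_insert _ (hF2 m) (by simp [hv])]
      refine lintegral_congr fun y => ?_
      simp only [hG]
      rw [← ENNReal.rpow_mul]; norm_num
    have hsplit : ∀ H : K → ℝ≥0∞, ∏ m, H m =
        H k * H l * ∏ m ∈ (Finset.univ.erase k).erase l, H m := by
      intro H
      rw [mul_assoc, Finset.mul_prod_erase _ _ (by simp [hkl.symm]),
        Finset.mul_prod_erase _ _ (Finset.mem_univ k)]
    have hrest : ∀ m ∈ (Finset.univ.erase k).erase l, v ∉ D m := by
      intro m hm' hvm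
      have := hm m hvm
      simp only [Finset.mem_erase] at hm'
      tauto
    calc ∫⁻ y, (∫⋯∫⁻_s, (fun y => ∏ k, F k y) ∂fun _ => μ) (Function.update x v y) ∂μ
        ≤ ∫⁻ y, ∏ m, G m (Function.update x v y) ∂μ :=
          lintegral_mono fun y => ih (fun w hw => htwo w (Finset.mem_insert_of_mem hw)) _
      _ = ∫⁻ y, (G k (Function.update x v y) * G l (Function.update x v y)) *
            ∏ m ∈ (Finset.univ.erase k).erase l, G m x ∂μ := by
          refine lintegral_congr fun y => ?_
          rw [hsplit]
          congr 1
          exact Finset.prod_congr rfl fun m hm' => hGconst m (hrest m hm') y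
      _ = (∫⁻ y, G k (Function.update x v y) * G l (Function.update x v y) ∂μ) *
            ∏ m ∈ (Finset.univ.erase k).erase l, G m x :=
          lintegral_mul_const _ ((hGu k).mul (hGu l))
      _ ≤ ((∫⁻ y, G k (Function.update x v y) ^ (2 : ℝ) ∂μ) ^ (1 / 2 : ℝ) *
            (∫⁻ y, G l (Function.update x v y) ^ (2 : ℝ) ∂μ) ^ (1 / 2 : ℝ)) *
            ∏ m ∈ (Finset.univ.erase k).erase l, G m x := by
          gcongr
          exact ENNReal.lintegral_mul_le_Lp_mul_Lq μ Real.HolderConjugate.two_two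
            (hGu k).aemeasurable (hGu l).aemeasurable
      _ = _ := by
          rw [hsplit, hins k hk, hins l hl]
          congr 1
          refine Finset.prod_congr rfl fun m hm' => ?_
          rw [Finset.insert_inter_of_notMem (hrest m hm')]

lemma lmarginal_comp_injective [SigmaFinite μ] {N : Type*} [Fintype N] [DecidableEq N] {ε : N → V}
    (hε : Function.Injective ε) {G : (N → X) → ℝ≥0∞} (hG : Measurable G) (x : V → X) :
    (∫⋯∫⁻_(Finset.univ.image ε), (fun y => G (y ∘ ε)) ∂fun _ => μ) x =
      ∫⁻ z, G z ∂(Measure.pi fun _ : N => μ) := by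
  have := lmarginal_image (μ := fun _ : V => μ) hε Finset.univ hG x
  simp only [lmarginal_univ] at this
  exact this

/-- The graph inequality for kernels attached to the vertices `k : K` of a multigraph with edge set
`V`, the kernel at `k` depending on the variables carried by the edges `ε k i` at `k`. -/
theorem lintegral_prod_comp_le_prod_sq [Fintype V] [SigmaFinite μ] (N : K → Type*)
    [∀ k, Fintype (N k)] (ε : ∀ k, N k → V) (hε : ∀ k, Function.Injective (ε k))
    (htwo : ∀ v, ∃ k l, k ≠ l ∧ v ∈ Set.range (ε k) ∧ v ∈ Set.range (ε l) ∧
      ∀ m, v ∈ Set.range (ε m) → m = k ∨ m = l)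
    (G : ∀ k, (N k → X) → ℝ≥0∞) (hG : ∀ k, Measurable (G k)) :
    ∫⁻ x, ∏ k, G k (x ∘ ε k) ∂(Measure.pi fun _ : V => μ) ≤
      ∏ k, (∫⁻ z, G k z ^ (2 : ℝ) ∂(Measure.pi fun _ : N k => μ)) ^ (1 / 2 : ℝ) := by
  classical
  rcases isEmpty_or_nonempty (V → X) with hX | ⟨⟨x⟩⟩
  · simp
  rw [lintegral_eq_lmarginal_univ x]
  have hm : ∀ k, Measurable fun y : V → X => y ∘ ε k := fun k => by fun_prop
  refine (lmarginal_prod_le_prod_lmarginal_sq (fun k => Finset.univ.image (ε k))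
    (fun k y => G k (y ∘ ε k)) (fun k => (hG k).comp (hm k)) ?_ _ ?_ x).trans_eq ?_
  · intro k a b hab
    simp only
    congr 1
    ext i
    exact hab _ (by simp)
  · intro v _
    obtain ⟨k, l, hkl, hk, hl, hm⟩ := htwo v
    exact ⟨k, l, hkl, by simpa using hk, by simpa using hl, fun m hvm => hm m (by simpa using hvm)⟩
  · refine Finset.prod_congr rfl fun k _ => ?_
    rw [Finset.univ_inter, lmarginal_comp_injective (hε k) ((hG k).pow_const _)]

/-- The graph inequality with one vertex singled out, whose legs may be indexed differently. -/
theorem lintegral_mul_prod_comp_le [Fintype V] [SigmaFinite μ] {N₀ : Type*} [Fintype N₀]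
    (N : K → Type*) [∀ k, Fintype (N k)] (ε₀ : N₀ → V) (ε : ∀ k, N k → V)
    (hε₀ : Function.Injective ε₀) (hε : ∀ k, Function.Injective (ε k))
    (htwo : ∀ v, ∃ k l : Option K, k ≠ l ∧
      ∀ m, v ∈ m.elim (Set.range ε₀) (fun k => Set.range (ε k)) ↔ m = k ∨ m = l)
    (G₀ : (N₀ → X) → ℝ≥0∞) (hG₀ : Measurable G₀)
    (G : ∀ k, (N k → X) → ℝ≥0∞) (hG : ∀ k, Measurable (G k)) :
    ∫⁻ x, G₀ (x ∘ ε₀) * ∏ k, G k (x ∘ ε k) ∂(Measure.pi fun _ : V => μ) ≤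
      (∫⁻ z, G₀ z ^ (2 : ℝ) ∂(Measure.pi fun _ : N₀ => μ)) ^ (1 / 2 : ℝ) *
      ∏ k, (∫⁻ z, G k z ^ (2 : ℝ) ∂(Measure.pi fun _ : N k => μ)) ^ (1 / 2 : ℝ) := by
  classical
  rcases isEmpty_or_nonempty (V → X) with hX | ⟨⟨x⟩⟩
  · simp
  rw [lintegral_eq_lmarginal_univ x]
  have key := lmarginal_prod_le_prod_lmarginal_sq (μ := μ)
    (fun o : Option K => o.elim (Finset.univ.image ε₀) fun k => Finset.univ.image (ε k))
    (fun o y => o.elim (G₀ (y ∘ ε₀)) fun k => G k (y ∘ ε k)) ?_ ?_ Finset.univ ?_ x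
  · simp only [Fintype.prod_option, Option.elim, Finset.univ_inter] at key
    refine key.trans_eq ?_
    rw [lmarginal_comp_injective hε₀ (hG₀.pow_const _)]
    congr 1
    refine Finset.prod_congr rfl fun k _ => ?_
    rw [lmarginal_comp_injective (hε k) ((hG k).pow_const _)]
  · rintro (_ | k)
    · exact hG₀.comp (by fun_prop)
    · exact (hG k).comp (by fun_prop)
  · rintro (_ | k) a b hab <;> simp only [Option.elim] at hab ⊢ <;> congr 1 <;> ext i <;>
      exact hab _ (by simp)
  · intro v _
    obtain ⟨k, l, hkl, h⟩ := htwo v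
    have h' : ∀ m : Option K, v ∈ m.elim (Finset.univ.image ε₀) (fun k => Finset.univ.image (ε k)) ↔
        m = k ∨ m = l := by
      intro m
      rw [← h]
      cases m <;> simp
    exact ⟨k, l, hkl, (h' k).2 (Or.inl rfl), (h' l).2 (Or.inr rfl), fun m => (h' m).1⟩

end Graph

section Contraction

variable {V : Type*} [DecidableEq V] {X : Type*} [MeasurableSpace X]

/-- The configuration on `V` with values `s` on the finite set `R` (listed by `R.equivFin`) and
values `y` off `R`. -/
noncomputable def glueArgs (R : Finset V) (y : {v : V // v ∉ R} → X) (s : Fin R.card → X) : V → X :=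
  fun v => if h : v ∈ R then s (R.equivFin ⟨v, h⟩) else y ⟨v, h⟩

lemma measurePreserving_glueArgs [Fintype V] (μ : Measure X) [SigmaFinite μ] (R : Finset V) :
    MeasurePreserving (fun p : ({v : V // v ∉ R} → X) × (Fin R.card → X) => glueArgs R p.1 p.2)
      ((Measure.pi fun _ => μ).prod (Measure.pi fun _ => μ)) (Measure.pi fun _ => μ) := by
  let φ : {v : V // v ∉ R} ⊕ Fin R.card ≃ V :=
    (Equiv.sumComm _ _).trans
      ((Equiv.sumCongr R.equivFin.symm (Equiv.refl _)).trans (Equiv.sumCompl (· ∈ R)))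
  have h := (measurePreserving_piCongrLeft (fun _ : V => μ) φ).comp
    (measurePreserving_sumPiEquivProdPi_symm (fun _ : {v : V // v ∉ R} ⊕ Fin R.card => μ))
  convert h using 1
  funext p v
  symm
  simp only [Function.comp_apply, MeasurableEquiv.coe_piCongrLeft]
  obtain ⟨w, rfl⟩ := φ.surjective v
  rw [Equiv.piCongrLeft_apply_apply]
  rcases w with w | w
  · have : φ (Sum.inl w) = w.1 := by simp [φ]
    rw [this, glueArgs, dif_neg w.2]; rfl
  · have : φ (Sum.inr w) = (R.equivFin.symm w).1 := by simp [φ]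
    rw [this, glueArgs, dif_pos (R.equivFin.symm w).2]
    simp; rfl

/-- Legs of a kernel indexed by an injection `ε` can be reordered so that those in `R` come last,
in the order of `R.equivFin`. -/
lemma exists_perm_glueArgs_eq_joinArgs {p : ℕ} {ε : Fin p → V} (hε : Function.Injective ε)
    (R : Finset V) (hR : ∀ v ∈ R, v ∈ Set.range ε) :
    ∃ (α : Fin (p - R.card) → {v : V // v ∉ R}) (σ : Equiv.Perm (Fin p)),
      Function.Injective α ∧ (∀ v, v ∈ Set.range α ↔ v.1 ∈ Set.range ε) ∧
      ∀ (y : {v : V // v ∉ R} → ℝ) (s : Fin R.card → ℝ),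
        (fun k => glueArgs R y s (ε (σ k))) = joinArgs p R.card (y ∘ α) s := by
  have hsub : R ⊆ Finset.univ.image ε := fun v hv => by simpa using hR v hv
  have hcardR : R.card ≤ p := by
    simpa [Finset.card_image_of_injective _ hε] using Finset.card_le_card hsub
  have hcard : (Finset.univ.image ε \ R).card = p - R.card := by
    rw [Finset.card_sdiff_of_subset hsub, Finset.card_image_of_injective _ hε]; simp
  let α₀ := (Finset.equivFinOfCardEq hcard).symm
  have hα₀ : ∀ j, (α₀ j).1 ∈ Set.range ε ∧ (α₀ j).1 ∉ R := fun j => by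
    have := (α₀ j).2
    rw [Finset.mem_sdiff] at this
    simpa using this
  let α : Fin (p - R.card) → {v : V // v ∉ R} := fun j => ⟨(α₀ j).1, (hα₀ j).2⟩
  have hα : Function.Injective α := fun i j h => by
    have : (α₀ i).1 = (α₀ j).1 := by simpa [α] using h
    exact α₀.injective (Subtype.ext this)
  let ι : Fin p → V := fun k =>
    if h : k.1 < p - R.card then (α ⟨k.1, h⟩).1
    else (R.equivFin.symm ⟨k.1 - (p - R.card), by omega⟩).1
  have hι : Function.Injective ι := by
    intro i j hij
    simp only [ι] at hij
    split_ifs at hij with h1 h2 h2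
    · have := hα (Subtype.ext hij)
      simpa [Fin.ext_iff] using this
    · exact absurd (hij ▸ (R.equivFin.symm _).2) (α _).2
    · exact absurd (hij ▸ (R.equivFin.symm _).2) (α _).2
    · have := R.equivFin.symm.injective (Subtype.ext hij)
      simp only [Fin.mk.injEq] at this
      ext; omega
  have hιε : ∀ k, ∃ i, ε i = ι k := by
    intro k
    simp only [ι]
    split_ifs with h
    · exact (hα₀ _).1
    · exact hR _ (R.equivFin.symm _).2
  choose σ hσ using hιε
  have hσinj : Function.Injective σ := fun i j h => hι (by rw [← hσ, ← hσ, h])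
  refine ⟨α, Equiv.ofBijective σ (Finite.injective_iff_bijective.1 hσinj), hα, ?_, ?_⟩
  · intro v
    constructor
    · rintro ⟨j, rfl⟩; exact (hα₀ j).1
    · intro hv
      refine ⟨α₀.symm ⟨v.1, by rw [Finset.mem_sdiff]; exact ⟨by simpa using hv, v.2⟩⟩, ?_⟩
      simp [α]
  · intro y s
    funext k
    simp only [Equiv.ofBijective_apply, hσ, joinArgs, glueArgs, ι]
    by_cases h : k.1 < p - R.card
    · simp only [dif_pos h, dif_neg (α ⟨k.1, h⟩).2]; rfl
    · simp only [dif_neg h, dif_pos (R.equivFin.symm _).2]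
      simp

/-- A kernel that is invariant under all permutations of its arguments, at every point. -/
def IsPointwiseSymmetric {q : ℕ} (f : (Fin q → ℝ) → ℝ) : Prop :=
  ∀ (σ : Equiv.Perm (Fin q)) (x : Fin q → ℝ), f (fun k => x (σ k)) = f x

lemma measurable_joinArgs (p r : ℕ) :
    Measurable fun z : (Fin (p - r) → ℝ) × (Fin r → ℝ) => joinArgs p r z.1 z.2 := by
  refine measurable_pi_lambda _ fun k => ?_
  unfold joinArgs
  split_ifs <;> fun_prop

lemma measurable_contraction (μ : Measure ℝ) [SigmaFinite μ] {p q : ℕ} (r : ℕ)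
    {f : (Fin p → ℝ) → ℝ} {g : (Fin q → ℝ) → ℝ} (hf : Measurable f) (hg : Measurable g) :
    Measurable (contraction μ p q r f g) := by
  refine StronglyMeasurable.measurable (StronglyMeasurable.integral_prod_right' (f := fun z :
    ((Fin (p - r) → ℝ) × (Fin (q - r) → ℝ)) × (Fin r → ℝ) =>
      f (joinArgs p r z.1.1 z.2) * g (joinArgs q r z.1.2 z.2)) ?_)
  refine Measurable.stronglyMeasurable (Measurable.mul ?_ ?_)
  · exact hf.comp ((measurable_joinArgs p r).comp
      (Measurable.prodMk measurable_fst.fst measurable_snd))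
  · exact hg.comp ((measurable_joinArgs q r).comp
      (Measurable.prodMk measurable_fst.snd measurable_snd))

lemma enorm_finsetProd {κ : Type*} (s : Finset κ) (a : κ → ℝ) :
    ‖∏ k ∈ s, a k‖ₑ = ∏ k ∈ s, ‖a k‖ₑ := by
  classical
  induction s using Finset.induction_on with
  | empty => simp
  | insert k s hk ih => rw [Finset.prod_insert hk, Finset.prod_insert hk, enorm_mul, ih]

lemma eLpNorm_two_eq_lintegral_rpow {α : Type*} [MeasurableSpace α] (ν : Measure α) (f : α → ℝ) :
    eLpNorm f 2 ν = (∫⁻ x, ‖f x‖ₑ ^ (2 : ℝ) ∂ν) ^ (1 / 2 : ℝ) := by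
  rw [eLpNorm_eq_lintegral_rpow_enorm_toReal (by simp) (by simp)]; simp

variable {K : Type*} [Fintype K] [Fintype V] {μ : Measure ℝ} [SigmaFinite μ]
  {q : K → ℕ} {ε : ∀ k, Fin (q k) → V} {f : ∀ k, (Fin (q k) → ℝ) → ℝ}

/-- Every variable occurs in exactly two of the kernels. -/
def IsTwoRegular (ε : ∀ k, Fin (q k) → V) : Prop :=
  ∀ v, ∃ k l, k ≠ l ∧ v ∈ Set.range (ε k) ∧ v ∈ Set.range (ε l) ∧
    ∀ m, v ∈ Set.range (ε m) → m = k ∨ m = l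

theorem enorm_integral_prod_comp_le_prod_eLpNorm (hε : ∀ k, Function.Injective (ε k))
    (htwo : IsTwoRegular ε) (hf : ∀ k, Measurable (f k)) :
    ‖∫ x, ∏ k, f k (fun i => x (ε k i)) ∂(Measure.pi fun _ : V => μ)‖ₑ ≤
      ∏ k, eLpNorm (f k) 2 (Measure.pi fun _ : Fin (q k) => μ) := by
  refine (enorm_integral_le_lintegral_enorm _).trans ?_
  simp_rw [eLpNorm_two_eq_lintegral_rpow, enorm_finsetProd]
  exact lintegral_prod_comp_le_prod_sq (fun k => Fin (q k)) ε hε htwo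
    (fun k z => ‖f k z‖ₑ) (fun k => (hf k).enorm)

/-- The graph inequality improves when the kernels at two vertices `k₀`, `l₀` are first contracted
along all the edges `R` joining them: the graph with these two vertices merged again has no loops,
so that the general inequality applies to it. -/
theorem enorm_integral_prod_comp_le_contractionNorm [DecidableEq K]
    (hε : ∀ k, Function.Injective (ε k))
    (htwo : IsTwoRegular ε) (hf : ∀ k, Measurable (f k)) {k₀ l₀ : K} (hkl : k₀ ≠ l₀)
    (hk₀ : IsPointwiseSymmetric (f k₀)) (hl₀ : IsPointwiseSymmetric (f l₀))
    (hint : Integrable (fun x : V → ℝ => ∏ k, f k (fun i => x (ε k i))) (Measure.pi fun _ => μ)) :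
    ‖∫ x, ∏ k, f k (fun i => x (ε k i)) ∂(Measure.pi fun _ : V => μ)‖ₑ ≤
      contractionNorm μ (q k₀) (q l₀) (Finset.univ.image (ε k₀) ∩ Finset.univ.image (ε l₀)).card
          (f k₀) (f l₀) *
        ∏ m : {m // m ≠ k₀ ∧ m ≠ l₀}, eLpNorm (f m) 2 (Measure.pi fun _ : Fin (q m) => μ) := by
  classical
  set R := Finset.univ.image (ε k₀) ∩ Finset.univ.image (ε l₀) with hRdef
  have hR : ∀ v, v ∈ R ↔ v ∈ Set.range (ε k₀) ∧ v ∈ Set.range (ε l₀) := by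
    intro v; simp [hRdef]
  obtain ⟨α, σ, hα, hαr, hασ⟩ := exists_perm_glueArgs_eq_joinArgs (hε k₀) R
    fun v hv => ((hR v).1 hv).1
  obtain ⟨α', σ', hα', hαr', hασ'⟩ := exists_perm_glueArgs_eq_joinArgs (hε l₀) R
    fun v hv => ((hR v).1 hv).2
  -- the legs of the other vertices avoid `R`
  have hoff : ∀ (m : {m // m ≠ k₀ ∧ m ≠ l₀}) i, ε m i ∉ R := by
    rintro ⟨m, hmk, hml⟩ i hi
    obtain ⟨h1, h2⟩ := (hR _).1 hi
    obtain ⟨k, l, -, -, -, hkl'⟩ := htwo (ε m i)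
    have a1 := hkl' _ h1
    have a2 := hkl' _ h2
    have a3 := hkl' m ⟨i, rfl⟩
    grind
  have hprod : ∀ y s, ∏ k, f k (fun i => glueArgs R y s (ε k i)) =
      (f k₀ (joinArgs (q k₀) R.card (y ∘ α) s) * f l₀ (joinArgs (q l₀) R.card (y ∘ α') s)) *
        ∏ m : {m // m ≠ k₀ ∧ m ≠ l₀}, f m (fun i => y ⟨ε m i, hoff m i⟩) := by
    intro y s
    have e1 : f k₀ (fun i => glueArgs R y s (ε k₀ i)) =
        f k₀ (joinArgs (q k₀) R.card (y ∘ α) s) := by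
      rw [← hασ, ← hk₀ σ]
    have e2 : f l₀ (fun i => glueArgs R y s (ε l₀ i)) =
        f l₀ (joinArgs (q l₀) R.card (y ∘ α') s) := by
      rw [← hασ', ← hl₀ σ']
    rw [← e1, ← e2, mul_assoc, ← Finset.mul_prod_erase _ _ (Finset.mem_univ k₀),
      ← Finset.mul_prod_erase _ _ (show l₀ ∈ Finset.univ.erase k₀ by simp [hkl.symm])]
    congr 2
    rw [Finset.prod_subtype (p := fun m => m ≠ k₀ ∧ m ≠ l₀) _ (by intro m; simp [and_comm])]
    refine Finset.prod_congr rfl fun m _ => ?_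
    congr 1
    funext i
    rw [glueArgs, dif_neg (hoff m i)]
  have hmp := measurePreserving_glueArgs μ R
  have hint' : Integrable (fun p : ({v : V // v ∉ R} → ℝ) × (Fin R.card → ℝ) =>
      ∏ k, f k (fun i => glueArgs R p.1 p.2 (ε k i)))
      ((Measure.pi fun _ => μ).prod (Measure.pi fun _ => μ)) :=
    hmp.integrable_comp_of_integrable hint
  rw [← hmp.map_eq] at hint ⊢
  rw [integral_map hmp.measurable.aemeasurable hint.aestronglyMeasurable, integral_prod _ hint']
  simp_rw [hprod, integral_mul_const]
  refine (enorm_integral_le_lintegral_enorm _).trans ?_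
  simp_rw [enorm_mul, enorm_finsetProd]
  -- the merged graph: `none` is the vertex obtained from `k₀` and `l₀`
  have hmeas : Measurable fun z : Fin (q k₀ - R.card) ⊕ Fin (q l₀ - R.card) → ℝ =>
      ‖contraction μ (q k₀) (q l₀) R.card (f k₀) (f l₀) (z ∘ Sum.inl, z ∘ Sum.inr)‖ₑ :=
    ((measurable_contraction μ R.card (hf k₀) (hf l₀)).comp (by fun_prop)).enorm
  have key := lintegral_mul_prod_comp_le (μ := μ) (K := {m // m ≠ k₀ ∧ m ≠ l₀})
    (fun m => Fin (q m)) (Sum.elim α α') (fun m i => ⟨ε m i, hoff m i⟩) ?_ ?_ ?_ _ hmeas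
    (fun m z => ‖f m z‖ₑ) (fun m => (hf m).enorm)
  · refine le_trans (le_of_eq rfl) (key.trans (le_of_eq ?_))
    simp_rw [contractionNorm, eLpNorm_two_eq_lintegral_rpow]
    congr 2
    exact (measurePreserving_sumPiEquivProdPi
      (fun _ : Fin (q k₀ - R.card) ⊕ Fin (q l₀ - R.card) => μ)).lintegral_comp
        (((measurable_contraction μ R.card (hf k₀) (hf l₀)).enorm).pow_const _)
  · refine Function.Injective.sumElim hα hα' fun i j hij => ?_
    refine (α i).2 ((hR _).2 ⟨(hαr _).1 ⟨i, rfl⟩, (hαr' _).1 ⟨j, ?_⟩⟩)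
    exact hij.symm
  · intro m i j hij
    exact hε m (by simpa using hij)
  · intro v
    have hnone : v ∈ Set.range (Sum.elim α α') ↔
        v.1 ∈ Set.range (ε k₀) ∨ v.1 ∈ Set.range (ε l₀) := by
      rw [← hαr, ← hαr']
      exact Set.ext_iff.1 (Set.Sum.elim_range α α') v
    have hsome : ∀ m : {m // m ≠ k₀ ∧ m ≠ l₀}, v ∈ Set.range
        (fun i => (⟨ε m i, hoff m i⟩ : {v : V // v ∉ R})) ↔ v.1 ∈ Set.range (ε m) := by
      intro m
      constructor
      · rintro ⟨i, rfl⟩; exact ⟨i, rfl⟩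
      · rintro ⟨i, hi⟩; exact ⟨i, Subtype.ext hi⟩
    obtain ⟨k, l, hne, hk, hl, hm⟩ := htwo v
    have hm' : ∀ m, v.1 ∈ Set.range (ε m) ↔ m = k ∨ m = l := fun m =>
      ⟨hm m, by rintro (rfl | rfl) <;> assumption⟩
    have hvR : ¬ ((k₀ = k ∨ k₀ = l) ∧ (l₀ = k ∨ l₀ = l)) := fun h =>
      v.2 ((hR _).2 ⟨(hm' _).2 h.1, (hm' _).2 h.2⟩)
    let c : K → Option {m // m ≠ k₀ ∧ m ≠ l₀} := fun k =>
      if h : k ≠ k₀ ∧ k ≠ l₀ then some ⟨k, h⟩ else none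
    have hcn : ∀ k, c k = none ↔ k = k₀ ∨ k = l₀ := by
      intro k; simp only [c]; split_ifs <;> grind
    have hcs : ∀ k (m : {m // m ≠ k₀ ∧ m ≠ l₀}), c k = some m ↔ k = m := by
      intro k m
      simp only [c]
      split_ifs with h
      · simp [Subtype.ext_iff]
      · have := m.2
        simp only [false_iff]
        grind
    refine ⟨c k, c l, ?_, ?_⟩
    · intro hckl
      cases hcl : c l with
      | none => rw [hcl, hcn] at hckl; rw [hcn] at hcl; grind
      | some m => rw [hcl, hcs] at hckl; rw [hcs] at hcl; exact hne (hckl.trans hcl.symm)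
    · rintro (_ | m)
      · simp only [Option.elim]
        rw [hnone, hm', hm', eq_comm (b := c k), eq_comm (b := c l), hcn, hcn]
        grind
      · simp only [Option.elim]
        rw [hsome, hm', eq_comm (b := c k), eq_comm (b := c l), hcs, hcs]
        grind

end Contraction

/-! ### The diagram formula -/

section Diagram

/-- The step function `∑ₘ cₘ 1_{A_{m,1} × ⋯ × A_{m,q}}`. -/
noncomputable def stepKernel {n q : ℕ} (c : Fin n → ℝ) (A : Fin n → Fin q → Set ℝ) :
    (Fin q → ℝ) → ℝ :=
  fun x => ∑ m, c m * ∏ k, (A m k).indicator (fun _ => (1 : ℝ)) (x k)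

lemma measurable_stepKernel {n q : ℕ} (c : Fin n → ℝ) {A : Fin n → Fin q → Set ℝ}
    (hA : ∀ m k, MeasurableSet (A m k)) : Measurable (stepKernel c A) := by
  unfold stepKernel
  refine Finset.measurable_sum _ fun m _ => Measurable.const_mul ?_ _
  exact Finset.measurable_prod _ fun k _ =>
    (measurable_const.indicator (hA m k)).comp (measurable_pi_apply k)

/-- Step functions built from off-diagonal rectangles vanish on the diagonals. -/
lemma stepKernel_eq_zero_of_eq {n q : ℕ} (c : Fin n → ℝ) {A : Fin n → Fin q → Set ℝ}
    (hA : ∀ m k l, k ≠ l → Disjoint (A m k) (A m l)) {x : Fin q → ℝ} {i j : Fin q} (hij : i ≠ j)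
    (hx : x i = x j) : stepKernel c A x = 0 := by
  refine Finset.sum_eq_zero fun m _ => ?_
  by_cases h : x i ∈ A m i
  · have : x j ∉ A m j := fun h' => Set.disjoint_left.1 (hA m i j hij) h (hx ▸ h')
    rw [Finset.prod_eq_zero (Finset.mem_univ j) (by simp [this]), mul_zero]
  · rw [Finset.prod_eq_zero (Finset.mem_univ i) (by simp [h]), mul_zero]

variable {K : Type*} [Fintype K] [DecidableEq K] {q n : K → ℕ} {c : ∀ k, Fin (n k) → ℝ}
  {A : ∀ k, Fin (n k) → Fin (q k) → Set ℝ} {μ : Measure ℝ} [SigmaFinite μ] {N : ℕ}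

/-- The edge of the pairing `e` to which the leg `i` of the vertex `k` belongs. -/
def edgeOf (e : Fin N × Bool ≃ Σ k, Fin (q k)) (k : K) (i : Fin (q k)) : Fin N := (e.symm ⟨k, i⟩).1

lemma prod_stepKernel_edgeOf (e : Fin N × Bool ≃ Σ k, Fin (q k)) (x : Fin N → ℝ) :
    ∏ k, stepKernel (c k) (A k) (fun i => x (edgeOf e k i)) =
      ∑ φ : ∀ k, Fin (n k), (∏ k, c k (φ k)) * ∏ v, (A (e (v, false)).1 (φ _) (e (v, false)).2 ∩
        A (e (v, true)).1 (φ _) (e (v, true)).2).indicator (fun _ => (1 : ℝ)) (x v) := by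
  simp only [stepKernel]
  rw [Finset.prod_univ_sum]
  simp only [Fintype.piFinset_univ]
  refine Finset.sum_congr rfl fun φ _ => ?_
  rw [Finset.prod_mul_distrib]
  congr 1
  rw [← Fintype.prod_sigma' (fun k i =>
      (A k (φ k) i).indicator (fun _ => (1 : ℝ)) (x (edgeOf e k i))),
    ← e.prod_comp, Fintype.prod_prod_type]
  refine Finset.prod_congr rfl fun v _ => ?_
  have hv : ∀ b, edgeOf e (e (v, b)).1 (e (v, b)).2 = v := fun b => by simp [edgeOf]
  simp only [Fintype.prod_bool, hv, Set.indicator, Set.mem_inter_iff]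
  split_ifs <;> simp_all

lemma integrable_prod_indicator {B : Fin N → Set ℝ} (hB : ∀ v, MeasurableSet (B v))
    (hB' : ∀ v, μ (B v) < ∞) :
    Integrable (fun x : Fin N → ℝ => ∏ v, (B v).indicator (fun _ => (1 : ℝ)) (x v))
      (Measure.pi fun _ => μ) :=
  Integrable.fintype_prod fun v => (integrable_indicator_iff (hB v)).2
    (integrableOn_const (hB' v).ne)

lemma integral_prod_indicator {B : Fin N → Set ℝ} (hB : ∀ v, MeasurableSet (B v)) :
    ∫ x, ∏ v, (B v).indicator (fun _ => (1 : ℝ)) (x v) ∂(Measure.pi fun _ : Fin N => μ) =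
      ∏ v, μ.real (B v) := by
  rw [integral_fintype_prod_eq_prod (fun v y => (B v).indicator (fun _ => (1 : ℝ)) y)]
  refine Finset.prod_congr rfl fun v _ => ?_
  rw [integral_indicator_const _ (hB v)]; simp

lemma integrable_prod_stepKernel_edgeOf
    (hA : ∀ k m i, MeasurableSet (A k m i) ∧ μ (A k m i) < ∞)
    (e : Fin N × Bool ≃ Σ k, Fin (q k)) :
    Integrable (fun x : Fin N → ℝ => ∏ k, stepKernel (c k) (A k) (fun i => x (edgeOf e k i)))
      (Measure.pi fun _ => μ) := by
  simp_rw [prod_stepKernel_edgeOf]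
  refine integrable_finsetSum _ fun φ _ => Integrable.const_mul ?_ _
  exact integrable_prod_indicator (fun v => (hA _ _ _).1.inter (hA _ _ _).1)
    fun v => (measure_mono Set.inter_subset_left).trans_lt (hA _ _ _).2

variable {E : Type*} [NormedAddCommGroup E] [NormedSpace ℝ E] [MeasurableSpace E] [BorelSpace E]
  {Q : Measure E} [IsGaussian Q] {L : ∀ k, Fin (n k) → Fin (q k) → StrongDual ℝ E}
  {ρ : (Σ k, Fin (q k)) → (Σ k, Fin (q k)) → ℝ}

lemma prod_sum_mul_prod_dual (x : E) :
    ∏ k, ∑ m, c k m * ∏ i, L k m i x =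
      ∑ φ : ∀ k, Fin (n k), (∏ k, c k (φ k)) * ∏ s : Σ k, Fin (q k), L s.1 (φ s.1) s.2 x := by
  rw [Finset.prod_univ_sum]
  simp only [Fintype.piFinset_univ]
  refine Finset.sum_congr rfl fun φ _ => ?_
  rw [Finset.prod_mul_distrib, Fintype.prod_sigma]

lemma memLp_prod_sum_mul_prod_dual (p : ℝ≥0∞) (hp : p ≠ ∞) :
    MemLp (fun x => ∏ k, ∑ m, c k m * ∏ i, L k m i x) p Q := by
  simp_rw [prod_sum_mul_prod_dual]
  exact memLp_finsetSum _ fun φ _ => (memLp_prod_dual _ _ p hp).const_mul _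

/-- **Diagram formula**: the expectation of a product of off-diagonal homogeneous forms in jointly
Gaussian variables, the `(k, i)`-th variables being correlated with the `(l, j)`-th ones as a
Gaussian random measure is, up to a factor `ρ`. It is a sum over all pairings of the legs of the
integrals obtained by identifying the arguments of the kernels along the pairs. -/
theorem integral_prod_form_eq_sum_pairings (h0 : ∀ L : StrongDual ℝ E, ∫ x, L x ∂Q = 0)
    (hA : ∀ k m i, MeasurableSet (A k m i) ∧ μ (A k m i) < ∞)
    (hcov : ∀ s t m m', ∫ x, L s.1 m s.2 x * L t.1 m' t.2 x ∂Q =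
      ρ s t * μ.real (A s.1 m s.2 ∩ A t.1 m' t.2))
    (hN : Fintype.card (Σ k, Fin (q k)) = 2 * N) :
    ∫ x, ∏ k, ∑ m, c k m * ∏ i, L k m i x ∂Q =
      wickConst N * ∑ e : Fin N × Bool ≃ Σ k, Fin (q k),
        (∏ v, ρ (e (v, false)) (e (v, true))) *
          ∫ x, ∏ k, stepKernel (c k) (A k) (fun i => x (edgeOf e k i))
            ∂(Measure.pi fun _ : Fin N => μ) := by
  simp_rw [prod_sum_mul_prod_dual, prod_stepKernel_edgeOf]
  rw [integral_finsetSum _ fun φ _ => (integrable_prod_dual _ _).const_mul _]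
  have h1 : ∀ e : Fin N × Bool ≃ Σ k, Fin (q k),
      ∫ x, ∑ φ : ∀ k, Fin (n k), (∏ k, c k (φ k)) *
          ∏ v, (A (e (v, false)).1 (φ _) (e (v, false)).2 ∩
        A (e (v, true)).1 (φ _) (e (v, true)).2).indicator (fun _ => (1 : ℝ)) (x v)
          ∂(Measure.pi fun _ : Fin N => μ) =
      ∑ φ : ∀ k, Fin (n k), (∏ k, c k (φ k)) *
          ∏ v, μ.real (A (e (v, false)).1 (φ _) (e (v, false)).2 ∩
        A (e (v, true)).1 (φ _) (e (v, true)).2) := by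
    intro e
    rw [integral_finsetSum]
    · refine Finset.sum_congr rfl fun φ _ => ?_
      rw [integral_const_mul, integral_prod_indicator fun v => (hA _ _ _).1.inter (hA _ _ _).1]
    · exact fun φ _ => (integrable_prod_indicator (fun v => (hA _ _ _).1.inter (hA _ _ _).1)
        fun v => (measure_mono Set.inter_subset_left).trans_lt (hA _ _ _).2).const_mul _
  simp_rw [h1, Finset.mul_sum]
  rw [Finset.sum_comm]
  refine Finset.sum_congr rfl fun φ _ => ?_
  rw [integral_const_mul, integral_prod_dual_eq_sum_pairings h0 _ hN, Finset.mul_sum,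
    Finset.mul_sum]
  refine Finset.sum_congr rfl fun e _ => ?_
  simp_rw [hcov, Finset.prod_mul_distrib]
  ring

/-- If the pairing `e` never pairs two legs of the same vertex, it is a graph in which every edge
joins exactly two vertices. -/
lemma isTwoRegular_edgeOf (e : Fin N × Bool ≃ Σ k, Fin (q k))
    (he : ∀ k, Function.Injective (edgeOf e k)) : IsTwoRegular (edgeOf e) := by
  intro v
  have hedge : ∀ b, edgeOf e (e (v, b)).1 (e (v, b)).2 = v := by
    intro b; simp [edgeOf]
  refine ⟨(e (v, false)).1, (e (v, true)).1, ?_, ⟨_, hedge false⟩, ⟨_, hedge true⟩, ?_⟩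
  · intro h
    generalize hs : e (v, false) = s at h
    generalize ht : e (v, true) = t at h
    obtain ⟨k, i⟩ := s
    obtain ⟨l, j⟩ := t
    obtain rfl : k = l := h
    have h1 := hedge false
    have h2 := hedge true
    rw [hs] at h1
    rw [ht] at h2
    have h3 : i = j := he k (h1.trans h2.symm)
    rw [h3, ← ht] at hs
    simpa using e.injective hs
  · rintro m ⟨i, hi⟩
    have h1 : e (v, (e.symm ⟨m, i⟩).2) = ⟨m, i⟩ := by
      rw [← hi]; simp [edgeOf]
    cases hb : (e.symm ⟨m, i⟩).2 <;> rw [hb] at h1 <;> simp [h1]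

lemma prod_stepKernel_edgeOf_eq_zero (hA : ∀ k m i j, i ≠ j → Disjoint (A k m i) (A k m j))
    (e : Fin N × Bool ≃ Σ k, Fin (q k)) {k : K} (he : ¬ Function.Injective (edgeOf e k))
    (x : Fin N → ℝ) : ∏ k, stepKernel (c k) (A k) (fun i => x (edgeOf e k i)) = 0 := by
  simp only [Function.Injective, not_forall] at he
  obtain ⟨i, j, hij, hne⟩ := he
  exact Finset.prod_eq_zero (Finset.mem_univ k)
    (stepKernel_eq_zero_of_eq _ (hA k) hne (by rw [hij]))

lemma enorm_integral_stepKernel_edgeOf_le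
    (hA : ∀ k m i, MeasurableSet (A k m i) ∧ μ (A k m i) < ∞)
    (hA' : ∀ k m i j, i ≠ j → Disjoint (A k m i) (A k m j)) (e : Fin N × Bool ≃ Σ k, Fin (q k)) :
    ‖∫ x, ∏ k, stepKernel (c k) (A k) (fun i => x (edgeOf e k i))
      ∂(Measure.pi fun _ : Fin N => μ)‖ₑ ≤
      ∏ k, eLpNorm (stepKernel (c k) (A k)) 2 (Measure.pi fun _ => μ) := by
  by_cases he : ∀ k, Function.Injective (edgeOf e k)
  · exact enorm_integral_prod_comp_le_prod_eLpNorm he (isTwoRegular_edgeOf e he)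
      fun k => measurable_stepKernel _ fun m i => (hA k m i).1
  · push Not at he
    obtain ⟨k, hk⟩ := he
    simp [prod_stepKernel_edgeOf_eq_zero hA' e hk]

/-- The sum of the norms of all the contractions of positive order of two kernels. -/
noncomputable def sumContractionNorm (μ : Measure ℝ) {p q : ℕ} (f : (Fin p → ℝ) → ℝ)
    (g : (Fin q → ℝ) → ℝ) : ℝ≥0∞ :=
  ∑ r ∈ Finset.Icc 1 (min p q), contractionNorm μ p q r f g

lemma enorm_integral_stepKernel_edgeOf_le_contraction
    (hA : ∀ k m i, MeasurableSet (A k m i) ∧ μ (A k m i) < ∞)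
    (hA' : ∀ k m i j, i ≠ j → Disjoint (A k m i) (A k m j)) (e : Fin N × Bool ≃ Σ k, Fin (q k))
    {k₀ l₀ : K} (hkl : k₀ ≠ l₀) (hk₀ : IsPointwiseSymmetric (stepKernel (c k₀) (A k₀)))
    (hl₀ : IsPointwiseSymmetric (stepKernel (c l₀) (A l₀))) {i : Fin (q k₀)} {j : Fin (q l₀)}
    (hij : edgeOf e k₀ i = edgeOf e l₀ j) :
    ‖∫ x, ∏ k, stepKernel (c k) (A k) (fun i => x (edgeOf e k i))
      ∂(Measure.pi fun _ : Fin N => μ)‖ₑ ≤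
      sumContractionNorm μ (stepKernel (c k₀) (A k₀)) (stepKernel (c l₀) (A l₀)) *
      ∏ m : {m // m ≠ k₀ ∧ m ≠ l₀},
        eLpNorm (stepKernel (c m) (A m)) 2 (Measure.pi fun _ => μ) := by
  by_cases he : ∀ k, Function.Injective (edgeOf e k)
  · refine (enorm_integral_prod_comp_le_contractionNorm (f := fun k => stepKernel (c k) (A k))
      he (isTwoRegular_edgeOf e he) (fun k => measurable_stepKernel _ fun m i => (hA k m i).1)
      hkl hk₀ hl₀ (integrable_prod_stepKernel_edgeOf hA e)).trans ?_
    gcongr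
    rw [sumContractionNorm]
    refine Finset.single_le_sum (f := fun r => contractionNorm μ (q k₀) (q l₀) r
      (stepKernel (c k₀) (A k₀)) (stepKernel (c l₀) (A l₀))) (fun _ _ => zero_le) ?_
    rw [Finset.mem_Icc, Nat.one_le_iff_ne_zero, Finset.card_ne_zero, le_min_iff]
    refine ⟨⟨edgeOf e k₀ i, ?_⟩, ?_, ?_⟩
    · simp only [Finset.mem_inter, Finset.mem_image, Finset.mem_univ, true_and]
      exact ⟨⟨i, rfl⟩, ⟨j, hij.symm⟩⟩
    · refine (Finset.card_le_card Finset.inter_subset_left).trans ?_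
      simpa using Finset.card_image_le (s := Finset.univ) (f := edgeOf e k₀)
    · refine (Finset.card_le_card Finset.inter_subset_right).trans ?_
      simpa using Finset.card_image_le (s := Finset.univ) (f := edgeOf e l₀)
  · push Not at he
    obtain ⟨k, hk⟩ := he
    simp [prod_stepKernel_edgeOf_eq_zero hA' e hk]

/-- `d!`, which for even `d` is the number of labelled oriented pairings of `d` points, weighted by
the Wick constant. -/
noncomputable def pairingBound (d : ℕ) : ℝ≥0∞ := ENNReal.ofReal (wickConst (d / 2) * d.factorial)

lemma enorm_integral_prod_form_le_of_forall_pairing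
    (h0 : ∀ L : StrongDual ℝ E, ∫ x, L x ∂Q = 0)
    (hA : ∀ k m i, MeasurableSet (A k m i) ∧ μ (A k m i) < ∞)
    (hcov : ∀ s t m m', ∫ x, L s.1 m s.2 x * L t.1 m' t.2 x ∂Q =
      ρ s t * μ.real (A s.1 m s.2 ∩ A t.1 m' t.2))
    (hρ : ∀ s t, |ρ s t| ≤ 1) (C : ℝ≥0∞)
    (hC : ∀ (N : ℕ) (e : Fin N × Bool ≃ Σ k, Fin (q k)),
      (∀ v, ρ (e (v, false)) (e (v, true)) ≠ 0) →
      ‖∫ x, ∏ k, stepKernel (c k) (A k) (fun i => x (edgeOf e k i))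
        ∂(Measure.pi fun _ : Fin N => μ)‖ₑ ≤ C) :
    ‖∫ x, ∏ k, ∑ m, c k m * ∏ i, L k m i x ∂Q‖ₑ ≤
      pairingBound (Fintype.card (Σ k, Fin (q k))) * C := by
  rcases Nat.even_or_odd' (Fintype.card (Σ k, Fin (q k))) with ⟨N, hN | hN⟩
  · rw [integral_prod_form_eq_sum_pairings h0 hA hcov hN, enorm_mul, pairingBound,
      ENNReal.ofReal_mul (wickConst_pos _).le, mul_assoc, hN, Nat.mul_div_cancel_left _ two_pos,
      Real.enorm_of_nonneg (wickConst_pos _).le]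
    gcongr
    refine (enorm_sum_le _ _).trans ?_
    have hterm : ∀ e : Fin N × Bool ≃ Σ k, Fin (q k),
        ‖(∏ v, ρ (e (v, false)) (e (v, true))) *
          ∫ x, ∏ k, stepKernel (c k) (A k) (fun i => x (edgeOf e k i))
            ∂(Measure.pi fun _ : Fin N => μ)‖ₑ ≤ C := by
      intro e
      by_cases hz : ∀ v, ρ (e (v, false)) (e (v, true)) ≠ 0
      · rw [enorm_mul, enorm_finsetProd]
        refine (mul_le_mul' (Finset.prod_le_one' fun v _ => ?_) (hC N e hz)).trans_eq (one_mul C)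
        rw [Real.enorm_eq_ofReal_abs]
        exact ENNReal.ofReal_le_one.2 (hρ _ _)
      · push Not at hz
        obtain ⟨v, hv⟩ := hz
        rw [Finset.prod_eq_zero (Finset.mem_univ v) hv]
        simp
    refine (Finset.sum_le_sum fun e _ => hterm e).trans_eq ?_
    have e₀ : Fin N × Bool ≃ Σ k, Fin (q k) :=
      Fintype.equivOfCardEq (by rw [hN]; simp [mul_comm])
    rw [Finset.sum_const, Finset.card_univ, Fintype.card_equiv e₀]
    simp [mul_comm]
  · have : ∫ x, ∏ k, ∑ m, c k m * ∏ i, L k m i x ∂Q = 0 := by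
      simp_rw [prod_sum_mul_prod_dual]
      rw [integral_finsetSum _ fun φ _ => (integrable_prod_dual _ _).const_mul _]
      refine Finset.sum_eq_zero fun φ _ => ?_
      rw [integral_const_mul, integral_prod_dual_eq_zero_of_odd h0 _ (hN ▸ odd_two_mul_add_one N),
        mul_zero]
    simp [this]

/-- Moments of off-diagonal forms are controlled by the norms of the kernels: Cauchy–Schwarz is
applied to each diagram. -/
theorem enorm_integral_prod_form_le (h0 : ∀ L : StrongDual ℝ E, ∫ x, L x ∂Q = 0)
    (hA : ∀ k m i, MeasurableSet (A k m i) ∧ μ (A k m i) < ∞)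
    (hA' : ∀ k m i j, i ≠ j → Disjoint (A k m i) (A k m j))
    (hcov : ∀ s t m m', ∫ x, L s.1 m s.2 x * L t.1 m' t.2 x ∂Q =
      ρ s t * μ.real (A s.1 m s.2 ∩ A t.1 m' t.2))
    (hρ : ∀ s t, |ρ s t| ≤ 1) :
    ‖∫ x, ∏ k, ∑ m, c k m * ∏ i, L k m i x ∂Q‖ₑ ≤
      pairingBound (Fintype.card (Σ k, Fin (q k))) *
        ∏ k, eLpNorm (stepKernel (c k) (A k)) 2 (Measure.pi fun _ => μ) :=
  enorm_integral_prod_form_le_of_forall_pairing h0 hA hcov hρ _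
    fun _ e _ => enorm_integral_stepKernel_edgeOf_le hA hA' e

/-- If the leg `i` of the vertex `k₀` is only correlated with the leg `j` of another vertex `l₀`,
then the two vertices are joined in every diagram that contributes, and the expectation is
controlled by the contractions of the two kernels. -/
theorem enorm_integral_prod_form_le_contraction (h0 : ∀ L : StrongDual ℝ E, ∫ x, L x ∂Q = 0)
    (hA : ∀ k m i, MeasurableSet (A k m i) ∧ μ (A k m i) < ∞)
    (hA' : ∀ k m i j, i ≠ j → Disjoint (A k m i) (A k m j))
    (hcov : ∀ s t m m', ∫ x, L s.1 m s.2 x * L t.1 m' t.2 x ∂Q =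
      ρ s t * μ.real (A s.1 m s.2 ∩ A t.1 m' t.2))
    (hρ : ∀ s t, |ρ s t| ≤ 1) {k₀ l₀ : K} (hkl : k₀ ≠ l₀)
    (hk₀ : IsPointwiseSymmetric (stepKernel (c k₀) (A k₀)))
    (hl₀ : IsPointwiseSymmetric (stepKernel (c l₀) (A l₀))) (i : Fin (q k₀)) (j : Fin (q l₀))
    (hforce : ∀ t : Σ k, Fin (q k), t ≠ ⟨k₀, i⟩ → t ≠ ⟨l₀, j⟩ →
      ρ ⟨k₀, i⟩ t = 0 ∧ ρ t ⟨k₀, i⟩ = 0) :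
    ‖∫ x, ∏ k, ∑ m, c k m * ∏ i, L k m i x ∂Q‖ₑ ≤
      pairingBound (Fintype.card (Σ k, Fin (q k))) *
        (sumContractionNorm μ (stepKernel (c k₀) (A k₀)) (stepKernel (c l₀) (A l₀)) *
        ∏ m : {m // m ≠ k₀ ∧ m ≠ l₀},
          eLpNorm (stepKernel (c m) (A m)) 2 (Measure.pi fun _ => μ)) := by
  refine enorm_integral_prod_form_le_of_forall_pairing h0 hA hcov hρ _ fun N e he => ?_
  refine enorm_integral_stepKernel_edgeOf_le_contraction hA hA' e hkl hk₀ hl₀ (i := i) (j := j) ?_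
  obtain ⟨⟨v, b⟩, hv⟩ := e.surjective ⟨k₀, i⟩
  have h1 : e (v, !b) = ⟨l₀, j⟩ := by
    by_contra hne
    have hne' : e (v, !b) ≠ ⟨k₀, i⟩ := by
      rw [← hv]
      exact fun h => by simpa using e.injective h
    cases b
    · exact he v (by rw [hv]; exact (hforce _ hne' hne).1)
    · exact he v (by rw [hv]; exact (hforce _ hne' hne).2)
  simp [edgeOf, ← hv, ← h1]

lemma eLpNorm_two_sq {α : Type*} [MeasurableSpace α] (ν : Measure α) (f : α → ℝ) :
    eLpNorm f 2 ν ^ 2 = ∫⁻ x, ‖f x‖ₑ ^ 2 ∂ν := by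
  rw [eLpNorm_two_eq_lintegral_rpow, ← ENNReal.rpow_natCast, ← ENNReal.rpow_mul]
  norm_num

lemma eLpNorm_two_sq_eq_ofReal {α : Type*} [MeasurableSpace α] {ν : Measure α} {f : α → ℝ}
    (hf : MemLp f 2 ν) : eLpNorm f 2 ν ^ 2 = ENNReal.ofReal (∫ x, f x ^ 2 ∂ν) := by
  rw [eLpNorm_two_sq, ofReal_integral_eq_lintegral_ofReal hf.integrable_sq
    (.of_forall fun x => sq_nonneg _)]
  refine lintegral_congr fun x => ?_
  rw [← enorm_pow, Real.enorm_of_nonneg (sq_nonneg _)]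

lemma memLp_stepKernel {n q : ℕ} (c : Fin n → ℝ) {A : Fin n → Fin q → Set ℝ}
    (hA : ∀ m i, MeasurableSet (A m i) ∧ μ (A m i) < ∞) :
    MemLp (stepKernel c A) 2 (Measure.pi fun _ => μ) := by
  refine memLp_finsetSum _ fun m _ => MemLp.const_mul ?_ _
  refine (memLp_two_iff_integrable_sq ?_).2 ?_
  · exact (Finset.measurable_prod _ fun k _ => (measurable_const.indicator (hA m k).1).comp
      (measurable_pi_apply k)).aestronglyMeasurable
  · refine (integrable_prod_indicator (fun i => (hA m i).1) fun i => (hA m i).2).congr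
      (.of_forall fun x => ?_)
    simp only [← Finset.prod_pow]
    refine Finset.prod_congr rfl fun i _ => ?_
    by_cases h : x i ∈ A m i <;> simp [h]

/-- The `L²`-norm of a symmetric off-diagonal kernel is controlled by the second moment of its
integral: by symmetry, every diagram contributes a nonnegative amount. -/
theorem wickConst_mul_eLpNorm_stepKernel_sq_le (h0 : ∀ L : StrongDual ℝ E, ∫ x, L x ∂Q = 0)
    {n q : ℕ} {c : Fin n → ℝ} {A : Fin n → Fin q → Set ℝ} {L : Fin n → Fin q → StrongDual ℝ E}
    (hA : ∀ m i, MeasurableSet (A m i) ∧ μ (A m i) < ∞)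
    (hA' : ∀ m i j, i ≠ j → Disjoint (A m i) (A m j))
    (hcov : ∀ m i m' j, ∫ x, L m i x * L m' j x ∂Q = μ.real (A m i ∩ A m' j))
    (hs : IsPointwiseSymmetric (stepKernel c A)) :
    ENNReal.ofReal (wickConst q) * eLpNorm (stepKernel c A) 2 (Measure.pi fun _ => μ) ^ 2 ≤
      eLpNorm (fun x => ∑ m, c m * ∏ i, L m i x) 2 Q ^ 2 := by
  have hX : MemLp (fun x => ∑ m, c m * ∏ i, L m i x) 2 Q :=
    memLp_finsetSum _ fun m _ => (memLp_prod_dual _ _ 2 (by simp)).const_mul _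
  rw [eLpNorm_two_sq_eq_ofReal (memLp_stepKernel c hA), eLpNorm_two_sq_eq_ofReal hX,
    ← ENNReal.ofReal_mul (wickConst_pos q).le]
  refine ENNReal.ofReal_le_ofReal ?_
  have key := integral_prod_form_eq_sum_pairings (K := Bool) (q := fun _ => q) (n := fun _ => n)
    (c := fun _ => c) (A := fun _ => A) (L := fun _ => L) (ρ := fun _ _ => 1) (N := q) (μ := μ) h0
    (fun _ => hA) (by intro s t m m'; rw [hcov, one_mul]) (by simp)
  simp only [Fintype.prod_bool, ← sq, Finset.prod_const_one, one_mul] at key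
  rw [key]
  refine mul_le_mul_of_nonneg_left ?_ (wickConst_pos q).le
  have hperm : ∀ e : Fin q × Bool ≃ Σ _ : Bool, Fin q, (∀ b, Function.Injective (edgeOf e b)) →
      ∫ x, stepKernel c A (fun i => x (edgeOf e true i)) * stepKernel c A
        (fun i => x (edgeOf e false i)) ∂(Measure.pi fun _ : Fin q => μ) =
      ∫ x, stepKernel c A x ^ 2 ∂(Measure.pi fun _ : Fin q => μ) := by
    intro e he
    have h1 : ∀ b (x : Fin q → ℝ), stepKernel c A (fun i => x (edgeOf e b i)) = stepKernel c A x :=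
      fun b x => hs (Equiv.ofBijective _ (Finite.injective_iff_bijective.1 (he b))) x
    simp_rw [h1, sq]
  let e₀ : Fin q × Bool ≃ Σ _ : Bool, Fin q :=
    ⟨fun p => ⟨p.2, p.1⟩, fun s => (s.2, s.1), fun _ => rfl, fun _ => rfl⟩
  rw [← hperm e₀ fun b i j h => h]
  refine Finset.single_le_sum (f := fun e : Fin q × Bool ≃ Σ _ : Bool, Fin q =>
    ∫ x, stepKernel c A (fun i => x (edgeOf e true i)) * stepKernel c A
        (fun i => x (edgeOf e false i)) ∂(Measure.pi fun _ : Fin q => μ)) (fun e _ => ?_)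
    (Finset.mem_univ e₀)
  by_cases he : ∀ b, Function.Injective (edgeOf e b)
  · rw [hperm e he]
    exact integral_nonneg fun x => sq_nonneg _
  · push Not at he
    obtain ⟨b, hb⟩ := he
    have := prod_stepKernel_edgeOf_eq_zero (K := Bool) (q := fun _ => q) (n := fun _ => n)
      (c := fun _ => c) (A := fun _ => A) (fun _ => hA') e hb
    simp only [Fintype.prod_bool] at this
    simp [this]

end Diagram

/-! ### Gaussian interpolation -/

section Growth

/-- `g` is bounded by a polynomial in the norm. -/
def HasPolynomialGrowth {E F : Type*} [NormedAddCommGroup E] [NormedAddCommGroup F] (g : E → F) :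
    Prop :=
  ∃ (C : ℝ) (d : ℕ), 0 ≤ C ∧ ∀ x, ‖g x‖ ≤ C * (1 + ‖x‖) ^ d

variable {E F : Type*} [NormedAddCommGroup E] [NormedSpace ℝ E] [NormedAddCommGroup F]

lemma HasPolynomialGrowth.of_bounded {E F : Type*} [NormedAddCommGroup E] [NormedAddCommGroup F]
    {g : E → F} {C : ℝ} (hg : ∀ x, ‖g x‖ ≤ C) : HasPolynomialGrowth g :=
  ⟨C, 0, (norm_nonneg _).trans (hg 0), by simpa using hg⟩

lemma ContinuousLinearMap.hasPolynomialGrowth [NormedSpace ℝ F] (L : E →L[ℝ] F) :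
    HasPolynomialGrowth L :=
  ⟨‖L‖, 1, norm_nonneg _, fun x => (L.le_opNorm x).trans (by gcongr; simp)⟩

lemma HasPolynomialGrowth.mul {E R : Type*} [NormedAddCommGroup E] [NormedRing R] {g h : E → R}
    (hg : HasPolynomialGrowth g) (hh : HasPolynomialGrowth h) :
    HasPolynomialGrowth fun x => g x * h x := by
  obtain ⟨C, d, hC, hg⟩ := hg
  obtain ⟨C', d', hC', hh⟩ := hh
  refine ⟨C * C', d + d', mul_nonneg hC hC', fun x => ?_⟩
  calc ‖g x * h x‖ ≤ ‖g x‖ * ‖h x‖ := norm_mul_le _ _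
    _ ≤ (C * (1 + ‖x‖) ^ d) * (C' * (1 + ‖x‖) ^ d') := by gcongr <;> simp [hg, hh]
    _ = _ := by ring

lemma HasPolynomialGrowth.add {E F : Type*} [NormedAddCommGroup E] [NormedAddCommGroup F]
    {g h : E → F} (hg : HasPolynomialGrowth g) (hh : HasPolynomialGrowth h) :
    HasPolynomialGrowth fun x => g x + h x := by
  obtain ⟨C, d, hC, hg⟩ := hg
  obtain ⟨C', d', hC', hh⟩ := hh
  refine ⟨C + C', d + d', add_nonneg hC hC', fun x => ?_⟩
  calc ‖g x + h x‖ ≤ ‖g x‖ + ‖h x‖ := norm_add_le _ _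
    _ ≤ C * (1 + ‖x‖) ^ d + C' * (1 + ‖x‖) ^ d' := add_le_add (hg x) (hh x)
    _ ≤ C * (1 + ‖x‖) ^ (d + d') + C' * (1 + ‖x‖) ^ (d + d') := by
        gcongr <;> simp
    _ = _ := by ring

lemma HasPolynomialGrowth.sum {E F ι : Type*} [NormedAddCommGroup E] [NormedAddCommGroup F]
    {g : ι → E → F} (s : Finset ι) (hg : ∀ i ∈ s, HasPolynomialGrowth (g i)) :
    HasPolynomialGrowth fun x => ∑ i ∈ s, g i x := by
  classical
  induction s using Finset.induction_on with
  | empty => exact .of_bounded (C := 0) (by simp)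
  | insert i s hi ih =>
    simp_rw [Finset.sum_insert hi]
    exact (hg i (by simp)).add (ih fun j hj => hg j (by simp [hj]))

lemma HasPolynomialGrowth.prod {E R ι : Type*} [NormedAddCommGroup E] [NormedCommRing R]
    {g : ι → E → R} (s : Finset ι) (hg : ∀ i ∈ s, HasPolynomialGrowth (g i)) :
    HasPolynomialGrowth fun x => ∏ i ∈ s, g i x := by
  classical
  induction s using Finset.induction_on with
  | empty => exact .of_bounded (C := ‖(1 : R)‖) (by simp)
  | insert i s hi ih =>
    simp_rw [Finset.prod_insert hi]
    exact (hg i (by simp)).mul (ih fun j hj => hg j (by simp [hj]))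

lemma HasPolynomialGrowth.comp {E E' F : Type*} [NormedAddCommGroup E] [NormedAddCommGroup E']
    [NormedAddCommGroup F] {g : E → F} (hg : HasPolynomialGrowth g) {φ : E' → E} {c : ℝ}
    (hc : 1 ≤ c) (hφ : ∀ y, ‖φ y‖ ≤ c * ‖y‖) : HasPolynomialGrowth fun y => g (φ y) := by
  obtain ⟨C, d, hC, hg⟩ := hg
  refine ⟨C * c ^ d, d, by positivity, fun y => (hg _).trans ?_⟩
  rw [mul_assoc, ← mul_pow]
  gcongr
  nlinarith [hφ y]

lemma HasPolynomialGrowth.integrable [MeasurableSpace E] [BorelSpace E]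
    [SecondCountableTopology E] [CompleteSpace E] {Q : Measure E} [IsGaussian Q] {g : E → F}
    (hg : HasPolynomialGrowth g) (hm : AEStronglyMeasurable g Q) : Integrable g Q := by
  obtain ⟨C, d, hC, hg⟩ := hg
  have h1 : MemLp (fun x : E => 1 + ‖x‖) (d : ℝ≥0∞) Q :=
    (memLp_const (1 : ℝ)).add (IsGaussian.memLp_id Q (d : ℝ≥0∞) (ENNReal.natCast_ne_top d)).norm
  refine (h1.integrable_norm_pow'.const_mul C).mono' hm (.of_forall fun x => (hg x).trans_eq ?_)
  have h3 : 0 ≤ 1 + ‖x‖ := by positivity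
  rw [Real.norm_of_nonneg h3]

end Growth

section Interpolation

variable {E : Type*} [NormedAddCommGroup E] [NormedSpace ℝ E] [MeasurableSpace E] [BorelSpace E]
  [SecondCountableTopology E] [CompleteSpace E] {Q : Measure E} [IsGaussian Q]

lemma norm_cos_smul_add_sin_smul_le (θ : ℝ) (p : E × E) :
    ‖Real.cos θ • p.1 + Real.sin θ • p.2‖ ≤ 2 * ‖p‖ := by
  have h1 := Real.abs_cos_le_one θ
  have h2 := Real.abs_sin_le_one θ
  calc ‖Real.cos θ • p.1 + Real.sin θ • p.2‖ ≤ |Real.cos θ| * ‖p.1‖ + |Real.sin θ| * ‖p.2‖ := by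
        simpa [norm_smul] using norm_add_le (Real.cos θ • p.1) (Real.sin θ • p.2)
    _ ≤ 1 * ‖p‖ + 1 * ‖p‖ := by gcongr <;> simp [norm_fst_le, norm_snd_le]
    _ = _ := by ring

lemma norm_neg_sin_smul_add_cos_smul_le (θ : ℝ) (p : E × E) :
    ‖-Real.sin θ • p.1 + Real.cos θ • p.2‖ ≤ 2 * ‖p‖ := by
  have := norm_cos_smul_add_sin_smul_le (θ + Real.pi / 2) p
  rwa [Real.cos_add_pi_div_two, Real.sin_add_pi_div_two] at this

lemma hasDerivAt_integral_mul_comp_rotation {F G : E → ℂ} (hF : Continuous F)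
    (hF' : HasPolynomialGrowth F) (hG : ContDiff ℝ 1 G) (hG' : HasPolynomialGrowth G)
    (hG'' : HasPolynomialGrowth (fderiv ℝ G)) (θ : ℝ) :
    HasDerivAt (fun θ : ℝ => ∫ p : E × E, F p.1 * G (Real.cos θ • p.1 + Real.sin θ • p.2)
        ∂(Q.prod Q))
      (∫ p : E × E, F p.1 * fderiv ℝ G (Real.cos θ • p.1 + Real.sin θ • p.2)
        (-Real.sin θ • p.1 + Real.cos θ • p.2) ∂(Q.prod Q)) θ := by
  have hGc : Continuous G := hG.continuous
  have hGc' : Continuous (fderiv ℝ G) := hG.continuous_fderiv one_ne_zero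
  obtain ⟨C, d, hC, hCF⟩ := hF'
  obtain ⟨C', d', hC', hCG⟩ := hG''
  refine (hasDerivAt_integral_of_dominated_loc_of_deriv_le (𝕜 := ℝ) (s := Set.univ)
    (F := fun θ (p : E × E) => F p.1 * G (Real.cos θ • p.1 + Real.sin θ • p.2))
    (F' := fun θ (p : E × E) => F p.1 * fderiv ℝ G (Real.cos θ • p.1 + Real.sin θ • p.2)
        (-Real.sin θ • p.1 + Real.cos θ • p.2))
    (bound := fun p : E × E => (C * (1 + ‖p‖) ^ d) * ((C' * (2 * (1 + ‖p‖)) ^ d') * (2 * ‖p‖)))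
    univ_mem ?_ ?_ ?_ ?_ ?_ ?_).2
  · refine .of_forall fun θ => Continuous.aestronglyMeasurable ?_
    fun_prop
  · refine HasPolynomialGrowth.integrable ?_ (Continuous.aestronglyMeasurable (by fun_prop))
    refine (HasPolynomialGrowth.comp ⟨C, d, hC, hCF⟩ (φ := Prod.fst) le_rfl fun p => ?_).mul
      (hG'.comp (φ := fun p : E × E => Real.cos θ • p.1 + Real.sin θ • p.2) one_le_two
        (norm_cos_smul_add_sin_smul_le θ))
    rw [one_mul]; exact norm_fst_le p
  · refine Continuous.aestronglyMeasurable ?_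
    fun_prop
  · refine .of_forall fun p θ _ => ?_
    rw [norm_mul]
    have h1 : ‖p.1‖ ≤ ‖p‖ := norm_fst_le p
    have h2 := norm_cos_smul_add_sin_smul_le θ p
    gcongr
    · exact (hCF _).trans (by gcongr)
    · refine (ContinuousLinearMap.le_opNorm _ _).trans ?_
      gcongr
      · refine (hCG _).trans ?_
        gcongr
        linarith
      · exact norm_neg_sin_smul_add_cos_smul_le θ p
  · refine HasPolynomialGrowth.integrable ⟨2 * C * C' * 2 ^ d', d + d' + 1, by positivity,
      fun p => ?_⟩ (Continuous.aestronglyMeasurable (by fun_prop))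
    rw [Real.norm_of_nonneg (by positivity)]
    calc (C * (1 + ‖p‖) ^ d) * ((C' * (2 * (1 + ‖p‖)) ^ d') * (2 * ‖p‖))
        ≤ (C * (1 + ‖p‖) ^ d) * ((C' * (2 * (1 + ‖p‖)) ^ d') * (2 * (1 + ‖p‖))) := by
          gcongr; simp
      _ = _ := by rw [mul_pow]; ring
  · refine .of_forall fun p θ _ => ?_
    have h1 : HasDerivAt (fun θ : ℝ => Real.cos θ • p.1 + Real.sin θ • p.2)
        (-Real.sin θ • p.1 + Real.cos θ • p.2) θ :=
      ((Real.hasDerivAt_cos θ).smul_const p.1).add ((Real.hasDerivAt_sin θ).smul_const p.2)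
    exact (((hG.differentiable one_ne_zero _).hasFDerivAt.comp_hasDerivAt θ h1)).const_mul (F p.1)

/-- A pair of independent copies of a centred Gaussian vector is invariant under rotations. -/
lemma integral_comp_rotation (h0 : ∀ L : StrongDual ℝ E, ∫ x, L x ∂Q = 0) (θ : ℝ) {K : E × E → ℂ}
    (hK : Continuous K) :
    ∫ p : E × E, K (Real.cos θ • p.1 + Real.sin θ • p.2, -Real.sin θ • p.1 + Real.cos θ • p.2)
      ∂(Q.prod Q) = ∫ p, K p ∂(Q.prod Q) := by
  have h := IsGaussian.map_rotation_eq_self_of_forall_strongDual_eq_zero h0 θ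
  conv_rhs => rw [← h]
  rw [integral_map (by fun_prop) hK.aestronglyMeasurable]
  simp [ContinuousLinearMap.rotation_apply]

/-- **Gaussian integration by parts** without coordinates. It is the derivative at `π/2` of
`θ ↦ E[ℓ(X) H(X cos θ + Y sin θ)]`, which by rotation invariance is a linear combination of `cos θ`
and `sin θ`. -/
theorem integral_clm_mul_eq_integral_fderiv (h0 : ∀ L : StrongDual ℝ E, ∫ x, L x ∂Q = 0)
    (ℓ : E →L[ℝ] ℂ) {H : E → ℂ} (hH : ContDiff ℝ 1 H) (hH' : HasPolynomialGrowth H)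
    (hH'' : HasPolynomialGrowth (fderiv ℝ H)) :
    ∫ v, ℓ v * H v ∂Q = ∫ v, ∫ w, ℓ w * fderiv ℝ H v w ∂Q ∂Q := by
  have hHc : Continuous H := hH.continuous
  have hHc' : Continuous (fderiv ℝ H) := hH.continuous_fderiv one_ne_zero
  have hd := hasDerivAt_integral_mul_comp_rotation (Q := Q) ℓ.continuous ℓ.hasPolynomialGrowth
    hH hH' hH'' (Real.pi / 2)
  have hfst : ∀ p : E × E, ‖p.1‖ ≤ 1 * ‖p‖ := fun p => by rw [one_mul]; exact norm_fst_le p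
  have hsnd : ∀ p : E × E, ‖p.2‖ ≤ 1 * ‖p‖ := fun p => by rw [one_mul]; exact norm_snd_le p
  have hint1 : Integrable (fun p : E × E => ℓ p.1 * H p.1) (Q.prod Q) :=
    HasPolynomialGrowth.integrable ((ℓ.hasPolynomialGrowth.comp le_rfl hfst).mul
      (hH'.comp le_rfl hfst)) (Continuous.aestronglyMeasurable (by fun_prop))
  have hint2 : Integrable (fun p : E × E => ℓ p.2 * H p.1) (Q.prod Q) :=
    HasPolynomialGrowth.integrable ((ℓ.hasPolynomialGrowth.comp le_rfl hsnd).mul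
      (hH'.comp le_rfl hfst)) (Continuous.aestronglyMeasurable (by fun_prop))
  have hrot : ∀ θ : ℝ, ∫ p : E × E, ℓ p.1 * H (Real.cos θ • p.1 + Real.sin θ • p.2) ∂(Q.prod Q) =
      Real.cos θ * (∫ p : E × E, ℓ p.1 * H p.1 ∂(Q.prod Q)) -
        Real.sin θ * (∫ p : E × E, ℓ p.2 * H p.1 ∂(Q.prod Q)) := by
    intro θ
    rw [← integral_const_mul, ← integral_const_mul,
      ← integral_sub (hint1.const_mul _) (hint2.const_mul _),
      ← integral_comp_rotation h0 θ (K := fun p => (Real.cos θ : ℂ) * (ℓ p.1 * H p.1) -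
        (Real.sin θ : ℂ) * (ℓ p.2 * H p.1)) (by fun_prop)]
    refine integral_congr_ae (.of_forall fun p => ?_)
    have hcs : (Real.cos θ : ℂ) ^ 2 + (Real.sin θ : ℂ) ^ 2 = 1 := by
      exact_mod_cast Real.cos_sq_add_sin_sq θ
    simp only [map_add, map_smul, Complex.real_smul, Complex.ofReal_neg]
    linear_combination (-(ℓ p.1) * H (Real.cos θ • p.1 + Real.sin θ • p.2)) * hcs
  simp_rw [hrot] at hd
  have hd' : HasDerivAt (fun θ : ℝ => (Real.cos θ : ℂ) * (∫ p : E × E, ℓ p.1 * H p.1 ∂(Q.prod Q)) -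
        (Real.sin θ : ℂ) * (∫ p : E × E, ℓ p.2 * H p.1 ∂(Q.prod Q)))
      (((-Real.sin (Real.pi / 2) : ℝ) : ℂ) * (∫ p : E × E, ℓ p.1 * H p.1 ∂(Q.prod Q)) -
        ((Real.cos (Real.pi / 2) : ℝ) : ℂ) * (∫ p : E × E, ℓ p.2 * H p.1 ∂(Q.prod Q)))
      (Real.pi / 2) :=
    ((Real.hasDerivAt_cos _).ofReal_comp.mul_const _).sub
      ((Real.hasDerivAt_sin _).ofReal_comp.mul_const _)
  have heq := hd.unique hd'
  simp only [Real.cos_pi_div_two, Real.sin_pi_div_two, zero_smul, one_smul, zero_add, add_zero,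
    neg_smul, map_neg, mul_neg, integral_neg] at heq
  have hint3 : Integrable (fun p : E × E => ℓ p.1 * fderiv ℝ H p.2 p.1) (Q.prod Q) := by
    refine HasPolynomialGrowth.integrable ((ℓ.hasPolynomialGrowth.comp le_rfl hfst).mul ?_)
      (Continuous.aestronglyMeasurable (by fun_prop))
    obtain ⟨C, d, hC, hb⟩ := hH''
    refine ⟨C, d + 1, hC, fun p => (ContinuousLinearMap.le_opNorm _ _).trans ?_⟩
    calc ‖fderiv ℝ H p.2‖ * ‖p.1‖ ≤ (C * (1 + ‖p‖) ^ d) * (1 + ‖p‖) := by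
          gcongr
          · exact (hb _).trans (by gcongr; exact norm_snd_le p)
          · linarith [norm_fst_le p]
      _ = _ := by ring
  rw [integral_prod_symm _ hint3, integral_prod _ hint1] at heq
  simpa using heq.symm

/-- Covariance interpolation: the covariance of `F(X)` and `G(X)` is controlled by the gradients of
`F` and `G` along the rotation path that joins `(X, X)` to a pair of independent copies. The
inner product of the gradients in the Cameron–Martin space is written as an expectation over an
independent copy `w`. -/
theorem norm_covariance_le_of_fderiv (h0 : ∀ L : StrongDual ℝ E, ∫ x, L x ∂Q = 0) {F G : E → ℂ}
    (hF : ContDiff ℝ 1 F) (hF' : HasPolynomialGrowth F) (hF'' : HasPolynomialGrowth (fderiv ℝ F))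
    (hG : ContDiff ℝ 1 G) (hG' : HasPolynomialGrowth G) (hG'' : HasPolynomialGrowth (fderiv ℝ G))
    {B : ℝ} (hB : ∀ θ : ℝ, ∫ u, ∫ v, ‖∫ w, fderiv ℝ G u w *
      fderiv ℝ F (Real.cos θ • u - Real.sin θ • v) w ∂Q‖ ∂Q ∂Q ≤ B) :
    ‖∫ x, F x * G x ∂Q - (∫ x, F x ∂Q) * ∫ x, G x ∂Q‖ ≤ B * (Real.pi / 2) := by
  have hFc : Continuous F := hF.continuous
  have hGc : Continuous G := hG.continuous
  have hGc' : Continuous (fderiv ℝ G) := hG.continuous_fderiv one_ne_zero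
  have hfst : ∀ p : E × E, ‖p.1‖ ≤ 1 * ‖p‖ := fun p => by rw [one_mul]; exact norm_fst_le p
  have hderiv : ∀ θ : ℝ, ‖∫ p : E × E, F p.1 * fderiv ℝ G (Real.cos θ • p.1 + Real.sin θ • p.2)
        (-Real.sin θ • p.1 + Real.cos θ • p.2) ∂(Q.prod Q)‖ ≤ B := by
    intro θ
    have hsub : ∀ p : E × E, ‖Real.cos θ • p.1 - Real.sin θ • p.2‖ ≤ 2 * ‖p‖ := fun p => by
      simpa [sub_eq_add_neg] using norm_cos_smul_add_sin_smul_le (-θ) p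
    have h1 : ∫ p : E × E, F p.1 * fderiv ℝ G (Real.cos θ • p.1 + Real.sin θ • p.2)
        (-Real.sin θ • p.1 + Real.cos θ • p.2) ∂(Q.prod Q) =
        ∫ p : E × E, F (Real.cos θ • p.1 - Real.sin θ • p.2) * fderiv ℝ G p.1 p.2
          ∂(Q.prod Q) := by
      rw [← integral_comp_rotation h0 θ (K := fun p => F (Real.cos θ • p.1 - Real.sin θ • p.2) *
        fderiv ℝ G p.1 p.2) (by fun_prop)]
      refine integral_congr_ae (.of_forall fun p => ?_)
      have : Real.cos θ • (Real.cos θ • p.1 + Real.sin θ • p.2) -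
          Real.sin θ • (-Real.sin θ • p.1 + Real.cos θ • p.2) = p.1 := by
        have h2 : p.1 = (Real.cos θ ^ 2 + Real.sin θ ^ 2) • p.1 := by
          rw [Real.cos_sq_add_sin_sq, one_smul]
        conv_rhs => rw [h2]
        module
      simp only [this]
    have hint : Integrable (fun p : E × E => F (Real.cos θ • p.1 - Real.sin θ • p.2) *
        fderiv ℝ G p.1 p.2) (Q.prod Q) := by
      refine HasPolynomialGrowth.integrable ((hF'.comp one_le_two hsub).mul ?_)
        (Continuous.aestronglyMeasurable (by fun_prop))
      obtain ⟨C, d, hC, hb⟩ := hG''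
      refine ⟨C, d + 1, hC, fun p => (ContinuousLinearMap.le_opNorm _ _).trans ?_⟩
      calc ‖fderiv ℝ G p.1‖ * ‖p.2‖ ≤ (C * (1 + ‖p‖) ^ d) * (1 + ‖p‖) := by
            gcongr
            · exact (hb _).trans (by gcongr; exact norm_fst_le p)
            · linarith [norm_snd_le p]
        _ = _ := by ring
    rw [h1, integral_prod _ hint]
    have h2 : ∀ u, ‖∫ v, F (Real.cos θ • u - Real.sin θ • v) * fderiv ℝ G u v ∂Q‖ ≤
        ∫ v, ‖∫ w, fderiv ℝ G u w * fderiv ℝ F (Real.cos θ • u - Real.sin θ • v) w ∂Q‖ ∂Q := by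
      intro u
      set H : E → ℂ := fun v => F (Real.cos θ • u - Real.sin θ • v) with hH
      have hHd : ∀ v, fderiv ℝ H v =
          -(Real.sin θ • fderiv ℝ F (Real.cos θ • u - Real.sin θ • v)) := by
        intro v
        have h3 : HasFDerivAt (fun v : E => Real.cos θ • u - Real.sin θ • v)
            (-(Real.sin θ • ContinuousLinearMap.id ℝ E)) v := by
          simpa using ((hasFDerivAt_id v).const_smul (Real.sin θ)).const_sub (Real.cos θ • u)
        refine (((hF.differentiable one_ne_zero _).hasFDerivAt.comp v h3)).fderiv.trans ?_
        ext w
        simp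
      have hHs : ContDiff ℝ 1 H := hF.comp (by fun_prop)
      have hn : ∀ v, ‖Real.cos θ • u - Real.sin θ • v‖ ≤ ‖u‖ + ‖v‖ := fun v => by
        refine (norm_sub_le _ _).trans ?_
        rw [norm_smul, norm_smul]
        have h1 := Real.abs_cos_le_one θ
        have h2 := Real.abs_sin_le_one θ
        exact add_le_add (mul_le_of_le_one_left (norm_nonneg _) h1)
          (mul_le_of_le_one_left (norm_nonneg _) h2)
      have hshift : ∀ {X : Type} [NormedAddCommGroup X] (g : E → X), HasPolynomialGrowth g →
          HasPolynomialGrowth fun v => g (Real.cos θ • u - Real.sin θ • v) := by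
        rintro X _ g ⟨C, d, hC, hg⟩
        refine ⟨C * (1 + ‖u‖) ^ d, d, by positivity, fun v => (hg _).trans ?_⟩
        rw [mul_assoc, ← mul_pow]
        gcongr
        nlinarith [hn v, norm_nonneg u, norm_nonneg v, mul_nonneg (norm_nonneg u) (norm_nonneg v)]
      have hH' : HasPolynomialGrowth H := hshift F hF'
      have hH'' : HasPolynomialGrowth (fderiv ℝ H) := by
        obtain ⟨C, d, hC, hb⟩ := hF''
        obtain ⟨C', d', hC', hb'⟩ := hshift (fun v => (C * (1 + ‖v‖) ^ d : ℝ))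
          ⟨C, d, hC, fun v => by rw [Real.norm_of_nonneg (by positivity)]⟩
        refine ⟨C', d', hC', fun v => le_trans ?_ (hb' v)⟩
        rw [hHd, norm_neg, norm_smul, Real.norm_of_nonneg
          (show 0 ≤ C * (1 + ‖Real.cos θ • u - Real.sin θ • v‖) ^ d by positivity)]
        exact (mul_le_of_le_one_left (norm_nonneg _) (Real.abs_sin_le_one θ)).trans (hb _)
      have hibp := integral_clm_mul_eq_integral_fderiv h0 (fderiv ℝ G u) hHs hH' hH''
      have h4 : ∫ v, F (Real.cos θ • u - Real.sin θ • v) * fderiv ℝ G u v ∂Q =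
          ∫ v, fderiv ℝ G u v * H v ∂Q := by simp_rw [hH, mul_comm]
      have h5 : ∀ v, ∫ w, fderiv ℝ G u w * fderiv ℝ H v w ∂Q = -(Real.sin θ) * ∫ w, fderiv ℝ G u w *
          fderiv ℝ F (Real.cos θ • u - Real.sin θ • v) w ∂Q := by
        intro v
        rw [← integral_const_mul]
        refine integral_congr_ae (.of_forall fun w => ?_)
        simp [hHd]
        ring
      rw [h4, hibp]
      simp_rw [h5]
      rw [integral_const_mul, norm_mul, norm_neg]
      refine le_trans (mul_le_of_le_one_left (norm_nonneg _) ?_) (norm_integral_le_integral_norm _)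
      rw [Complex.norm_real]
      exact Real.abs_sin_le_one θ
    refine (norm_integral_le_integral_norm _).trans 
      ((integral_mono_of_nonneg ?_ ?_ ?_).trans (hB θ))
    · exact .of_forall fun _ => norm_nonneg _
    · have hFc' : Continuous (fderiv ℝ F) := hF.continuous_fderiv one_ne_zero
      obtain ⟨C, d, hC, hb⟩ := hG''
      obtain ⟨C', d', hC', hb'⟩ := hF''
      have hint : Integrable (fun p : (E × E) × E => fderiv ℝ G p.1.1 p.2 *
          fderiv ℝ F (Real.cos θ • p.1.1 - Real.sin θ • p.1.2) p.2) ((Q.prod Q).prod Q) := by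
        refine HasPolynomialGrowth.integrable ⟨C * C' * 2 ^ d', d + 1 + (d' + 1), by positivity,
          fun p => ?_⟩ (Continuous.aestronglyMeasurable (by fun_prop))
        rw [norm_mul]
        have h3 : ‖p.1.1‖ ≤ ‖p‖ := (norm_fst_le p.1).trans (norm_fst_le p)
        have h4 : ‖p.2‖ ≤ 1 + ‖p‖ := (norm_snd_le p).trans (by simp)
        have h5 : ‖Real.cos θ • p.1.1 - Real.sin θ • p.1.2‖ ≤ 2 * ‖p‖ :=
          (hsub p.1).trans (by gcongr; exact norm_fst_le p)
        calc ‖fderiv ℝ G p.1.1 p.2‖ *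
              ‖fderiv ℝ F (Real.cos θ • p.1.1 - Real.sin θ • p.1.2) p.2‖
            ≤ ((C * (1 + ‖p‖) ^ d) * (1 + ‖p‖)) * ((C' * (2 * (1 + ‖p‖)) ^ d') * (1 + ‖p‖)) := by
              gcongr
              · refine (ContinuousLinearMap.le_opNorm _ _).trans ?_
                gcongr
                exact (hb _).trans (by gcongr)
              · refine (ContinuousLinearMap.le_opNorm _ _).trans ?_
                gcongr
                exact (hb' _).trans (by gcongr; linarith)
          _ = _ := by rw [mul_pow]; ring
      exact hint.integral_prod_left.norm.integral_prod_left
    · exact .of_forall h2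
  have hmv := norm_image_sub_le_of_norm_deriv_le_segment' (a := 0) (b := Real.pi / 2)
    (fun θ _ => (hasDerivAt_integral_mul_comp_rotation (Q := Q)
      hFc hF' hG hG' hG'' θ).hasDerivWithinAt)
    (fun θ _ => hderiv θ) (Real.pi / 2) (Set.right_mem_Icc.2 (by positivity))
  simp only [Real.cos_pi_div_two, Real.sin_pi_div_two, zero_smul, one_smul, zero_add, Real.cos_zero,
    Real.sin_zero, add_zero, sub_zero] at hmv
  have h6 : ∫ p : E × E, F p.1 * G p.1 ∂(Q.prod Q) = ∫ x, F x * G x ∂Q := by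
    have := integral_fun_fst (μ := Q) (ν := Q) (fun x => F x * G x)
    simpa using this
  rw [integral_prod_mul, h6, norm_sub_rev] at hmv
  exact hmv

end Interpolation

/-! ### Asymptotic independence of off-diagonal forms -/

section FourFold

variable {E : Type*} [NormedAddCommGroup E] [NormedSpace ℝ E] [MeasurableSpace E] [BorelSpace E]
  [SecondCountableTopology E] [CompleteSpace E] {Q : Measure E} [IsGaussian Q]

/-- The off-diagonal form `∑ₘ cₘ ∏ᵢ L_{m,i}(x)`. -/
noncomputable def multiForm {n q : ℕ} (c : Fin n → ℝ) (L : Fin n → Fin q → StrongDual ℝ E) (x : E) :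
    ℝ := ∑ m, c m * ∏ i, L m i x

/-- The form `multiForm c L`, polarized so that its `i`-th argument is `w` and the others are `x`;
summed over `i`, this is the derivative at `x` in the direction `w`. -/
noncomputable def partialForm {n q : ℕ} (c : Fin n → ℝ) (L : Fin n → Fin q → StrongDual ℝ E)
    (i : Fin q) (x w : E) : ℝ :=
  ∑ m, c m * ∏ j, L m j (if j = i then w else x)

lemma integral_dual_mul_dual_prod {E₁ E₂ : Type*} [NormedAddCommGroup E₁] [NormedSpace ℝ E₁]
    [MeasurableSpace E₁] [BorelSpace E₁] [SecondCountableTopology E₁]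
    [NormedAddCommGroup E₂] [NormedSpace ℝ E₂] [MeasurableSpace E₂] [BorelSpace E₂]
    [SecondCountableTopology E₂]
    {Q₁ : Measure E₁} {Q₂ : Measure E₂} [IsGaussian Q₁] [IsGaussian Q₂]
    (h₁ : ∀ L : StrongDual ℝ E₁, ∫ x, L x ∂Q₁ = 0) (L L' : StrongDual ℝ (E₁ × E₂)) :
    ∫ p, L p * L' p ∂(Q₁.prod Q₂) =
      ∫ x, L (x, 0) * L' (x, 0) ∂Q₁ + ∫ y, L (0, y) * L' (0, y) ∂Q₂ := by
  let M₁ : StrongDual ℝ (E₁ × E₂) → StrongDual ℝ E₁ := fun L => L.comp (.inl ℝ E₁ E₂)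
  let M₂ : StrongDual ℝ (E₁ × E₂) → StrongDual ℝ E₂ := fun L => L.comp (.inr ℝ E₁ E₂)
  have hL : ∀ (L : StrongDual ℝ (E₁ × E₂)) p, L p = M₁ L p.1 + M₂ L p.2 := fun L p => by
    rw [← L.comp_inl_add_comp_inr]
  have i₁ : Integrable (fun x => M₁ L x * M₁ L' x) Q₁ := by
    simpa using integrable_prod_dual (Q := Q₁) (Finset.univ : Finset (Fin 2)) ![M₁ L, M₁ L']
  have i₂ : Integrable (fun x => M₂ L x * M₂ L' x) Q₂ := by
    simpa using integrable_prod_dual (Q := Q₂) (Finset.univ : Finset (Fin 2)) ![M₂ L, M₂ L']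
  have j₁ : Integrable (fun p : E₁ × E₂ => M₁ L p.1 * M₁ L' p.1) (Q₁.prod Q₂) := i₁.comp_fst Q₂
  have j₂ : Integrable (fun p : E₁ × E₂ => M₂ L p.2 * M₂ L' p.2) (Q₁.prod Q₂) := i₂.comp_snd Q₁
  have j₃ : Integrable (fun p : E₁ × E₂ => M₁ L p.1 * M₂ L' p.2) (Q₁.prod Q₂) :=
    (IsGaussian.integrable_dual Q₁ (M₁ L)).mul_prod (IsGaussian.integrable_dual Q₂ (M₂ L'))
  have j₄ : Integrable (fun p : E₁ × E₂ => M₁ L' p.1 * M₂ L p.2) (Q₁.prod Q₂) :=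
    (IsGaussian.integrable_dual Q₁ (M₁ L')).mul_prod (IsGaussian.integrable_dual Q₂ (M₂ L))
  have hexp : ∀ p : E₁ × E₂, L p * L' p = (M₁ L p.1 * M₁ L' p.1 + M₂ L p.2 * M₂ L' p.2) +
      (M₁ L p.1 * M₂ L' p.2 + M₁ L' p.1 * M₂ L p.2) := by
    intro p; rw [hL L, hL L']; ring
  rw [integral_congr_ae (.of_forall hexp)]
  refine (integral_add (j₁.add j₂) (j₃.add j₄)).trans ?_
  rw [integral_add' j₁ j₂, integral_add' j₃ j₄, integral_prod_mul, integral_prod_mul, h₁, h₁,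
    zero_mul, zero_mul, add_zero, add_zero, integral_fun_fst (fun x => M₁ L x * M₁ L' x),
    integral_fun_snd (fun x => M₂ L x * M₂ L' x)]
  simp [M₁, M₂]

lemma integral_dual_prod_eq_zero {E₁ E₂ : Type*} [NormedAddCommGroup E₁] [NormedSpace ℝ E₁]
    [MeasurableSpace E₁] [BorelSpace E₁] [NormedAddCommGroup E₂] [NormedSpace ℝ E₂]
    [MeasurableSpace E₂] [BorelSpace E₂]
    {Q₁ : Measure E₁} {Q₂ : Measure E₂} [IsGaussian Q₁] [IsGaussian Q₂]
    (h₁ : ∀ L : StrongDual ℝ E₁, ∫ x, L x ∂Q₁ = 0) (h₂ : ∀ L : StrongDual ℝ E₂, ∫ x, L x ∂Q₂ = 0)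
    (L : StrongDual ℝ (E₁ × E₂)) : ∫ p, L p ∂(Q₁.prod Q₂) = 0 := by
  have hL : ∀ p, L p = L.comp (.inl ℝ E₁ E₂) p.1 + L.comp (.inr ℝ E₁ E₂) p.2 := fun p => by
    rw [← L.comp_inl_add_comp_inr]
  simp_rw [hL]
  rw [integral_add ((IsGaussian.integrable_dual Q₁ _).comp_fst Q₂)
    ((IsGaussian.integrable_dual Q₂ _).comp_snd Q₁)]
  rw [integral_fun_fst (μ := Q₁) (ν := Q₂) (fun x => L.comp (.inl ℝ E₁ E₂) x),
    integral_fun_snd (μ := Q₁) (ν := Q₂) (fun x => L.comp (.inr ℝ E₁ E₂) x), h₁, h₂]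
  simp

/-- The linear combination of four vectors with coefficients `ξ`. -/
noncomputable def combination (E : Type*) [NormedAddCommGroup E] [NormedSpace ℝ E]
    (ξ : (ℝ × ℝ) × ℝ × ℝ) : (E × E) × E × E →L[ℝ] E :=
  (ξ.1.1 • ContinuousLinearMap.fst ℝ E E + ξ.1.2 • ContinuousLinearMap.snd ℝ E E).comp
      (.fst ℝ (E × E) (E × E)) +
    (ξ.2.1 • ContinuousLinearMap.fst ℝ E E + ξ.2.2 • ContinuousLinearMap.snd ℝ E E).comp
      (.snd ℝ (E × E) (E × E))

lemma combination_apply (ξ : (ℝ × ℝ) × ℝ × ℝ) (p : (E × E) × E × E) :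
    combination E ξ p = ξ.1.1 • p.1.1 + ξ.1.2 • p.1.2 + (ξ.2.1 • p.2.1 + ξ.2.2 • p.2.2) := rfl

lemma integral_comp_combination (h0 : ∀ L : StrongDual ℝ E, ∫ x, L x ∂Q = 0)
    (L L' : StrongDual ℝ E) (ξ η : (ℝ × ℝ) × ℝ × ℝ) :
    ∫ p, L (combination E ξ p) * L' (combination E η p) ∂((Q.prod Q).prod (Q.prod Q)) =
      (ξ.1.1 * η.1.1 + ξ.1.2 * η.1.2 + (ξ.2.1 * η.2.1 + ξ.2.2 * η.2.2)) * ∫ x, L x * L' x ∂Q := by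
  have h1 := integral_dual_mul_dual_prod (Q₁ := Q.prod Q) (Q₂ := Q.prod Q)
    (integral_dual_prod_eq_zero h0 h0) (L.comp (combination E ξ)) (L'.comp (combination E η))
  have h2 := fun (a a' b b' : ℝ) => integral_dual_mul_dual_prod (Q₁ := Q) (Q₂ := Q) h0
    (L.comp (a • ContinuousLinearMap.fst ℝ E E + b • ContinuousLinearMap.snd ℝ E E))
    (L'.comp (a' • ContinuousLinearMap.fst ℝ E E + b' • ContinuousLinearMap.snd ℝ E E))
  have h3 : ∀ a b : ℝ, ∫ x, a * L x * (b * L' x) ∂Q = a * b * ∫ x, L x * L' x ∂Q := by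
    intro a b
    rw [← integral_const_mul]
    congr with x
    ring
  simp only [ContinuousLinearMap.comp_apply, combination_apply, Prod.fst_zero, Prod.snd_zero,
    smul_zero, add_zero, zero_add] at h1
  simp only [ContinuousLinearMap.comp_apply, add_apply,
    smul_apply, ContinuousLinearMap.coe_fst', ContinuousLinearMap.coe_snd',
    smul_zero, add_zero, zero_add] at h2
  simp only [combination_apply]
  rw [h1, h2, h2]
  simp only [map_smul, smul_eq_mul, h3]
  ring

variable {μ : Measure ℝ} [SigmaFinite μ] {q n : Bool → ℕ} {c : ∀ s, Fin (n s) → ℝ}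
  {A : ∀ s, Fin (n s) → Fin (q s) → Set ℝ} {L : ∀ s, Fin (n s) → Fin (q s) → StrongDual ℝ E}

/-- The coefficients, with respect to `((u, v), (w, w'))`, of the argument of the `i`-th leg of the
kernel `s`: the distinguished legs carry `w` or `w'` according to `b`, the others carry
`u cos θ - v sin θ` for the first kernel and `u` for the second one. -/
noncomputable def legCoeff (θ : ℝ) (i : ∀ s, Fin (q s)) (k : Bool × Bool) (j : Fin (q k.1)) :
    (ℝ × ℝ) × ℝ × ℝ :=
  if j = i k.1 then ((0, 0), bif k.2 then (0, 1) else (1, 0))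
  else (bif k.1 then (1, 0) else (Real.cos θ, -Real.sin θ), (0, 0))

lemma legCoeff_sq (θ : ℝ) (i : ∀ s, Fin (q s)) (k : Bool × Bool) (j : Fin (q k.1)) :
    (legCoeff θ i k j).1.1 ^ 2 + (legCoeff θ i k j).1.2 ^ 2 +
      ((legCoeff θ i k j).2.1 ^ 2 + (legCoeff θ i k j).2.2 ^ 2) = 1 := by
  obtain ⟨s, b⟩ := k
  rw [legCoeff]
  split_ifs
  · cases b <;> simp
  · cases s <;> simp

lemma abs_inner_four_le_one {a b c d a' b' c' d' : ℝ} (h : a ^ 2 + b ^ 2 + (c ^ 2 + d ^ 2) = 1)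
    (h' : a' ^ 2 + b' ^ 2 + (c' ^ 2 + d' ^ 2) = 1) :
    |a * a' + b * b' + (c * c' + d * d')| ≤ 1 := by
  rw [abs_le]
  constructor
  · linarith [sq_nonneg (a + a'), sq_nonneg (b + b'), sq_nonneg (c + c'), sq_nonneg (d + d')]
  · linarith [sq_nonneg (a - a'), sq_nonneg (b - b'), sq_nonneg (c - c'), sq_nonneg (d - d')]

lemma legCoeff_self (θ : ℝ) (i : ∀ s, Fin (q s)) :
    legCoeff θ i (false, false) (i false) = ((0, 0), (1, 0)) := by
  simp [legCoeff]

lemma legCoeff_of_ne {θ : ℝ} {i : ∀ s, Fin (q s)} {t : Σ k : Bool × Bool, Fin (q k.1)}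
    (h : t ≠ ⟨(false, false), i false⟩) (h' : t ≠ ⟨(true, false), i true⟩) :
    (legCoeff θ i t.1 t.2).2.1 = 0 := by
  obtain ⟨⟨s, b⟩, j⟩ := t
  rw [legCoeff]
  split_ifs with hj
  · obtain rfl : j = i s := hj
    cases b
    · cases s
      · exact absurd rfl h
      · exact absurd rfl h'
    · rfl
  · rfl

/-- The pairing of two gradients along the interpolation path, for one distinguished leg in each
kernel. -/
noncomputable def gradPairing (Q : Measure E) (c : ∀ s, Fin (n s) → ℝ)
    (L : ∀ s, Fin (n s) → Fin (q s) → StrongDual ℝ E) (i : ∀ s, Fin (q s)) (θ : ℝ)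
    (p : E × E) : ℝ :=
  ∫ w, partialForm (c false) (L false) (i false) (Real.cos θ • p.1 - Real.sin θ • p.2) w *
    partialForm (c true) (L true) (i true) p.1 w ∂Q

lemma continuous_partialForm {n q : ℕ} (c : Fin n → ℝ) (L : Fin n → Fin q → StrongDual ℝ E)
    (i : Fin q) : Continuous fun p : E × E => partialForm c L i p.1 p.2 := by
  unfold partialForm
  refine continuous_finsetSum _ fun m _ => continuous_const.mul ?_
  refine continuous_finsetProd _ fun j _ => ?_
  split_ifs <;> fun_prop

lemma memLp_partialForm {n q : ℕ} (c : Fin n → ℝ) (L : Fin n → Fin q → StrongDual ℝ E)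
    (i : Fin q) (x : E) : MemLp (partialForm c L i x) 2 Q := by
  unfold partialForm
  refine memLp_finsetSum _ fun m _ => MemLp.const_mul ?_ _
  have : (fun w => ∏ j, L m j (if j = i then w else x)) =
      fun w => L m i w * ∏ j ∈ Finset.univ.erase i, L m j x := by
    ext w
    rw [← Finset.mul_prod_erase _ _ (Finset.mem_univ i), if_pos rfl]
    congr 1
    exact Finset.prod_congr rfl fun j hj => by rw [if_neg (Finset.ne_of_mem_erase hj)]
  rw [this]
  exact (IsGaussian.memLp_dual Q (L m i) 2 (by simp)).mul_const _

/-- The gradient pairing is square integrable, and its norm is controlled by the contractions of the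
two kernels: in the diagram formula for its second moment, every diagram joins the distinguished
legs of the two kernels. -/
theorem eLpNorm_gradPairing_sq_le (h0 : ∀ L : StrongDual ℝ E, ∫ x, L x ∂Q = 0)
    (hA : ∀ s m i, MeasurableSet (A s m i) ∧ μ (A s m i) < ∞)
    (hA' : ∀ s m i j, i ≠ j → Disjoint (A s m i) (A s m j))
    (hcov : ∀ s m i s' m' i', ∫ x, L s m i x * L s' m' i' x ∂Q = μ.real (A s m i ∩ A s' m' i'))
    (hs : ∀ s, IsPointwiseSymmetric (stepKernel (c s) (A s))) (i : ∀ s, Fin (q s)) (θ : ℝ) :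
    MemLp (gradPairing Q c L i θ) 2 (Q.prod Q) ∧ eLpNorm (gradPairing Q c L i θ) 2 (Q.prod Q) ^ 2 ≤
      pairingBound (2 * (q false + q true)) *
        (sumContractionNorm μ (stepKernel (c false) (A false)) (stepKernel (c true) (A true)) *
        (eLpNorm (stepKernel (c false) (A false)) 2 (Measure.pi fun _ => μ) *
        eLpNorm (stepKernel (c true) (A true)) 2 (Measure.pi fun _ => μ))) := by
  set S : (E × E) × E × E → ℝ := fun p => ∏ k : Bool × Bool, ∑ m, c k.1 m * ∏ j,
    (L k.1 m j).comp (combination E (legCoeff θ i k j)) p with hS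
  have hterm : ∀ (s b : Bool) (p : (E × E) × E × E), ∑ m, c s m * ∏ j,
      (L s m j).comp (combination E (legCoeff θ i (s, b) j)) p =
      partialForm (c s) (L s) (i s)
        (bif s then p.1.1 else Real.cos θ • p.1.1 - Real.sin θ • p.1.2)
        (bif b then p.2.2 else p.2.1) := by
    intro s b p
    refine Finset.sum_congr rfl fun m _ => ?_
    congr 1
    refine Finset.prod_congr rfl fun j _ => ?_
    rw [ContinuousLinearMap.comp_apply, combination_apply, legCoeff]
    by_cases hj : j = i s
    · cases b <;> simp [hj]
    · cases s <;> simp [hj, sub_eq_add_neg]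
  have hSeq : ∀ p, S p =
      (partialForm (c false) (L false) (i false) (Real.cos θ • p.1.1 - Real.sin θ • p.1.2) p.2.1 *
        partialForm (c true) (L true) (i true) p.1.1 p.2.1) *
      (partialForm (c false) (L false) (i false) (Real.cos θ • p.1.1 - Real.sin θ • p.1.2) p.2.2 *
        partialForm (c true) (L true) (i true) p.1.1 p.2.2) := by
    intro p
    simp only [hS, Fintype.prod_prod_type, Fintype.prod_bool, hterm, cond_true, cond_false]
    ring
  have hSint : Integrable S ((Q.prod Q).prod (Q.prod Q)) :=
    memLp_one_iff_integrable.1 (memLp_prod_sum_mul_prod_dual (K := Bool × Bool)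
      (q := fun k => q k.1) (n := fun k => n k.1) (c := fun k => c k.1)
      (L := fun k m j => (L k.1 m j).comp (combination E (legCoeff θ i k j))) 1 (by simp))
  have hsq' : ∀ p, gradPairing Q c L i θ p ^ 2 = ∫ w, S (p, w) ∂(Q.prod Q) := by
    intro p
    simp only [hSeq]
    rw [gradPairing, sq, ← integral_prod_mul]
  have hsq : ∫ p, gradPairing Q c L i θ p ^ 2 ∂(Q.prod Q) =
      ∫ p, S p ∂((Q.prod Q).prod (Q.prod Q)) := by
    rw [integral_prod _ hSint]
    exact integral_congr_ae (.of_forall hsq')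
  have hmeas : AEStronglyMeasurable (gradPairing Q c L i θ) (Q.prod Q) := by
    refine AEStronglyMeasurable.integral_prod_right' (f := fun z : (E × E) × E =>
      partialForm (c false) (L false) (i false) (Real.cos θ • z.1.1 - Real.sin θ • z.1.2) z.2 *
        partialForm (c true) (L true) (i true) z.1.1 z.2) (Continuous.aestronglyMeasurable ?_)
    exact ((continuous_partialForm (c false) (L false) (i false)).comp
      (g := fun p : E × E => partialForm (c false) (L false) (i false) p.1 p.2)
      (f := fun z : (E × E) × E => (Real.cos θ • z.1.1 - Real.sin θ • z.1.2, z.2))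
      (by fun_prop)).mul ((continuous_partialForm (c true) (L true) (i true)).comp
      (g := fun p : E × E => partialForm (c true) (L true) (i true) p.1 p.2)
      (f := fun z : (E × E) × E => (z.1.1, z.2)) (by fun_prop))
  have hmem : MemLp (gradPairing Q c L i θ) 2 (Q.prod Q) := by
    refine (memLp_two_iff_integrable_sq hmeas).2 ?_
    simp_rw [hsq']
    exact hSint.integral_prod_left
  refine ⟨hmem, ?_⟩
  have key := enorm_integral_prod_form_le_contraction (K := Bool × Bool)
      (q := fun k => q k.1) (n := fun k => n k.1) (c := fun k => c k.1) (A := fun k => A k.1)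
      (Q := (Q.prod Q).prod (Q.prod Q)) (μ := μ)
      (L := fun k m j => (L k.1 m j).comp (combination E (legCoeff θ i k j)))
      (ρ := fun s t => (legCoeff θ i s.1 s.2).1.1 * (legCoeff θ i t.1 t.2).1.1 +
        (legCoeff θ i s.1 s.2).1.2 * (legCoeff θ i t.1 t.2).1.2 +
        ((legCoeff θ i s.1 s.2).2.1 * (legCoeff θ i t.1 t.2).2.1 +
        (legCoeff θ i s.1 s.2).2.2 * (legCoeff θ i t.1 t.2).2.2))
      (integral_dual_prod_eq_zero (integral_dual_prod_eq_zero h0 h0)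
        (integral_dual_prod_eq_zero h0 h0)) (fun k => hA k.1) (fun k => hA' k.1) ?_ ?_
      (k₀ := (false, false)) (l₀ := (true, false)) (by simp) (hs false) (hs true)
      (i false) (i true) ?_
  · rw [eLpNorm_two_sq_eq_ofReal hmem, hsq, ← Real.enorm_of_nonneg]
    · refine key.trans (le_of_eq ?_)
      congr 1
      · congr 1
        simp only [Fintype.card_sigma, Fintype.card_fin, Fintype.sum_prod_type, Fintype.sum_bool]
        ring
      · congr 1
        rw [← Finset.prod_subtype ({(false, true), (true, true)} : Finset (Bool × Bool))
          (p := fun m => m ≠ (false, false) ∧ m ≠ (true, false)) (by decide)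
          (fun m => eLpNorm (stepKernel (c m.1) (A m.1)) 2 (Measure.pi fun _ => μ))]
        rw [Finset.prod_pair (by decide)]
    · rw [← hsq]; exact integral_nonneg fun _ => sq_nonneg _
  · intro s t m m'
    simp only [ContinuousLinearMap.comp_apply]
    rw [integral_comp_combination h0, hcov]
  · exact fun s t => abs_inner_four_le_one (legCoeff_sq θ i s.1 s.2) (legCoeff_sq θ i t.1 t.2)
  · intro t ht ht'
    simp [legCoeff_self, legCoeff_of_ne ht ht']

lemma integral_abs_gradPairing_le (h0 : ∀ L : StrongDual ℝ E, ∫ x, L x ∂Q = 0)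
    (hA : ∀ s m i, MeasurableSet (A s m i) ∧ μ (A s m i) < ∞)
    (hA' : ∀ s m i j, i ≠ j → Disjoint (A s m i) (A s m j))
    (hcov : ∀ s m i s' m' i', ∫ x, L s m i x * L s' m' i' x ∂Q = μ.real (A s m i ∩ A s' m' i'))
    (hs : ∀ s, IsPointwiseSymmetric (stepKernel (c s) (A s))) (i : ∀ s, Fin (q s)) (θ : ℝ)
    {δ : ℝ} (hδ : 0 ≤ δ) (hbound : pairingBound (2 * (q false + q true)) *
        (sumContractionNorm μ (stepKernel (c false) (A false)) (stepKernel (c true) (A true)) *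
        (eLpNorm (stepKernel (c false) (A false)) 2 (Measure.pi fun _ => μ) *
        eLpNorm (stepKernel (c true) (A true)) 2 (Measure.pi fun _ => μ))) ≤
        ENNReal.ofReal (δ ^ 2)) :
    ∫ p, |gradPairing Q c L i θ p| ∂(Q.prod Q) ≤ δ := by
  obtain ⟨hmem, hle⟩ := eLpNorm_gradPairing_sq_le h0 hA hA' hcov hs i θ
  have h1 : eLpNorm (gradPairing Q c L i θ) 2 (Q.prod Q) ≤ ENNReal.ofReal δ := by
    have := hle.trans hbound
    rw [ENNReal.ofReal_pow hδ] at this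
    exact (ENNReal.pow_le_pow_left_iff two_ne_zero).1 this
  have h2 := (eLpNorm_le_eLpNorm_of_exponent_le (p := 1) (q := 2) (by norm_num)
    hmem.aestronglyMeasurable).trans h1
  rw [eLpNorm_one_eq_lintegral_enorm] at h2
  have h3 := integral_norm_eq_lintegral_enorm hmem.aestronglyMeasurable
  simp only [Real.norm_eq_abs] at h3
  rw [h3]
  exact ENNReal.toReal_le_of_le_ofReal hδ h2

end FourFold

section Phase

variable {E : Type*} [NormedAddCommGroup E] [NormedSpace ℝ E]

/-- The derivative of `multiForm c L` at `x`. -/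
noncomputable def multiFormDeriv {n q : ℕ} (c : Fin n → ℝ) (L : Fin n → Fin q → StrongDual ℝ E)
    (x : E) : StrongDual ℝ E :=
  ∑ m, c m • ∑ i, (∏ j ∈ Finset.univ.erase i, L m j x) • L m i

lemma hasFDerivAt_multiForm {n q : ℕ} (c : Fin n → ℝ) (L : Fin n → Fin q → StrongDual ℝ E)
    (x : E) : HasFDerivAt (multiForm c L) (multiFormDeriv c L x) x := by
  unfold multiForm multiFormDeriv
  refine HasFDerivAt.fun_sum fun m _ => HasFDerivAt.const_mul ?_ _
  exact HasFDerivAt.finsetProd fun i _ => (L m i).hasFDerivAt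

lemma multiFormDeriv_apply {n q : ℕ} (c : Fin n → ℝ) (L : Fin n → Fin q → StrongDual ℝ E)
    (x w : E) : multiFormDeriv c L x w = ∑ i, partialForm c L i x w := by
  simp only [multiFormDeriv, partialForm, sum_apply, smul_apply, smul_eq_mul, Finset.mul_sum]
  rw [Finset.sum_comm]
  refine Finset.sum_congr rfl fun i _ => Finset.sum_congr rfl fun m _ => ?_
  rw [← Finset.mul_prod_erase _ _ (Finset.mem_univ i), if_pos rfl, mul_comm (L m i w)]
  congr 2
  refine Finset.prod_congr rfl fun j hj => ?_
  rw [if_neg (Finset.ne_of_mem_erase hj)]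

lemma HasPolynomialGrowth.smul_const {E F : Type*} [NormedAddCommGroup E] [NormedAddCommGroup F]
    [NormedSpace ℝ F] {g : E → ℝ} (hg : HasPolynomialGrowth g) (a : F) :
    HasPolynomialGrowth fun x => g x • a := by
  obtain ⟨C, d, hC, hg⟩ := hg
  refine ⟨C * ‖a‖, d, by positivity, fun x => ?_⟩
  rw [norm_smul, mul_right_comm]
  gcongr
  exact hg x

lemma HasPolynomialGrowth.const_smul {E F : Type*} [NormedAddCommGroup E] [NormedAddCommGroup F]
    [NormedSpace ℝ F] {g : E → F} (hg : HasPolynomialGrowth g) (a : ℝ) :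
    HasPolynomialGrowth fun x => a • g x := by
  obtain ⟨C, d, hC, hg⟩ := hg
  refine ⟨|a| * C, d, by positivity, fun x => ?_⟩
  rw [norm_smul, mul_assoc]
  exact mul_le_mul_of_nonneg_left (hg x) (norm_nonneg a)

lemma hasPolynomialGrowth_multiFormDeriv {n q : ℕ} (c : Fin n → ℝ)
    (L : Fin n → Fin q → StrongDual ℝ E) : HasPolynomialGrowth (multiFormDeriv c L) := by
  unfold multiFormDeriv
  refine .sum _ fun m _ => .const_smul (.sum _ fun i _ => .smul_const ?_ _) _
  exact .prod _ fun j _ => (L m j).hasPolynomialGrowth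

variable {T : Type*} [Fintype T] {q n : T → ℕ}

/-- The characteristic exponential `exp (i ∑ₜ αₜ Xₜ)` of the forms `Xₜ = multiForm (c t) (L t)`. -/
noncomputable def phase (c : ∀ t, Fin (n t) → ℝ) (L : ∀ t, Fin (n t) → Fin (q t) → StrongDual ℝ E)
    (α : T → ℝ) (x : E) : ℂ :=
  Complex.exp ((∑ t, α t * multiForm (c t) (L t) x : ℝ) * Complex.I)

variable (c : ∀ t, Fin (n t) → ℝ) (L : ∀ t, Fin (n t) → Fin (q t) → StrongDual ℝ E) (α : T → ℝ)

lemma norm_phase (x : E) : ‖phase c L α x‖ = 1 := Complex.norm_exp_ofReal_mul_I _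

lemma contDiff_phase : ContDiff ℝ 1 (phase c L α) := by
  unfold phase multiForm
  refine ContDiff.cexp (ContDiff.mul (Complex.ofRealCLM.contDiff.comp ?_) contDiff_const)
  refine ContDiff.sum fun t _ => contDiff_const.mul (ContDiff.sum fun m _ => contDiff_const.mul ?_)
  exact contDiff_prod fun i _ => (L t m i).contDiff

lemma fderiv_phase_apply (x w : E) : fderiv ℝ (phase c L α) x w =
    phase c L α x * (((∑ t, α t • multiFormDeriv (c t) (L t) x) w : ℝ) * Complex.I) := by
  have h1 : HasFDerivAt (fun x => ∑ t, α t * multiForm (c t) (L t) x)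
      (∑ t, α t • multiFormDeriv (c t) (L t) x) x :=
    HasFDerivAt.fun_sum fun t _ => (hasFDerivAt_multiForm (c t) (L t) x).const_mul _
  have h2 := ((Complex.ofRealCLM.hasFDerivAt.comp x h1).mul_const Complex.I).cexp
  have h3 : HasFDerivAt (phase c L α) _ x := h2
  rw [h3.fderiv]
  simp [phase, mul_comm, mul_left_comm]

lemma hasPolynomialGrowth_fderiv_phase : HasPolynomialGrowth (fderiv ℝ (phase c L α)) := by
  have h : HasPolynomialGrowth fun x => ∑ t, α t • multiFormDeriv (c t) (L t) x :=
    .sum _ fun t _ => .const_smul (hasPolynomialGrowth_multiFormDeriv _ _) _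
  obtain ⟨C, d, hC, h⟩ := h
  refine ⟨C, d, hC, fun x => le_trans ?_ (h x)⟩
  refine ContinuousLinearMap.opNorm_le_bound _ (norm_nonneg _) fun w => ?_
  rw [fderiv_phase_apply, norm_mul, norm_phase, one_mul, norm_mul, Complex.norm_I, mul_one,
    Complex.norm_real]
  exact ContinuousLinearMap.le_opNorm _ _

end Phase

section Covariance

variable {E : Type*} [NormedAddCommGroup E] [NormedSpace ℝ E] [MeasurableSpace E] [BorelSpace E]
  [SecondCountableTopology E] [CompleteSpace E] {Q : Measure E} [IsGaussian Q]
  {μ : Measure ℝ} [SigmaFinite μ] {T : Type*} [Fintype T] {q n : T → ℕ}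
  {c : ∀ t, Fin (n t) → ℝ} {A : ∀ t, Fin (n t) → Fin (q t) → Set ℝ}
  {L : ∀ t, Fin (n t) → Fin (q t) → StrongDual ℝ E}

/-- **Asymptotic independence of off-diagonal forms.** If each form of the first group has small
contractions with each form of the second group, then the characteristic function of the two groups
nearly factorizes. -/
theorem norm_integral_phase_mul_sub_le (h0 : ∀ L : StrongDual ℝ E, ∫ x, L x ∂Q = 0)
    (hA : ∀ t m i, MeasurableSet (A t m i) ∧ μ (A t m i) < ∞)
    (hA' : ∀ t m i j, i ≠ j → Disjoint (A t m i) (A t m j))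
    (hcov : ∀ t m i t' m' i', ∫ x, L t m i x * L t' m' i' x ∂Q = μ.real (A t m i ∩ A t' m' i'))
    (hs : ∀ t, IsPointwiseSymmetric (stepKernel (c t) (A t))) (α β : T → ℝ) {δ : ℝ} (hδ : 0 ≤ δ)
    (hbound : ∀ t t', α t ≠ 0 → β t' ≠ 0 → pairingBound (2 * (q t + q t')) *
      (sumContractionNorm μ (stepKernel (c t) (A t)) (stepKernel (c t') (A t')) *
        (eLpNorm (stepKernel (c t) (A t)) 2 (Measure.pi fun _ => μ) *
        eLpNorm (stepKernel (c t') (A t')) 2 (Measure.pi fun _ => μ))) ≤ ENNReal.ofReal (δ ^ 2)) :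
    ‖∫ x, phase c L α x * phase c L β x ∂Q - (∫ x, phase c L α x ∂Q) * ∫ x, phase c L β x ∂Q‖ ≤
      (∑ s : Σ t, Fin (q t), ∑ s' : Σ t, Fin (q t), |α s.1| * |β s'.1| * δ) * (Real.pi / 2) := by
  refine norm_covariance_le_of_fderiv h0 (contDiff_phase c L α)
    (.of_bounded fun x => (norm_phase c L α x).le) (hasPolynomialGrowth_fderiv_phase c L α)
    (contDiff_phase c L β) (.of_bounded fun x => (norm_phase c L β x).le)
    (hasPolynomialGrowth_fderiv_phase c L β) fun θ => ?_
  -- the gradient pairing of the `s.2`-th leg of the form `s.1` with the `s'.2`-th one of `s'.1`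
  let τ : (Σ t, Fin (q t)) → (Σ t, Fin (q t)) → Bool → T := fun s s' b => bif b then s'.1 else s.1
  let ι : ∀ (s s' : Σ t, Fin (q t)) b, Fin (q (τ s s' b)) := fun s s' b =>
    match b with
    | false => s.2
    | true => s'.2
  let g : (Σ t, Fin (q t)) → (Σ t, Fin (q t)) → E × E → ℝ := fun s s' =>
    gradPairing Q (fun b => c (τ s s' b)) (fun b => L (τ s s' b)) (ι s s') θ
  have hg : ∀ s s' p, g s s' p =
      ∫ w, partialForm (c s.1) (L s.1) s.2 (Real.cos θ • p.1 - Real.sin θ • p.2) w *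
        partialForm (c s'.1) (L s'.1) s'.2 p.1 w ∂Q := fun s s' p => rfl
  have hgint : ∀ s s', Integrable (g s s') (Q.prod Q) := fun s s' =>
    (eLpNorm_gradPairing_sq_le (A := fun b => A (τ s s' b)) h0 (fun b => hA _) (fun b => hA' _)
      (fun _ _ _ _ _ _ => hcov _ _ _ _ _ _) (fun b => hs _) (ι s s') θ).1.integrable (by norm_num)
  have hgle : ∀ s s', |α s.1| * |β s'.1| * ∫ p, |g s s' p| ∂(Q.prod Q) ≤
      |α s.1| * |β s'.1| * δ := by
    intro s s'
    by_cases hα : α s.1 = 0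
    · simp [hα]
    by_cases hβ : β s'.1 = 0
    · simp [hβ]
    refine mul_le_mul_of_nonneg_left ?_ (by positivity)
    exact integral_abs_gradPairing_le (A := fun b => A (τ s s' b)) h0 (fun b => hA _)
      (fun b => hA' _) (fun _ _ _ _ _ _ => hcov _ _ _ _ _ _) (fun b => hs _) (ι s s') θ hδ
      (hbound s.1 s'.1 hα hβ)
  let Φ : E × E → ℝ := fun p => ∑ s, ∑ s', |α s.1| * |β s'.1| * |g s s' p|
  have hΦ : Integrable Φ (Q.prod Q) := integrable_finsetSum _ fun s _ =>
    integrable_finsetSum _ fun s' _ => (hgint s s').abs.const_mul _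
  have hder : ∀ (a : T → ℝ) (x w : E), (∑ t, a t • multiFormDeriv (c t) (L t) x) w =
      ∑ s : Σ t, Fin (q t), a s.1 * partialForm (c s.1) (L s.1) s.2 x w := by
    intro a x w
    rw [Fintype.sum_sigma]
    simp [multiFormDeriv_apply, Finset.mul_sum]
  have hpoint : ∀ u v, ‖∫ w, fderiv ℝ (phase c L β) u w *
      fderiv ℝ (phase c L α) (Real.cos θ • u - Real.sin θ • v) w ∂Q‖ ≤ Φ (u, v) := by
    intro u v
    set z := Real.cos θ • u - Real.sin θ • v with hz
    have h1 : ∀ w, fderiv ℝ (phase c L β) u w * fderiv ℝ (phase c L α) z w =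
        -(phase c L β u * phase c L α z) * ((∑ s : Σ t, Fin (q t), ∑ s' : Σ t, Fin (q t),
          α s.1 * β s'.1 * (partialForm (c s.1) (L s.1) s.2 z w *
            partialForm (c s'.1) (L s'.1) s'.2 u w) : ℝ) : ℂ) := by
      intro w
      have h2 : (∑ s : Σ t, Fin (q t), ∑ s' : Σ t, Fin (q t),
          α s.1 * β s'.1 * (partialForm (c s.1) (L s.1) s.2 z w *
            partialForm (c s'.1) (L s'.1) s'.2 u w)) =
          (∑ s : Σ t, Fin (q t), α s.1 * partialForm (c s.1) (L s.1) s.2 z w) *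
          ∑ s' : Σ t, Fin (q t), β s'.1 * partialForm (c s'.1) (L s'.1) s'.2 u w := by
        rw [Finset.sum_mul_sum]
        exact Finset.sum_congr rfl fun s _ => Finset.sum_congr rfl fun s' _ => by ring
      rw [h2, fderiv_phase_apply, fderiv_phase_apply, hder, hder]
      push_cast
      linear_combination (phase c L β u * phase c L α z *
        (∑ s : Σ t, Fin (q t), (α s.1 : ℂ) * (partialForm (c s.1) (L s.1) s.2 z w : ℂ)) *
        (∑ s' : Σ t, Fin (q t), (β s'.1 : ℂ) * (partialForm (c s'.1) (L s'.1) s'.2 u w : ℂ))) *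
        Complex.I_sq
    have hint : ∀ s s' : Σ t, Fin (q t), Integrable (fun w => α s.1 * β s'.1 *
        (partialForm (c s.1) (L s.1) s.2 z w * partialForm (c s'.1) (L s'.1) s'.2 u w)) Q :=
      fun s s' => ((memLp_partialForm (c s.1) (L s.1) s.2 z).integrable_mul
        (memLp_partialForm (c s'.1) (L s'.1) s'.2 u)).const_mul _
    simp_rw [h1]
    rw [integral_const_mul, integral_complex_ofReal, norm_mul, norm_neg, norm_mul, norm_phase,
      norm_phase,
      one_mul, one_mul, Complex.norm_real]
    rw [integral_finsetSum _ fun s _ => integrable_finsetSum _ fun s' _ => hint s s']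
    refine (norm_sum_le _ _).trans (Finset.sum_le_sum fun s _ => ?_)
    rw [integral_finsetSum _ fun s' _ => hint s s']
    refine (norm_sum_le _ _).trans (Finset.sum_le_sum fun s' _ => ?_)
    rw [integral_const_mul, norm_mul, norm_mul, hg]
    rfl
  calc ∫ u, ∫ v, ‖∫ w, fderiv ℝ (phase c L β) u w *
        fderiv ℝ (phase c L α) (Real.cos θ • u - Real.sin θ • v) w ∂Q‖ ∂Q ∂Q
      ≤ ∫ u, ∫ v, Φ (u, v) ∂Q ∂Q := by
        refine integral_mono_of_nonneg
          (.of_forall fun u => integral_nonneg fun v => norm_nonneg _) hΦ.integral_prod_left ?_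
        filter_upwards [hΦ.prod_right_ae] with u hu
        exact integral_mono_of_nonneg (.of_forall fun v => norm_nonneg _) hu
          (.of_forall fun v => hpoint u v)
    _ = ∫ p, Φ p ∂(Q.prod Q) := (integral_prod _ hΦ).symm
    _ = ∑ s : Σ t, Fin (q t), ∑ s' : Σ t, Fin (q t),
          |α s.1| * |β s'.1| * ∫ p, |g s s' p| ∂(Q.prod Q) := by
        rw [integral_finsetSum _ fun s _ => integrable_finsetSum _ fun s' _ =>
          (hgint s s').abs.const_mul _]
        refine Finset.sum_congr rfl fun s _ => ?_
        rw [integral_finsetSum _ fun s' _ => (hgint s s').abs.const_mul _]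
        exact Finset.sum_congr rfl fun s' _ => integral_const_mul _ _
    _ ≤ _ := Finset.sum_le_sum fun s _ => Finset.sum_le_sum fun s' _ => hgle s s'

end Covariance

/-! ### Elementary multiple integrals with respect to the random measure -/

section RandomMeasure

variable {Ω : Type*} [MeasurableSpace Ω] {P : Measure Ω} {μ : Measure ℝ}
  {W : Set ℝ → Ω → ℝ}

/-- The multiple integral `∑ₘ cₘ W(A_{m,1}) ⋯ W(A_{m,q})` of the step kernel of `c` and `A`. -/
noncomputable def stepIntegral {n q : ℕ} (W : Set ℝ → Ω → ℝ) (c : Fin n → ℝ)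
    (A : Fin n → Fin q → Set ℝ) (ω : Ω) : ℝ :=
  ∑ m, c m * ∏ k, W (A m k) ω

section Law

variable {S : Type*} [Fintype S] {A : S → Set ℝ}

lemma IsGaussianRandomMeasure.aemeasurable (hW : IsGaussianRandomMeasure W μ P)
    {B : Set ℝ} (hB : MeasurableSet B) (hB' : μ B < ∞) : AEMeasurable (W B) P :=
  hW.gaussian.aemeasurable ⟨B, hB, hB'⟩

lemma IsGaussianRandomMeasure.aemeasurable_pi (hW : IsGaussianRandomMeasure W μ P)
    (hA : ∀ s, MeasurableSet (A s) ∧ μ (A s) < ∞) : AEMeasurable (fun ω s => W (A s) ω) P :=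
  aemeasurable_pi_lambda _ fun s => hW.aemeasurable (hA s).1 (hA s).2

lemma IsGaussianRandomMeasure.isGaussian_map (hW : IsGaussianRandomMeasure W μ P)
    (hA : ∀ s, MeasurableSet (A s) ∧ μ (A s) < ∞) :
    IsGaussian (P.map fun ω s => W (A s) ω) := by
  have h := (hW.gaussian.comp_right fun s => ⟨A s, hA s⟩).hasGaussianLaw Finset.univ
  exact (h.map (.pi fun s : S => .proj (⟨s, Finset.mem_univ s⟩ : (Finset.univ : Finset S)))
    ).isGaussian_map

lemma IsGaussianRandomMeasure.integral_map_dual (hW : IsGaussianRandomMeasure W μ P)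
    (hA : ∀ s, MeasurableSet (A s) ∧ μ (A s) < ∞) (L : StrongDual ℝ (S → ℝ)) :
    ∫ x, L x ∂(P.map fun ω s => W (A s) ω) = 0 := by
  classical
  have := hW.isGaussian_map hA
  have hL : ∀ x, L x = ∑ s, x s * L (Pi.single s 1) := fun x => by
    conv_lhs => rw [← Finset.univ_sum_single x]
    rw [map_sum]
    refine Finset.sum_congr rfl fun s _ => ?_
    rw [← smul_eq_mul, ← map_smul, ← Pi.single_smul', smul_eq_mul, mul_one]
  have hint : ∀ s, Integrable (fun x : S → ℝ => x s) (P.map fun ω s => W (A s) ω) := fun s =>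
    IsGaussian.integrable_dual _ (ContinuousLinearMap.proj (R := ℝ) (φ := fun _ : S => ℝ) s)
  rw [integral_congr_ae (.of_forall hL), integral_finsetSum _ fun s _ => (hint s).mul_const _]
  refine Finset.sum_eq_zero fun s _ => ?_
  rw [integral_mul_const, integral_map (hW.aemeasurable_pi hA)
    (measurable_pi_apply s).aestronglyMeasurable, hW.centred _ (hA s).1 (hA s).2, zero_mul]

lemma IsGaussianRandomMeasure.integral_map_mul (hW : IsGaussianRandomMeasure W μ P)
    (hA : ∀ s, MeasurableSet (A s) ∧ μ (A s) < ∞) (s t : S) :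
    ∫ x, x s * x t ∂(P.map fun ω s => W (A s) ω) = μ.real (A s ∩ A t) := by
  rw [integral_map (hW.aemeasurable_pi hA) (Continuous.aestronglyMeasurable (by fun_prop)),
    hW.covariance _ _ (hA s).1 (hA s).2 (hA t).1 (hA t).2]

end Law

section Family

variable [SigmaFinite μ] {T : Type*} [Fintype T] {q n : T → ℕ} {c : ∀ t, Fin (n t) → ℝ}
  {A : ∀ t, Fin (n t) → Fin (q t) → Set ℝ}

/-- The `(m, i)`-th variable of the form `t`, as a coordinate. -/
noncomputable def legProj {T : Type*} (q n : T → ℕ) (t : T) (m : Fin (n t)) (i : Fin (q t)) :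
    StrongDual ℝ ((Σ t, Fin (n t) × Fin (q t)) → ℝ) :=
  .proj ⟨t, m, i⟩

lemma norm_integral_cexp_stepIntegral_sub_le (hW : IsGaussianRandomMeasure W μ P)
    (hA : ∀ t m i, MeasurableSet (A t m i) ∧ μ (A t m i) < ∞)
    (hA' : ∀ t m i j, i ≠ j → Disjoint (A t m i) (A t m j))
    (hs : ∀ t, IsPointwiseSymmetric (stepKernel (c t) (A t))) (α β : T → ℝ) {δ : ℝ} (hδ : 0 ≤ δ)
    (hbound : ∀ t t', α t ≠ 0 → β t' ≠ 0 → pairingBound (2 * (q t + q t')) *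
      (sumContractionNorm μ (stepKernel (c t) (A t)) (stepKernel (c t') (A t')) *
        (eLpNorm (stepKernel (c t) (A t)) 2 (Measure.pi fun _ => μ) *
        eLpNorm (stepKernel (c t') (A t')) 2 (Measure.pi fun _ => μ))) ≤ ENNReal.ofReal (δ ^ 2)) :
    ‖∫ ω, Complex.exp ((∑ t, α t * stepIntegral W (c t) (A t) ω : ℝ) * Complex.I) *
          Complex.exp ((∑ t, β t * stepIntegral W (c t) (A t) ω : ℝ) * Complex.I) ∂P -
        (∫ ω, Complex.exp ((∑ t, α t * stepIntegral W (c t) (A t) ω : ℝ) * Complex.I) ∂P) *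
          ∫ ω, Complex.exp ((∑ t, β t * stepIntegral W (c t) (A t) ω : ℝ) * Complex.I) ∂P‖ ≤
      (∑ s : Σ t, Fin (q t), ∑ s' : Σ t, Fin (q t), |α s.1| * |β s'.1| * δ) * (Real.pi / 2) := by
  let B : (Σ t, Fin (n t) × Fin (q t)) → Set ℝ := fun s => A s.1 s.2.1 s.2.2
  have hB : ∀ s, MeasurableSet (B s) ∧ μ (B s) < ∞ := fun s => hA _ _ _
  have := hW.isGaussian_map hB
  have key := norm_integral_phase_mul_sub_le (c := c) (L := legProj q n) (hW.integral_map_dual hB)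
    hA hA' (fun t m i t' m' i' => hW.integral_map_mul hB ⟨t, m, i⟩ ⟨t', m', i'⟩) hs α β hδ hbound
  have hm := hW.aemeasurable_pi hB
  have hα := (contDiff_phase c (legProj q n) α).continuous
  have hβ := (contDiff_phase c (legProj q n) β).continuous
  rw [integral_map hm (Continuous.aestronglyMeasurable (by fun_prop)),
    integral_map hm hα.aestronglyMeasurable,
    integral_map hm hβ.aestronglyMeasurable] at key
  exact key

end Family

section Single

variable [SigmaFinite μ] {n q : ℕ} {c : Fin n → ℝ} {A : Fin n → Fin q → Set ℝ}

lemma memLp_stepIntegral (hW : IsGaussianRandomMeasure W μ P)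
    (hA : ∀ m i, MeasurableSet (A m i) ∧ μ (A m i) < ∞) (p : ℝ≥0∞) (hp : p ≠ ∞) :
    MemLp (stepIntegral W c A) p P := by
  let B : Fin n × Fin q → Set ℝ := fun s => A s.1 s.2
  have hB : ∀ s, MeasurableSet (B s) ∧ μ (B s) < ∞ := fun s => hA _ _
  have := hW.isGaussian_map hB
  have h : MemLp (fun x : Fin n × Fin q → ℝ => ∑ m, c m * ∏ i,
      (ContinuousLinearMap.proj (R := ℝ) (φ := fun _ => ℝ) (m, i)) x) p
      (P.map fun ω s => W (B s) ω) :=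
    memLp_finsetSum _ fun m _ => (memLp_prod_dual Finset.univ
      (fun i => ContinuousLinearMap.proj (R := ℝ) (φ := fun _ : Fin n × Fin q => ℝ) (m, i))
      p hp).const_mul _
  exact h.comp_of_map (hW.aemeasurable_pi hB)

/-- **Hypercontractivity**, in the form of a bound of all moments of an elementary integral by the
norm of its kernel. -/
lemma enorm_integral_stepIntegral_pow_le (hW : IsGaussianRandomMeasure W μ P)
    (hA : ∀ m i, MeasurableSet (A m i) ∧ μ (A m i) < ∞)
    (hA' : ∀ m i j, i ≠ j → Disjoint (A m i) (A m j)) (k : ℕ) :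
    ‖∫ ω, stepIntegral W c A ω ^ k ∂P‖ₑ ≤
      pairingBound (k * q) * eLpNorm (stepKernel c A) 2 (Measure.pi fun _ => μ) ^ k := by
  let B : Fin n × Fin q → Set ℝ := fun s => A s.1 s.2
  have hB : ∀ s, MeasurableSet (B s) ∧ μ (B s) < ∞ := fun s => hA _ _
  have := hW.isGaussian_map hB
  have key := enorm_integral_prod_form_le (K := Fin k) (Q := P.map fun ω s => W (B s) ω)
    (q := fun _ => q) (n := fun _ => n) (c := fun _ => c) (A := fun _ => A)
    (L := fun _ m i => ContinuousLinearMap.proj (R := ℝ) (φ := fun _ : Fin n × Fin q => ℝ) (m, i))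
    (ρ := fun _ _ => 1) (hW.integral_map_dual hB) (fun _ => hA) (fun _ => hA')
    (fun s t m m' => by
      rw [one_mul]
      exact hW.integral_map_mul hB (m, s.2) (m', t.2)) (by simp)
  rw [integral_map (hW.aemeasurable_pi hB) (Continuous.aestronglyMeasurable (by fun_prop))] at key
  simpa [stepIntegral] using key

lemma wickConst_mul_eLpNorm_sq_le_stepIntegral (hW : IsGaussianRandomMeasure W μ P)
    (hA : ∀ m i, MeasurableSet (A m i) ∧ μ (A m i) < ∞)
    (hA' : ∀ m i j, i ≠ j → Disjoint (A m i) (A m j))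
    (hs : IsPointwiseSymmetric (stepKernel c A)) :
    ENNReal.ofReal (wickConst q) * eLpNorm (stepKernel c A) 2 (Measure.pi fun _ => μ) ^ 2 ≤
      eLpNorm (stepIntegral W c A) 2 P ^ 2 := by
  let B : Fin n × Fin q → Set ℝ := fun s => A s.1 s.2
  have hB : ∀ s, MeasurableSet (B s) ∧ μ (B s) < ∞ := fun s => hA _ _
  have := hW.isGaussian_map hB
  have key := wickConst_mul_eLpNorm_stepKernel_sq_le (Q := P.map fun ω s => W (B s) ω)
    (L := fun m i => ContinuousLinearMap.proj (R := ℝ) (φ := fun _ : Fin n × Fin q => ℝ) (m, i))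
    (hW.integral_map_dual hB) hA hA'
    (fun m i m' j => hW.integral_map_mul hB (m, i) (m', j)) hs
  rw [eLpNorm_map_measure (Continuous.aestronglyMeasurable (by fun_prop))
    (hW.aemeasurable_pi hB)] at key
  exact key

end Single

/-! ### Symmetrization of elementary integrals -/

section Symmetrization

variable {q : ℕ}

/-- The average of `f` over all permutations of its variables. -/
noncomputable def symmetrize (f : (Fin q → ℝ) → ℝ) (x : Fin q → ℝ) : ℝ :=
  (q.factorial : ℝ)⁻¹ * ∑ σ : Equiv.Perm (Fin q), f fun k => x (σ k)

lemma isPointwiseSymmetric_symmetrize (f : (Fin q → ℝ) → ℝ) :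
    IsPointwiseSymmetric (symmetrize f) := by
  intro σ x
  unfold symmetrize
  congr 1
  exact Fintype.sum_equiv (Equiv.mulLeft σ) _ _ fun τ => rfl

lemma measurePreserving_comp_perm [SigmaFinite μ] (σ : Equiv.Perm (Fin q)) :
    MeasurePreserving (fun (x : Fin q → ℝ) k => x (σ k)) (Measure.pi fun _ => μ)
      (Measure.pi fun _ => μ) := by
  have h := measurePreserving_piCongrLeft (fun _ : Fin q => μ) σ.symm
  have heq : ⇑(MeasurableEquiv.piCongrLeft (fun _ : Fin q => ℝ) σ.symm) =
      fun (x : Fin q → ℝ) k => x (σ k) := by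
    ext x k
    rw [MeasurableEquiv.coe_piCongrLeft, Equiv.piCongrLeft_apply]
    simp
  rwa [heq] at h

lemma eLpNorm_symmetrize_sub_le [SigmaFinite μ] {f g : (Fin q → ℝ) → ℝ}
    (hg : AEStronglyMeasurable g (Measure.pi fun _ => μ))
    (hf : AEStronglyMeasurable f (Measure.pi fun _ => μ)) (hs : IsSymmetricKernel μ q f) :
    eLpNorm (symmetrize g - f) 2 (Measure.pi fun _ => μ) ≤
      eLpNorm (g - f) 2 (Measure.pi fun _ => μ) := by
  have hq : (q.factorial : ℝ) ≠ 0 := by positivity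
  have heq : symmetrize g - f =ᵐ[Measure.pi fun _ => μ] (q.factorial : ℝ)⁻¹ •
      ∑ σ : Equiv.Perm (Fin q), (g - f) ∘ fun (x : Fin q → ℝ) k => x (σ k) := by
    filter_upwards [ae_all_iff.2 hs] with x hx
    simp only [Pi.sub_apply, symmetrize, Pi.smul_apply, Finset.sum_apply, Function.comp_apply, hx,
      Finset.sum_sub_distrib, Finset.sum_const, Finset.card_univ, Fintype.card_perm,
      Fintype.card_fin, smul_eq_mul, nsmul_eq_mul]
    field_simp
  rw [eLpNorm_congr_ae heq, eLpNorm_const_smul]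
  have h1 : eLpNorm (∑ σ : Equiv.Perm (Fin q), (g - f) ∘ fun (x : Fin q → ℝ) k => x (σ k)) 2
      (Measure.pi fun _ => μ) ≤ q.factorial * eLpNorm (g - f) 2 (Measure.pi fun _ => μ) := by
    refine (eLpNorm_sum_le (fun σ _ => (hg.sub hf).comp_measurePreserving
      (measurePreserving_comp_perm σ)) (by norm_num)).trans (le_of_eq ?_)
    rw [Finset.sum_congr rfl fun σ _ => eLpNorm_comp_measurePreserving (hg.sub hf)
      (measurePreserving_comp_perm σ)]
    simp [Fintype.card_perm]
  refine (mul_le_mul_right h1 _).trans (le_of_eq ?_)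
  rw [← mul_assoc, Real.enorm_of_nonneg (by positivity), ENNReal.ofReal_inv_of_pos (by positivity),
    ENNReal.ofReal_natCast, ENNReal.inv_mul_cancel (by positivity) (by simp), one_mul]

lemma IsElementaryIntegral.exists_eq_symmetrize {W : Set ℝ → Ω → ℝ} {g : (Fin q → ℝ) → ℝ}
    {X : Ω → ℝ} (h : IsElementaryIntegral W μ q g X) :
    Measurable g ∧ ∃ (n : ℕ) (c : Fin n → ℝ) (A : Fin n → Fin q → Set ℝ),
      (∀ m i, MeasurableSet (A m i) ∧ μ (A m i) < ∞) ∧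
      (∀ m i j, i ≠ j → Disjoint (A m i) (A m j)) ∧
      stepKernel c A = symmetrize g ∧ stepIntegral W c A = X := by
  obtain ⟨n, c, A, hA, hA', rfl, rfl⟩ := h
  have hq : (q.factorial : ℝ) ≠ 0 := by positivity
  refine ⟨measurable_stepKernel c fun m k => (hA m k).1, ?_⟩
  let e := (Fintype.equivFin (Fin n × Equiv.Perm (Fin q))).symm
  refine ⟨_, fun m => (q.factorial : ℝ)⁻¹ * c (e m).1, fun m k => A (e m).1 ((e m).2.symm k),
    fun m i => hA _ _, fun m i j hij => hA' _ _ _ ((e m).2.symm.injective.ne hij), ?_, ?_⟩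
  · ext x
    simp only [stepKernel, symmetrize]
    rw [e.sum_comp (fun p : Fin n × Equiv.Perm (Fin q) => (q.factorial : ℝ)⁻¹ * c p.1 *
      ∏ k, (A p.1 (p.2.symm k)).indicator (fun _ => (1 : ℝ)) (x k)), Fintype.sum_prod_type,
      Finset.sum_comm, Finset.mul_sum]
    refine Finset.sum_congr rfl fun σ _ => ?_
    rw [Finset.mul_sum]
    refine Finset.sum_congr rfl fun m _ => ?_
    rw [mul_assoc, ← Equiv.prod_comp σ]
    simp
  · ext ω
    simp only [stepIntegral]
    rw [e.sum_comp (fun p : Fin n × Equiv.Perm (Fin q) => (q.factorial : ℝ)⁻¹ * c p.1 *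
      ∏ k, W (A p.1 (p.2.symm k)) ω), Fintype.sum_prod_type]
    refine Finset.sum_congr rfl fun m _ => ?_
    have : ∀ σ : Equiv.Perm (Fin q), ∏ k, W (A m (σ.symm k)) ω = ∏ k, W (A m k) ω := fun σ =>
      σ.symm.prod_comp fun k => W (A m k) ω
    simp only [this, Finset.sum_const, Finset.card_univ, Fintype.card_perm, Fintype.card_fin,
      nsmul_eq_mul]
    field_simp

/-- A multiple integral of a symmetric kernel is a limit of elementary multiple integrals whose
kernels are symmetric at every point. -/
lemma IsWienerItoIntegral.exists_stepIntegral [SigmaFinite μ] {W : Set ℝ → Ω → ℝ}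
    {f : (Fin q → ℝ) → ℝ} {X : Ω → ℝ} (h : IsWienerItoIntegral W μ P q f X)
    (hs : IsSymmetricKernel μ q f) {ε : ℝ≥0∞} (hε : 0 < ε) :
    ∃ (n : ℕ) (c : Fin n → ℝ) (A : Fin n → Fin q → Set ℝ),
      (∀ m i, MeasurableSet (A m i) ∧ μ (A m i) < ∞) ∧
      (∀ m i j, i ≠ j → Disjoint (A m i) (A m j)) ∧ IsPointwiseSymmetric (stepKernel c A) ∧
      eLpNorm (stepKernel c A - f) 2 (Measure.pi fun _ => μ) < ε ∧
      eLpNorm (stepIntegral W c A - X) 2 P < ε := by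
  obtain ⟨hf, -, fn, Xn, hel, hfn, hXn⟩ := h
  obtain ⟨k, hk, hk'⟩ := ((hfn.eventually_lt_const hε).and (hXn.eventually_lt_const hε)).exists
  obtain ⟨hm, n, c, A, hA, hA', hc, hX⟩ := (hel k).exists_eq_symmetrize
  refine ⟨n, c, A, hA, hA', hc ▸ isPointwiseSymmetric_symmetrize _, ?_, by rwa [hX]⟩
  rw [hc]
  exact (eLpNorm_symmetrize_sub_le hm.aestronglyMeasurable hf.1 hs).trans_lt hk

end Symmetrization

end RandomMeasure

/-! ### Continuity of contractions -/

section Contraction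

lemma measurePreserving_joinArgs (μ : Measure ℝ) [SigmaFinite μ] {p r : ℕ} (hr : r ≤ p) :
    MeasurePreserving (fun z : (Fin (p - r) → ℝ) × (Fin r → ℝ) => joinArgs p r z.1 z.2)
      ((Measure.pi fun _ => μ).prod (Measure.pi fun _ => μ)) (Measure.pi fun _ => μ) := by
  let φ : Fin (p - r) ⊕ Fin r ≃ Fin p :=
    finSumFinEquiv.trans (finCongr (Nat.sub_add_cancel hr))
  have h := (measurePreserving_piCongrLeft (fun _ : Fin p => μ) φ).comp
    (measurePreserving_sumPiEquivProdPi_symm (fun _ : Fin (p - r) ⊕ Fin r => μ))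
  convert h using 1
  ext z k
  obtain ⟨s, rfl⟩ := φ.surjective k
  rw [Function.comp_apply, MeasurableEquiv.coe_piCongrLeft, Equiv.piCongrLeft_apply_apply]
  rcases s with i | i
  · simp [φ, joinArgs, MeasurableEquiv.sumPiEquivProdPi]
  · simp [φ, joinArgs, MeasurableEquiv.sumPiEquivProdPi]

lemma ae_ae_joinArgs_eq {μ : Measure ℝ} [SigmaFinite μ] {p r : ℕ} (hr : r ≤ p)
    {f f' : (Fin p → ℝ) → ℝ} (h : f =ᵐ[Measure.pi fun _ => μ] f') :
    ∀ᵐ x ∂(Measure.pi fun _ : Fin (p - r) => μ), ∀ᵐ s ∂(Measure.pi fun _ : Fin r => μ),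
      f (joinArgs p r x s) = f' (joinArgs p r x s) :=
  Measure.ae_ae_of_ae_prod ((measurePreserving_joinArgs μ hr).quasiMeasurePreserving.ae h)

lemma contractionNorm_congr_ae {μ : Measure ℝ} [SigmaFinite μ] {p q r : ℕ} (hp : r ≤ p)
    (hq : r ≤ q) {f f' : (Fin p → ℝ) → ℝ} {g g' : (Fin q → ℝ) → ℝ}
    (hf : f =ᵐ[Measure.pi fun _ => μ] f') (hg : g =ᵐ[Measure.pi fun _ => μ] g') :
    contractionNorm μ p q r f g = contractionNorm μ p q r f' g' := by
  refine eLpNorm_congr_ae ?_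
  filter_upwards [Measure.quasiMeasurePreserving_fst.ae (ae_ae_joinArgs_eq hp hf),
    Measure.quasiMeasurePreserving_snd.ae (ae_ae_joinArgs_eq hq hg)] with z hz hz'
  refine integral_congr_ae ?_
  filter_upwards [hz, hz'] with s hs hs'
  rw [hs, hs']

/-- No integrability is needed: if `u - v` is not integrable the right-hand side is infinite, and
otherwise `u` and `v` are both integrable or both not. -/
lemma enorm_integral_le_add_lintegral_sub {α : Type*} [MeasurableSpace α] {ν : Measure α}
    {u v : α → ℝ} (hu : AEStronglyMeasurable u ν) (hv : AEStronglyMeasurable v ν) :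
    ‖∫ s, u s ∂ν‖ₑ ≤ ‖∫ s, v s ∂ν‖ₑ + ∫⁻ s, ‖u s - v s‖ₑ ∂ν := by
  by_cases hd : Integrable (fun s => u s - v s) ν
  · by_cases hv' : Integrable v ν
    · have : ∫ s, u s ∂ν = ∫ s, v s ∂ν + ∫ s, (u s - v s) ∂ν := by
        rw [← integral_add hv' hd]
        simp
      rw [this]
      exact (enorm_add_le _ _).trans (add_le_add le_rfl (enorm_integral_le_lintegral_enorm _))
    · have hu' : ¬ Integrable u ν := fun hu' =>
        hv' ((hu'.sub hd).congr (.of_forall fun s => by simp))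
      rw [integral_undef hu', enorm_zero]
      exact zero_le
  · have : ∫⁻ s, ‖u s - v s‖ₑ ∂ν = ∞ := by
      by_contra h
      exact hd ⟨hu.sub hv, lt_top_iff_ne_top.2 h⟩
    rw [this, add_top]
    exact le_top

lemma lintegral_sq_lintegral_mul_le {X Y S : Type*} [MeasurableSpace X] [MeasurableSpace Y]
    [MeasurableSpace S] {ν₁ : Measure X} {ν₂ : Measure Y} {ν : Measure S} [SigmaFinite ν₁]
    [SigmaFinite ν₂] [SigmaFinite ν] {F : X × S → ℝ≥0∞} {G : Y × S → ℝ≥0∞} (hF : Measurable F)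
    (hG : Measurable G) :
    (∫⁻ z, (∫⁻ s, F (z.1, s) * G (z.2, s) ∂ν) ^ (2 : ℝ) ∂(ν₁.prod ν₂)) ^ (1 / 2 : ℝ) ≤
      (∫⁻ z, F z ^ (2 : ℝ) ∂(ν₁.prod ν)) ^ (1 / 2 : ℝ) *
        (∫⁻ z, G z ^ (2 : ℝ) ∂(ν₂.prod ν)) ^ (1 / 2 : ℝ) := by
  rw [← ENNReal.mul_rpow_of_nonneg _ _ (by norm_num)]
  refine ENNReal.rpow_le_rpow ?_ (by norm_num)
  calc ∫⁻ z, (∫⁻ s, F (z.1, s) * G (z.2, s) ∂ν) ^ (2 : ℝ) ∂(ν₁.prod ν₂)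
      ≤ ∫⁻ z, (∫⁻ s, F (z.1, s) ^ (2 : ℝ) ∂ν) * ∫⁻ s, G (z.2, s) ^ (2 : ℝ) ∂ν ∂(ν₁.prod ν₂) := by
        refine lintegral_mono fun z => ?_
        have h := ENNReal.lintegral_mul_le_Lp_mul_Lq ν (Real.HolderConjugate.two_two)
          (f := fun s => F (z.1, s)) (g := fun s => G (z.2, s))
          (hF.comp measurable_prodMk_left).aemeasurable
          (hG.comp measurable_prodMk_left).aemeasurable
        refine (ENNReal.rpow_le_rpow h (by norm_num : (0 : ℝ) ≤ 2)).trans (le_of_eq ?_)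
        rw [ENNReal.mul_rpow_of_nonneg _ _ (by norm_num), ← ENNReal.rpow_mul, ← ENNReal.rpow_mul]
        norm_num
    _ = (∫⁻ z, F z ^ (2 : ℝ) ∂(ν₁.prod ν)) * ∫⁻ z, G z ^ (2 : ℝ) ∂(ν₂.prod ν) := by
        rw [lintegral_prod_mul (f := fun x => ∫⁻ s, F (x, s) ^ (2 : ℝ) ∂ν)
          (g := fun y => ∫⁻ s, G (y, s) ^ (2 : ℝ) ∂ν)
          (hF.pow_const _).lintegral_prod_right'.aemeasurable
          (hG.pow_const _).lintegral_prod_right'.aemeasurable,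
          lintegral_prod _ (hF.pow_const _).aemeasurable,
          lintegral_prod _ (hG.pow_const _).aemeasurable]

lemma contractionNorm_le_add_of_measurable {μ : Measure ℝ} [SigmaFinite μ] {p q r : ℕ} (hp : r ≤ p)
    (hq : r ≤ q) {f f' : (Fin p → ℝ) → ℝ} {g g' : (Fin q → ℝ) → ℝ} (hf : Measurable f)
    (hf' : Measurable f') (hg : Measurable g) (hg' : Measurable g') :
    contractionNorm μ p q r f' g' ≤ contractionNorm μ p q r f g +
      (eLpNorm (f' - f) 2 (Measure.pi fun _ => μ) * eLpNorm g' 2 (Measure.pi fun _ => μ) +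
        eLpNorm f 2 (Measure.pi fun _ => μ) * eLpNorm (g' - g) 2 (Measure.pi fun _ => μ)) := by
  have hjp := measurePreserving_joinArgs μ hp
  have hjq := measurePreserving_joinArgs μ hq
  let ν : ∀ k : ℕ, Measure (Fin k → ℝ) := fun k => Measure.pi fun _ => μ
  let K : ((Fin p → ℝ) → ℝ) → ((Fin q → ℝ) → ℝ) → (Fin (p - r) → ℝ) × (Fin (q - r) → ℝ) → ℝ≥0∞ :=
    fun u v z => ∫⁻ s, ‖u (joinArgs p r z.1 s)‖ₑ * ‖v (joinArgs q r z.2 s)‖ₑ ∂(ν r)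
  have hKm : ∀ {u v}, Measurable u → Measurable v → Measurable (K u v) := by
    intro u v hu hv
    refine Measurable.lintegral_prod_right' (f := fun z :
      ((Fin (p - r) → ℝ) × (Fin (q - r) → ℝ)) × (Fin r → ℝ) =>
      ‖u (joinArgs p r z.1.1 z.2)‖ₑ * ‖v (joinArgs q r z.1.2 z.2)‖ₑ) ?_
    exact ((hu.comp ((measurable_joinArgs p r).comp
      ((measurable_fst.comp measurable_fst).prodMk measurable_snd))).enorm).mul
      ((hv.comp ((measurable_joinArgs q r).comp
      ((measurable_snd.comp measurable_fst).prodMk measurable_snd))).enorm)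
  have hK : ∀ {u v}, Measurable u → Measurable v →
      (∫⁻ z, K u v z ^ (2 : ℝ) ∂((ν (p - r)).prod (ν (q - r)))) ^ (1 / 2 : ℝ) ≤
        eLpNorm u 2 (ν p) * eLpNorm v 2 (ν q) := by
    intro u v hu hv
    refine (lintegral_sq_lintegral_mul_le (ν₁ := ν (p - r)) (ν₂ := ν (q - r)) (ν := ν r)
      (F := fun z => ‖u (joinArgs p r z.1 z.2)‖ₑ) (G := fun z => ‖v (joinArgs q r z.1 z.2)‖ₑ)
      (hu.comp hjp.measurable).enorm (hv.comp hjq.measurable).enorm).trans (le_of_eq ?_)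
    rw [eLpNorm_two_eq_lintegral_rpow, eLpNorm_two_eq_lintegral_rpow,
      ← hjp.lintegral_comp (hu.enorm.pow_const _), ← hjq.lintegral_comp (hv.enorm.pow_const _)]
  have hpoint : ∀ z, ‖contraction μ p q r f' g' z‖ₑ ≤
      ‖contraction μ p q r f g z‖ₑ + (K (f' - f) g' z + K f (g' - g) z) := by
    intro z
    have hmp : ∀ {u : (Fin p → ℝ) → ℝ}, Measurable u →
        Measurable fun s => u (joinArgs p r z.1 s) := fun hu =>
      hu.comp (hjp.measurable.comp measurable_prodMk_left)
    have hmq : ∀ {u : (Fin q → ℝ) → ℝ}, Measurable u →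
        Measurable fun s => u (joinArgs q r z.2 s) := fun hu =>
      hu.comp (hjq.measurable.comp measurable_prodMk_left)
    refine (enorm_integral_le_add_lintegral_sub ((hmp hf').mul (hmq hg')).aestronglyMeasurable
      ((hmp hf).mul (hmq hg)).aestronglyMeasurable).trans (add_le_add le_rfl ?_)
    refine le_trans (lintegral_mono fun s => ?_) (lintegral_add_left
      (f := fun s => ‖(f' - f) (joinArgs p r z.1 s)‖ₑ * ‖g' (joinArgs q r z.2 s)‖ₑ)
      (((hmp (hf'.sub hf)).enorm).mul (hmq hg').enorm)
      fun s => ‖f (joinArgs p r z.1 s)‖ₑ * ‖(g' - g) (joinArgs q r z.2 s)‖ₑ).le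
    rw [← enorm_mul, ← enorm_mul]
    refine le_trans (le_of_eq ?_) (enorm_add_le _ _)
    congr 1
    simp only [Pi.mul_apply, Pi.sub_apply]
    ring
  have hc : Measurable fun z => ‖contraction μ p q r f g z‖ₑ :=
    (measurable_contraction μ r hf hg).enorm
  calc contractionNorm μ p q r f' g'
      ≤ (∫⁻ z, (‖contraction μ p q r f g z‖ₑ + (K (f' - f) g' z + K f (g' - g) z)) ^ (2 : ℝ)
          ∂((ν (p - r)).prod (ν (q - r)))) ^ (1 / 2 : ℝ) := by
        rw [contractionNorm, eLpNorm_two_eq_lintegral_rpow]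
        exact ENNReal.rpow_le_rpow (lintegral_mono fun z =>
          ENNReal.rpow_le_rpow (hpoint z) (by norm_num)) (by norm_num)
    _ ≤ contractionNorm μ p q r f g + ((∫⁻ z, K (f' - f) g' z ^ (2 : ℝ)
          ∂((ν (p - r)).prod (ν (q - r)))) ^ (1 / 2 : ℝ) + (∫⁻ z, K f (g' - g) z ^ (2 : ℝ)
          ∂((ν (p - r)).prod (ν (q - r)))) ^ (1 / 2 : ℝ)) := by
        rw [contractionNorm, eLpNorm_two_eq_lintegral_rpow]
        refine (ENNReal.lintegral_Lp_add_le hc.aemeasurable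
          ((hKm (hf'.sub hf) hg').add (hKm hf (hg'.sub hg))).aemeasurable (by norm_num)).trans
          (add_le_add le_rfl ?_)
        exact ENNReal.lintegral_Lp_add_le (hKm (hf'.sub hf) hg').aemeasurable
          (hKm hf (hg'.sub hg)).aemeasurable (by norm_num)
    _ ≤ _ := add_le_add le_rfl (add_le_add (hK (hf'.sub hf) hg') (hK hf (hg'.sub hg)))

/-- The norm of a contraction depends continuously on the two kernels. -/
theorem contractionNorm_le_add {μ : Measure ℝ} [SigmaFinite μ] {p q r : ℕ} (hp : r ≤ p)
    (hq : r ≤ q) {f f' : (Fin p → ℝ) → ℝ} {g g' : (Fin q → ℝ) → ℝ}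
    (hf : AEStronglyMeasurable f (Measure.pi fun _ => μ)) (hf' : Measurable f')
    (hg : AEStronglyMeasurable g (Measure.pi fun _ => μ)) (hg' : Measurable g') :
    contractionNorm μ p q r f' g' ≤ contractionNorm μ p q r f g +
      (eLpNorm (f' - f) 2 (Measure.pi fun _ => μ) * eLpNorm g' 2 (Measure.pi fun _ => μ) +
        eLpNorm f 2 (Measure.pi fun _ => μ) * eLpNorm (g' - g) 2 (Measure.pi fun _ => μ)) := by
  rw [contractionNorm_congr_ae hp hq hf.ae_eq_mk hg.ae_eq_mk, eLpNorm_congr_ae hf.ae_eq_mk,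
    eLpNorm_congr_ae ((EventuallyEq.refl _ f').sub hf.ae_eq_mk),
    eLpNorm_congr_ae ((EventuallyEq.refl _ g').sub hg.ae_eq_mk)]
  exact contractionNorm_le_add_of_measurable hp hq hf.stronglyMeasurable_mk.measurable hf'
    hg.stronglyMeasurable_mk.measurable hg'

end Contraction

/-! ### Moments and convergence in distribution -/

section Moments

variable {Ω Ω' : Type*} [MeasurableSpace Ω] [MeasurableSpace Ω'] {P : Measure Ω}
  [IsProbabilityMeasure P] {P' : Measure Ω'} [IsProbabilityMeasure P']

/-- A variant of the Paley–Zygmund inequality: if the fourth moment is controlled by the square of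
the second one, then the second moment is controlled by a quantile. -/
lemma integral_sq_le_of_integral_pow_four_le {X : Ω → ℝ} (hX : MemLp X 4 P) {C K : ℝ} (hC : 0 < C)
    (h4 : ∫ ω, X ω ^ 4 ∂P ≤ C * (∫ ω, X ω ^ 2 ∂P) ^ 2)
    (hK : P.real {ω | K ≤ |X ω|} ≤ 1 / (4 * C)) : ∫ ω, X ω ^ 2 ∂P ≤ 2 * K ^ 2 := by
  set s := ∫ ω, X ω ^ 2 ∂P with hs
  have hs0 : 0 ≤ s := integral_nonneg fun _ => sq_nonneg _
  rcases hs0.eq_or_lt with h | hpos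
  · rw [← h]; positivity
  have i4 : Integrable (fun ω => X ω ^ 4) P := by
    simpa using hX.integrable_norm_pow (p := 4) (by norm_num) |>.congr
      (.of_forall fun ω => by simp [Even.pow_abs (by decide : Even 4)])
  have i2 : Integrable (fun ω => X ω ^ 2) P := (hX.mono_exponent (by norm_num)).integrable_sq
  have hset : NullMeasurableSet {ω | K ≤ |X ω|} P :=
    nullMeasurableSet_le aemeasurable_const hX.aestronglyMeasurable.aemeasurable.abs
  have ii : Integrable ({ω | K ≤ |X ω|}.indicator fun _ => C * s) P :=
    (integrable_const _).indicator₀ hset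
  -- where `|X| < K` the first term suffices; elsewhere, the other two do by the inequality of
  -- arithmetic and geometric means
  have hpt : ∀ ω, X ω ^ 2 ≤ K ^ 2 + (1 / (4 * C * s) * X ω ^ 4 +
      {ω | K ≤ |X ω|}.indicator (fun _ => C * s) ω) := by
    intro ω
    have h1 : 0 ≤ 1 / (4 * C * s) * X ω ^ 4 := by positivity
    by_cases h : K ≤ |X ω|
    · rw [Set.indicator_of_mem (by exact h)]
      have h2 : 1 / (4 * C * s) * X ω ^ 4 + C * s - X ω ^ 2 =
          1 / (4 * C * s) * (X ω ^ 2 - 2 * (C * s)) ^ 2 := by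
        field_simp
        ring
      have h3 : 0 ≤ 1 / (4 * C * s) * (X ω ^ 2 - 2 * (C * s)) ^ 2 := by positivity
      linarith [sq_nonneg K]
    · rw [Set.indicator_of_notMem (by exact h)]
      have : X ω ^ 2 ≤ K ^ 2 := sq_le_sq' (by linarith [neg_abs_le (X ω)])
        (by linarith [le_abs_self (X ω)])
      linarith
  have key := integral_mono i2 ((integrable_const _).add ((i4.const_mul _).add ii)) hpt
  rw [integral_add' (integrable_const _) ((i4.const_mul _).add ii),
    integral_add' (i4.const_mul _) ii,
    integral_const_mul, integral_indicator₀ hset, setIntegral_const, integral_const] at key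
  simp only [probReal_univ, smul_eq_mul] at key
  have e1 : 1 / (4 * C * s) * ∫ ω, X ω ^ 4 ∂P ≤ s / 4 := by
    calc 1 / (4 * C * s) * ∫ ω, X ω ^ 4 ∂P ≤ 1 / (4 * C * s) * (C * s ^ 2) := by gcongr
      _ = s / 4 := by field_simp
  have e2 : P.real {ω | K ≤ |X ω|} * (C * s) ≤ s / 4 := by
    calc P.real {ω | K ≤ |X ω|} * (C * s) ≤ 1 / (4 * C) * (C * s) := by gcongr
      _ = s / 4 := by field_simp
  linarith

/-- Convergence in distribution bounds the second moments, if the fourth moments are controlled by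
them. -/
lemma exists_eventually_integral_sq_le {X : ℕ → Ω → ℝ} {U : Ω' → ℝ}
    (h : TendstoInDistribution X atTop U (fun _ => P) P') (hX : ∀ N, MemLp (X N) 4 P) {C : ℝ}
    (hC : 0 < C) (h4 : ∀ N, ∫ ω, X N ω ^ 4 ∂P ≤ C * (∫ ω, X N ω ^ 2 ∂P) ^ 2) :
    ∃ M, ∀ᶠ N in atTop, ∫ ω, X N ω ^ 2 ∂P ≤ M := by
  have hanti : Antitone fun k : ℕ => {x : ℝ | (k : ℝ) ≤ |x|} := fun k l hkl x (hx : _ ≤ _) =>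
    (Nat.cast_le.2 hkl : (k : ℝ) ≤ l).trans hx
  have hclosed : ∀ k : ℕ, IsClosed {x : ℝ | (k : ℝ) ≤ |x|} := fun k =>
    isClosed_le continuous_const continuous_abs
  have hprob : IsProbabilityMeasure (P'.map U) :=
    Measure.isProbabilityMeasure_map h.aemeasurable_limit
  have hlim := tendsto_measure_iInter_atTop (μ := P'.map U)
    (fun k => (hclosed k).measurableSet.nullMeasurableSet) hanti ⟨0, measure_ne_top _ _⟩
  have hempty : ⋂ k : ℕ, {x : ℝ | (k : ℝ) ≤ |x|} = ∅ := by
    refine Set.eq_empty_of_forall_notMem fun x hx => ?_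
    obtain ⟨k, hk⟩ := exists_nat_gt |x|
    exact (lt_irrefl _) (hk.trans_le (Set.mem_iInter.1 hx k))
  rw [hempty, measure_empty] at hlim
  have hε : (0 : ℝ≥0∞) < ENNReal.ofReal (1 / (4 * C)) := by
    rw [ENNReal.ofReal_pos]; positivity
  obtain ⟨k, hk⟩ := (hlim.eventually_lt_const hε).exists
  have hsup := (ProbabilityMeasure.limsup_measure_closed_le_of_tendsto
    h.tendsto (hclosed k)).trans_lt hk
  refine ⟨2 * (k : ℝ) ^ 2, ?_⟩
  filter_upwards [eventually_lt_of_limsup_lt hsup] with N hN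
  refine integral_sq_le_of_integral_pow_four_le (hX N) hC (h4 N) ?_
  rw [ProbabilityMeasure.coe_mk, Measure.map_apply_of_aemeasurable (h.forall_aemeasurable N)
    (hclosed k).measurableSet] at hN
  exact ENNReal.toReal_le_of_le_ofReal (by positivity) hN.le

/-- Even moments of a limit in distribution are finite if those of the sequence are bounded. -/
lemma integrable_pow_of_tendstoInDistribution {X : ℕ → Ω → ℝ} {U : Ω' → ℝ}
    (h : TendstoInDistribution X atTop U (fun _ => P) P') {k : ℕ} (hk : Even k)
    (hX : ∀ N, Integrable (fun ω => X N ω ^ k) P) {B : ℝ}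
    (hB : ∀ᶠ N in atTop, ∫ ω, X N ω ^ k ∂P ≤ B) : Integrable (fun ω => U ω ^ k) P' := by
  have hopen := lintegral_le_liminf_lintegral_of_forall_isOpen_measure_le_liminf_measure
    (μ := P'.map U) (μs := fun N => P.map (X N)) (f := fun x => x ^ k) (continuous_pow k)
    (fun x => hk.pow_nonneg x)
    (fun G hG => ProbabilityMeasure.le_liminf_measure_open_of_tendsto h.tendsto hG)
  have hm : AEMeasurable (fun x : ℝ => ENNReal.ofReal (x ^ k)) (P'.map U) := by fun_prop
  rw [lintegral_map' hm h.aemeasurable_limit] at hopen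
  have hle : ∀ᶠ N in atTop, ∫⁻ x, ENNReal.ofReal (x ^ k) ∂(P.map (X N)) ≤ ENNReal.ofReal B := by
    filter_upwards [hB] with N hN
    rw [lintegral_map' (by fun_prop) (h.forall_aemeasurable N),
      ← ofReal_integral_eq_lintegral_ofReal (hX N) (.of_forall fun ω => hk.pow_nonneg _)]
    exact ENNReal.ofReal_le_ofReal hN
  have hfin : ∫⁻ ω, ENNReal.ofReal (U ω ^ k) ∂P' < ∞ :=
    hopen.trans_lt ((liminf_le_of_frequently_le' hle.frequently).trans_lt ENNReal.ofReal_lt_top)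
  refine ⟨(h.aemeasurable_limit.pow_const k).aestronglyMeasurable, ?_⟩
  rwa [hasFiniteIntegral_iff_ofReal (.of_forall fun ω => hk.pow_nonneg _)]

lemma memLp_of_forall_integrable_pow {U : Ω' → ℝ} (hU : AEMeasurable U P')
    (h : ∀ m : ℕ, Integrable (fun ω => U ω ^ (2 * m)) P') (p : ℝ≥0∞) (hp : p ≠ ∞) :
    MemLp U p P' := by
  obtain ⟨m, hm⟩ := ENNReal.exists_nat_gt hp
  have h1 : MemLp U ((2 * (m + 1) : ℕ) : ℝ≥0∞) P' := by
    rw [← integrable_norm_rpow_iff hU.aestronglyMeasurable (by simp)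
      (ENNReal.natCast_ne_top _)]
    refine (h (m + 1)).congr (.of_forall fun ω => ?_)
    beta_reduce
    rw [ENNReal.toReal_natCast, Real.rpow_natCast, Real.norm_eq_abs, Even.pow_abs (even_two_mul _)]
  refine h1.mono_exponent (hm.le.trans ?_)
  exact_mod_cast (by omega : m ≤ 2 * (m + 1))

end Moments

/-! ### Limits of sequences of multiple integrals -/

section Limits

variable {Ω Ω' : Type*} [MeasurableSpace Ω] [MeasurableSpace Ω'] {P : Measure Ω}
  [IsProbabilityMeasure P] {P' : Measure Ω'} [IsProbabilityMeasure P'] {μ : Measure ℝ}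
  [SigmaFinite μ] {W : Set ℝ → Ω → ℝ}

lemma integral_stepIntegral_pow_le (hW : IsGaussianRandomMeasure W μ P) {n q : ℕ} {c : Fin n → ℝ}
    {A : Fin n → Fin q → Set ℝ} (hA : ∀ m i, MeasurableSet (A m i) ∧ μ (A m i) < ∞)
    (hA' : ∀ m i j, i ≠ j → Disjoint (A m i) (A m j)) (k : ℕ) :
    ∫ ω, stepIntegral W c A ω ^ k ∂P ≤ (pairingBound (k * q)).toReal *
      (eLpNorm (stepKernel c A) 2 (Measure.pi fun _ => μ)).toReal ^ k := by
  have h := enorm_integral_stepIntegral_pow_le (c := c) hW hA hA' k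
  have hfin : pairingBound (k * q) * eLpNorm (stepKernel c A) 2 (Measure.pi fun _ => μ) ^ k ≠ ∞ :=
    ENNReal.mul_ne_top ENNReal.ofReal_ne_top (ENNReal.pow_ne_top (memLp_stepKernel c hA).2.ne)
  have h' := ENNReal.toReal_mono hfin h
  rw [toReal_enorm, ENNReal.toReal_mul, ENNReal.toReal_pow] at h'
  exact (le_abs_self _).trans h'

lemma wickConst_mul_sq_le_integral_stepIntegral (hW : IsGaussianRandomMeasure W μ P) {n q : ℕ}
    {c : Fin n → ℝ} {A : Fin n → Fin q → Set ℝ}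
    (hA : ∀ m i, MeasurableSet (A m i) ∧ μ (A m i) < ∞)
    (hA' : ∀ m i j, i ≠ j → Disjoint (A m i) (A m j))
    (hs : IsPointwiseSymmetric (stepKernel c A)) :
    wickConst q * (eLpNorm (stepKernel c A) 2 (Measure.pi fun _ => μ)).toReal ^ 2 ≤
      ∫ ω, stepIntegral W c A ω ^ 2 ∂P := by
  have h := wickConst_mul_eLpNorm_sq_le_stepIntegral hW hA hA' hs
  have hnn : 0 ≤ ∫ ω, stepIntegral W c A ω ^ 2 ∂P := integral_nonneg fun _ => sq_nonneg _
  rw [eLpNorm_two_sq_eq_ofReal (memLp_stepIntegral hW hA 2 (by simp))] at h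
  have h' := ENNReal.toReal_mono ENNReal.ofReal_ne_top h
  rwa [ENNReal.toReal_mul, ENNReal.toReal_pow, ENNReal.toReal_ofReal (wickConst_pos q).le,
    ENNReal.toReal_ofReal hnn] at h'

section SingleSequence

variable {q : ℕ} {n : ℕ → ℕ} {c : ∀ N, Fin (n N) → ℝ} {A : ∀ N, Fin (n N) → Fin q → Set ℝ}
  {U : Ω' → ℝ}

/-- The kernels of a sequence of multiple integrals which converges in distribution are bounded. -/
lemma exists_eventually_eLpNorm_stepKernel_le (hW : IsGaussianRandomMeasure W μ P)
    (hA : ∀ N m i, MeasurableSet (A N m i) ∧ μ (A N m i) < ∞)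
    (hA' : ∀ N m i j, i ≠ j → Disjoint (A N m i) (A N m j))
    (hs : ∀ N, IsPointwiseSymmetric (stepKernel (c N) (A N)))
    (h : TendstoInDistribution (fun N => stepIntegral W (c N) (A N)) atTop U (fun _ => P) P') :
    ∃ R : ℝ, ∀ᶠ N in atTop, (eLpNorm (stepKernel (c N) (A N)) 2 (Measure.pi fun _ => μ)).toReal ≤ R
    := by
  have hw := wickConst_pos q
  have h4 : ∀ N, ∫ ω, stepIntegral W (c N) (A N) ω ^ 4 ∂P ≤
      ((pairingBound (4 * q)).toReal / wickConst q ^ 2 + 1) *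
        (∫ ω, stepIntegral W (c N) (A N) ω ^ 2 ∂P) ^ 2 := by
    intro N
    have h1 := integral_stepIntegral_pow_le (c := c N) hW (hA N) (hA' N) 4
    have h2 := wickConst_mul_sq_le_integral_stepIntegral hW (hA N) (hA' N) (hs N)
    set a := (eLpNorm (stepKernel (c N) (A N)) 2 (Measure.pi fun _ => μ)).toReal with ha
    set s := ∫ ω, stepIntegral W (c N) (A N) ω ^ 2 ∂P with hs
    have h3 : (wickConst q * a ^ 2) ^ 2 ≤ s ^ 2 := pow_le_pow_left₀ (by positivity) h2 2
    calc ∫ ω, stepIntegral W (c N) (A N) ω ^ 4 ∂P ≤ (pairingBound (4 * q)).toReal * a ^ 4 := h1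
      _ = (pairingBound (4 * q)).toReal / wickConst q ^ 2 * (wickConst q * a ^ 2) ^ 2 := by
          field_simp
      _ ≤ (pairingBound (4 * q)).toReal / wickConst q ^ 2 * s ^ 2 := by gcongr
      _ ≤ _ := by nlinarith [sq_nonneg s]
  obtain ⟨M, hM⟩ := exists_eventually_integral_sq_le h
    (fun N => memLp_stepIntegral hW (hA N) 4 (by simp)) (by positivity) h4
  refine ⟨√(M / wickConst q), ?_⟩
  filter_upwards [hM] with N hN
  refine Real.le_sqrt_of_sq_le ?_
  rw [le_div_iff₀ hw, mul_comm]
  exact (wickConst_mul_sq_le_integral_stepIntegral hW (hA N) (hA' N) (hs N)).trans hN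

/-- A limit in distribution of multiple integrals of a fixed order has moments of all orders. -/
lemma memLp_of_tendstoInDistribution_stepIntegral (hW : IsGaussianRandomMeasure W μ P)
    (hA : ∀ N m i, MeasurableSet (A N m i) ∧ μ (A N m i) < ∞)
    (hA' : ∀ N m i j, i ≠ j → Disjoint (A N m i) (A N m j))
    (hs : ∀ N, IsPointwiseSymmetric (stepKernel (c N) (A N)))
    (h : TendstoInDistribution (fun N => stepIntegral W (c N) (A N)) atTop U (fun _ => P) P')
    (p : ℝ≥0∞) (hp : p ≠ ∞) : MemLp U p P' := by
  obtain ⟨R, hR⟩ := exists_eventually_eLpNorm_stepKernel_le hW hA hA' hs h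
  refine memLp_of_forall_integrable_pow h.aemeasurable_limit (fun m => ?_) p hp
  refine integrable_pow_of_tendstoInDistribution h (even_two_mul m) (fun N => ?_)
    (B := (pairingBound (2 * m * q)).toReal * R ^ (2 * m)) ?_
  · have := memLp_finsetProd (Finset.univ : Finset (Fin (2 * m)))
      (f := fun _ => stepIntegral W (c N) (A N))
      (fun _ _ => memLp_stepIntegral hW (hA N)) 1 (by simp)
    simpa using memLp_one_iff_integrable.1 this
  · filter_upwards [hR] with N hN
    refine (integral_stepIntegral_pow_le hW (hA N) (hA' N) _).trans ?_
    gcongr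

end SingleSequence

lemma tendsto_integral_comp_of_tendstoInDistribution {E : Type*} [TopologicalSpace E]
    [MeasurableSpace E] [OpensMeasurableSpace E] {X : ℕ → Ω → E} {U : Ω' → E}
    (h : TendstoInDistribution X atTop U (fun _ => P) P') {F : E → ℂ} (hF : Continuous F) {C : ℝ}
    (hC : ∀ x, ‖F x‖ ≤ C) :
    Tendsto (fun N => ∫ ω, F (X N ω) ∂P) atTop (𝓝 (∫ ω, F (U ω) ∂P')) := by
  have h1 := (ProbabilityMeasure.tendsto_iff_forall_integral_rclike_tendsto ℂ).1 h.tendsto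
    (BoundedContinuousFunction.ofNormedAddCommGroup F hF C hC)
  simp only [ProbabilityMeasure.coe_mk, BoundedContinuousFunction.coe_ofNormedAddCommGroup] at h1
  rw [integral_map h.aemeasurable_limit hF.measurable.aestronglyMeasurable] at h1
  refine h1.congr fun N => ?_
  rw [integral_map (h.forall_aemeasurable N) hF.measurable.aestronglyMeasurable]

section Family

variable {T : Type*} [Fintype T] {q : T → ℕ}

/-- The characteristic function of the random vector `U` at `α`. -/
noncomputable def vectorCharFun (P' : Measure Ω') (U : Ω' → T → ℝ) (α : T → ℝ) : ℂ :=
  ∫ ω, Complex.exp ((∑ t, α t * U ω t : ℝ) * Complex.I) ∂P'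

/-- Two groups of multiple integrals with asymptotically vanishing mutual contractions are
independent in the limit. -/
lemma vectorCharFun_add {n : ℕ → T → ℕ} {c : ∀ N t, Fin (n N t) → ℝ}
    {A : ∀ N t, Fin (n N t) → Fin (q t) → Set ℝ} {U : Ω' → T → ℝ}
    (hW : IsGaussianRandomMeasure W μ P)
    (hA : ∀ N t m i, MeasurableSet (A N t m i) ∧ μ (A N t m i) < ∞)
    (hA' : ∀ N t m i j, i ≠ j → Disjoint (A N t m i) (A N t m j))
    (hs : ∀ N t, IsPointwiseSymmetric (stepKernel (c N t) (A N t)))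
    (h : TendstoInDistribution (fun N ω t => stepIntegral W (c N t) (A N t) ω) atTop U
      (fun _ => P) P') {α β : T → ℝ}
    (hcontr : ∀ t t', α t ≠ 0 → β t' ≠ 0 → Tendsto (fun N => sumContractionNorm μ
      (stepKernel (c N t) (A N t)) (stepKernel (c N t') (A N t'))) atTop (𝓝 0)) :
    vectorCharFun P' U (α + β) = vectorCharFun P' U α * vectorCharFun P' U β := by
  have hcoord : ∀ t, TendstoInDistribution (fun N => stepIntegral W (c N t) (A N t)) atTop
      (fun ω => U ω t) (fun _ => P) P' := fun t =>
    h.continuous_comp (g := fun x : T → ℝ => x t) (continuous_apply t)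
  choose R hR using fun t => exists_eventually_eLpNorm_stepKernel_le hW (fun N => hA N t)
    (fun N => hA' N t) (fun N => hs N t) (hcoord t)
  let e : (T → ℝ) → (T → ℝ) → ℂ := fun γ x => Complex.exp ((∑ t, γ t * x t : ℝ) * Complex.I)
  have he : ∀ γ, Continuous (e γ) := fun γ => by fun_prop
  have he' : ∀ γ x, ‖e γ x‖ ≤ 1 := fun γ x => (Complex.norm_exp_ofReal_mul_I _).le
  let X : ℕ → Ω → T → ℝ := fun N ω t => stepIntegral W (c N t) (A N t) ω
  have hlim : Tendsto (fun N => ‖∫ ω, e α (X N ω) * e β (X N ω) ∂P -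
      (∫ ω, e α (X N ω) ∂P) * ∫ ω, e β (X N ω) ∂P‖) atTop
      (𝓝 ‖∫ ω, e α (U ω) * e β (U ω) ∂P' - (∫ ω, e α (U ω) ∂P') * ∫ ω, e β (U ω) ∂P'‖) := by
    refine ((tendsto_integral_comp_of_tendstoInDistribution h ((he α).mul (he β)) (C := 1)
      fun x => ?_).sub ((tendsto_integral_comp_of_tendstoInDistribution h (he α) (he' α)).mul
      (tendsto_integral_comp_of_tendstoInDistribution h (he β) (he' β)))).norm
    rw [Pi.mul_apply, norm_mul]
    exact mul_le_one₀ (he' α x) (norm_nonneg _) (he' β x)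
  have hzero : ‖∫ ω, e α (U ω) * e β (U ω) ∂P' -
      (∫ ω, e α (U ω) ∂P') * ∫ ω, e β (U ω) ∂P'‖ ≤ 0 := by
    have hδ : ∀ δ : ℝ, 0 < δ → ‖∫ ω, e α (U ω) * e β (U ω) ∂P' -
        (∫ ω, e α (U ω) ∂P') * ∫ ω, e β (U ω) ∂P'‖ ≤
        (∑ s : Σ t, Fin (q t), ∑ s' : Σ t, Fin (q t), |α s.1| * |β s'.1| * δ) *
          (Real.pi / 2) := by
      intro δ hδ
      have hev : ∀ᶠ N in atTop, ∀ t t', α t ≠ 0 → β t' ≠ 0 → pairingBound (2 * (q t + q t')) *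
          (sumContractionNorm μ (stepKernel (c N t) (A N t)) (stepKernel (c N t') (A N t')) *
          (eLpNorm (stepKernel (c N t) (A N t)) 2 (Measure.pi fun _ => μ) *
          eLpNorm (stepKernel (c N t') (A N t')) 2 (Measure.pi fun _ => μ))) ≤
          ENNReal.ofReal (δ ^ 2) := by
        refine eventually_all.2 fun t => eventually_all.2 fun t' => ?_
        by_cases hα : α t = 0
        · exact .of_forall fun N h => absurd hα h
        by_cases hβ : β t' = 0
        · exact .of_forall fun N _ h => absurd hβ h
        have h1 : Tendsto (fun N => pairingBound (2 * (q t + q t')) *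
            (sumContractionNorm μ (stepKernel (c N t) (A N t)) (stepKernel (c N t') (A N t')) *
            (ENNReal.ofReal (R t) * ENNReal.ofReal (R t')))) atTop (𝓝 0) := by
          have h2 := ENNReal.Tendsto.mul_const (b := ENNReal.ofReal (R t) * ENNReal.ofReal (R t'))
            (hcontr t t' hα hβ) (.inr (ENNReal.mul_ne_top ENNReal.ofReal_ne_top
              ENNReal.ofReal_ne_top))
          have h3 := ENNReal.Tendsto.const_mul (a := pairingBound (2 * (q t + q t'))) h2
            (.inr ENNReal.ofReal_ne_top)
          simpa using h3
        have hpos : (0 : ℝ≥0∞) < ENNReal.ofReal (δ ^ 2) := by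
          rw [ENNReal.ofReal_pos]; positivity
        filter_upwards [h1.eventually_lt_const hpos, hR t, hR t'] with N hN ht ht' _ _
        refine le_trans ?_ hN.le
        gcongr
        · exact (ENNReal.le_ofReal_iff_toReal_le (memLp_stepKernel _ (hA N t)).2.ne
            (ENNReal.toReal_nonneg.trans ht)).2 ht
        · exact (ENNReal.le_ofReal_iff_toReal_le (memLp_stepKernel _ (hA N t')).2.ne
            (ENNReal.toReal_nonneg.trans ht')).2 ht'
      refine le_of_tendsto hlim ?_
      filter_upwards [hev] with N hN
      exact norm_integral_cexp_stepIntegral_sub_le hW (hA N) (hA' N) (hs N) α β hδ.le hN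
    have hcont : Tendsto (fun δ : ℝ => (∑ s : Σ t, Fin (q t), ∑ s' : Σ t, Fin (q t),
        |α s.1| * |β s'.1| * δ) * (Real.pi / 2)) (𝓝[>] 0) (𝓝 0) := by
      refine tendsto_nhdsWithin_of_tendsto_nhds (Continuous.tendsto' (by fun_prop) _ _ ?_)
      simp
    exact ge_of_tendsto hcont (by filter_upwards [self_mem_nhdsWithin] with δ hδ' using hδ δ hδ')
  have h1 := norm_le_zero_iff.1 hzero
  have h2 : vectorCharFun P' U (α + β) = ∫ ω, e α (U ω) * e β (U ω) ∂P' := by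
    refine integral_congr_ae (.of_forall fun ω => ?_)
    simp only [e]
    rw [← Complex.exp_add]
    congr 1
    simp only [Pi.add_apply, add_mul, Finset.sum_add_distrib]
    push_cast
    ring
  rw [h2]
  exact sub_eq_zero.1 h1

end Family

end Limits

/-! ### Approximation by elementary integrals along a sequence -/

section Approximation

variable {Ω Ω' : Type*} [MeasurableSpace Ω] [MeasurableSpace Ω'] {P : Measure Ω}
  [IsProbabilityMeasure P] {P' : Measure Ω'} [IsProbabilityMeasure P'] {μ : Measure ℝ}
  [SigmaFinite μ] {W : Set ℝ → Ω → ℝ} {T : Type*} [Fintype T] {q : T → ℕ}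

/-- Finitely many multiple integrals are approximated simultaneously by elementary ones, in such a
way that the norms of the contractions do not increase by more than `ε`. -/
lemma exists_stepIntegral_family {f : ∀ t, (Fin (q t) → ℝ) → ℝ} {X : T → Ω → ℝ}
    (hX : ∀ t, IsWienerItoIntegral W μ P (q t) (f t) (X t))
    (hs : ∀ t, IsSymmetricKernel μ (q t) (f t)) {ε : ℝ≥0∞} (hε : 0 < ε) :
    ∃ (n : T → ℕ) (c : ∀ t, Fin (n t) → ℝ) (A : ∀ t, Fin (n t) → Fin (q t) → Set ℝ),
      (∀ t m i, MeasurableSet (A t m i) ∧ μ (A t m i) < ∞) ∧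
      (∀ t m i j, i ≠ j → Disjoint (A t m i) (A t m j)) ∧
      (∀ t, IsPointwiseSymmetric (stepKernel (c t) (A t))) ∧
      (∀ t, eLpNorm (stepIntegral W (c t) (A t) - X t) 2 P ≤ ε) ∧
      ∀ t t' r, r ≤ q t → r ≤ q t' →
        contractionNorm μ (q t) (q t') r (stepKernel (c t) (A t)) (stepKernel (c t') (A t')) ≤
          contractionNorm μ (q t) (q t') r (f t) (f t') + ε := by
  set M : ℝ≥0∞ := ∑ t, eLpNorm (f t) 2 (Measure.pi fun _ => μ) with hM
  have hMtop : M ≠ ∞ := ENNReal.sum_ne_top.2 fun t _ => (hX t).1.2.ne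
  have hfM : ∀ t, eLpNorm (f t) 2 (Measure.pi fun _ => μ) ≤ M := fun t =>
    Finset.single_le_sum (f := fun t => eLpNorm (f t) 2 (Measure.pi fun _ => μ))
      (fun _ _ => zero_le) (Finset.mem_univ t)
  -- `η` is such that `η * (M + η) + M * η ≤ ε`
  set η : ℝ≥0∞ := min (min ε 1) (ε / (2 * M + 1)) with hη
  have hden : 2 * M + 1 ≠ ∞ := ENNReal.add_ne_top.2 ⟨ENNReal.mul_ne_top (by simp) hMtop, by simp⟩
  have hηpos : 0 < η := lt_min (lt_min hε one_pos) (ENNReal.div_pos hε.ne' hden)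
  have hη1 : η ≤ 1 := (min_le_left _ _).trans (min_le_right _ _)
  have hηε : η ≤ ε := (min_le_left _ _).trans (min_le_left _ _)
  have hηM : η * (2 * M + 1) ≤ ε := by
    refine (mul_le_mul_left (min_le_right _ _) _).trans (le_of_eq ?_)
    exact ENNReal.div_mul_cancel (by simp) hden
  choose n c A hA hA' hsym hker hint using fun t => (hX t).exists_stepIntegral (hs t) hηpos
  refine ⟨n, c, A, hA, hA', hsym, fun t => (hint t).le.trans hηε, fun t t' r hr hr' => ?_⟩
  have hmeas : ∀ t, Measurable (stepKernel (c t) (A t)) := fun t =>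
    measurable_stepKernel _ fun m i => (hA t m i).1
  refine (contractionNorm_le_add hr hr' (hX t).1.1 (hmeas t) (hX t').1.1 (hmeas t')).trans
    (add_le_add le_rfl ?_)
  have h1 : eLpNorm (stepKernel (c t') (A t')) 2 (Measure.pi fun _ => μ) ≤ M + 1 := by
    have h2 : stepKernel (c t') (A t') = f t' + (stepKernel (c t') (A t') - f t') := by
      rw [add_sub_cancel]
    rw [h2]
    refine (eLpNorm_add_le (hX t').1.1 ((hmeas t').aestronglyMeasurable.sub (hX t').1.1)
      (by norm_num)).trans ?_
    exact add_le_add (hfM t') ((hker t').le.trans hη1)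
  calc _ ≤ η * (M + 1) + M * η :=
        add_le_add (mul_le_mul' (hker t).le h1) (mul_le_mul' (hfM t) (hker t').le)
    _ = η * (2 * M + 1) := by ring
    _ ≤ ε := hηM

lemma tendstoInDistribution_of_tendsto_eLpNorm_sub {X Y : ℕ → T → Ω → ℝ} {U : Ω' → T → ℝ}
    (h : TendstoInDistribution (fun N ω t => X N t ω) atTop U (fun _ => P) P')
    (hX : ∀ N t, MemLp (X N t) 2 P) (hY : ∀ N t, MemLp (Y N t) 2 P)
    (hXY : ∀ t, Tendsto (fun N => eLpNorm (Y N t - X N t) 2 P) atTop (𝓝 0)) :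
    TendstoInDistribution (fun N ω t => Y N t ω) atTop U (fun _ => P) P' := by
  have hXm : ∀ N, AEMeasurable (fun ω t => X N t ω) P := fun N =>
    aemeasurable_pi_lambda _ fun t => (hX N t).1.aemeasurable
  have hYm : ∀ N, AEMeasurable (fun ω t => Y N t ω) P := fun N =>
    aemeasurable_pi_lambda _ fun t => (hY N t).1.aemeasurable
  refine tendstoInDistribution_of_tendstoInMeasure_sub _ _ h ?_ hYm
  refine tendstoInMeasure_of_tendsto_eLpNorm_of_ne_top (p := 2) (by simp) (by simp)
    (fun N => ((hYm N).sub (hXm N)).aestronglyMeasurable) aestronglyMeasurable_const ?_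
  have hsum : Tendsto (fun N => ∑ t, eLpNorm (Y N t - X N t) 2 P) atTop (𝓝 0) := by
    simpa using tendsto_finsetSum Finset.univ fun t _ => hXY t
  refine tendsto_of_tendsto_of_tendsto_of_le_of_le tendsto_const_nhds hsum (fun N => zero_le)
    fun N => ?_
  have h1 : eLpNorm (fun ω => ∑ t, ‖(Y N t - X N t) ω‖) 2 P ≤
      ∑ t, eLpNorm (Y N t - X N t) 2 P := by
    have h2 := eLpNorm_sum_le (μ := P) (p := 2) (s := Finset.univ)
      (f := fun t ω => ‖(Y N t - X N t) ω‖)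
      (fun t _ => ((hY N t).1.sub (hX N t).1).norm) (by norm_num)
    simp only [eLpNorm_norm] at h2
    refine le_trans (le_of_eq ?_) h2
    congr 1
    ext ω
    simp
  refine (eLpNorm_mono_real fun ω => ?_).trans h1
  refine (pi_norm_le_iff_of_nonneg (Finset.sum_nonneg fun _ _ => norm_nonneg _)).2 fun t => ?_
  simp only [Pi.sub_apply, sub_zero]
  exact Finset.single_le_sum (f := fun t => ‖Y N t ω - X N t ω‖) (fun _ _ => norm_nonneg _)
    (Finset.mem_univ t)

/-! ### Asymptotic independence of multiple integrals -/

/-- If the multiple integrals of kernels with small contractions across the blocks of `b` converge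
in distribution, then the limit has moments of all orders and its characteristic function factorizes
along the blocks. -/
theorem memLp_and_vectorCharFun_eq_prod {J : Type*} [Fintype J] [DecidableEq J] (b : T → J)
    {f : ∀ t, ℕ → (Fin (q t) → ℝ) → ℝ} {X : ℕ → T → Ω → ℝ} {U : Ω' → T → ℝ}
    (hW : IsGaussianRandomMeasure W μ P)
    (hX : ∀ N t, IsWienerItoIntegral W μ P (q t) (f t N) (X N t))
    (hs : ∀ N t, IsSymmetricKernel μ (q t) (f t N))
    (h : TendstoInDistribution (fun N ω t => X N t ω) atTop U (fun _ => P) P')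
    (hcontr : ∀ t t', b t ≠ b t' → ∀ r, 1 ≤ r → r ≤ min (q t) (q t') →
      Tendsto (fun N => contractionNorm μ (q t) (q t') r (f t N) (f t' N)) atTop (𝓝 0)) :
    (∀ t (p : ℝ≥0∞), p ≠ ∞ → MemLp (fun ω => U ω t) p P') ∧
      ∀ α : T → ℝ, vectorCharFun P' U α =
        ∏ j, vectorCharFun P' U (fun t => if b t = j then α t else 0) := by
  have hεpos : ∀ N : ℕ, (0 : ℝ≥0∞) < ((N : ℝ≥0∞))⁻¹ := fun N => by simp
  have hε := ENNReal.tendsto_inv_nat_nhds_zero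
  choose n c A hA hA' hsym hint hker using fun N =>
    exists_stepIntegral_family (hX N) (hs N) (hεpos N)
  have hY : TendstoInDistribution (fun N ω t => stepIntegral W (c N t) (A N t) ω) atTop U
      (fun _ => P) P' := by
    refine tendstoInDistribution_of_tendsto_eLpNorm_sub
      (Y := fun N t => stepIntegral W (c N t) (A N t)) h (fun N t => (hX N t).2.1)
      (fun N t => memLp_stepIntegral hW (hA N t) 2 (by simp)) fun t => ?_
    exact tendsto_of_tendsto_of_tendsto_of_le_of_le tendsto_const_nhds hε (fun N => zero_le)
      fun N => hint N t
  have hsum : ∀ t t', b t ≠ b t' → Tendsto (fun N => sumContractionNorm μ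
      (stepKernel (c N t) (A N t)) (stepKernel (c N t') (A N t'))) atTop (𝓝 0) := by
    intro t t' htt'
    unfold sumContractionNorm
    rw [← Finset.sum_const_zero (s := Finset.Icc 1 (min (q t) (q t')))]
    refine tendsto_finsetSum _ fun r hr => ?_
    obtain ⟨hr1, hr2⟩ := Finset.mem_Icc.1 hr
    have h1 := (hcontr t t' htt' r hr1 hr2).add hε
    rw [add_zero] at h1
    exact tendsto_of_tendsto_of_tendsto_of_le_of_le tendsto_const_nhds h1 (fun N => zero_le)
      fun N => hker N t t' r (hr2.trans (min_le_left _ _)) (hr2.trans (min_le_right _ _))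
  refine ⟨fun t p hp => memLp_of_tendstoInDistribution_stepIntegral hW (fun N => hA N t)
    (fun N => hA' N t) (fun N => hsym N t)
    (hY.continuous_comp (g := fun x : T → ℝ => x t) (continuous_apply t)) p hp, fun α => ?_⟩
  have key : ∀ s : Finset J, vectorCharFun P' U (fun t => if b t ∈ s then α t else 0) =
      ∏ j ∈ s, vectorCharFun P' U (fun t => if b t = j then α t else 0) := by
    intro s
    induction s using Finset.induction_on with
    | empty => simp [vectorCharFun]
    | insert j s hj ih =>
      rw [Finset.prod_insert hj, ← ih, ← vectorCharFun_add hW hA hA' hsym hY]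
      · congr 1
        ext t
        by_cases h1 : b t = j
        · simp [h1, hj]
        · simp [h1]
      · intro t t' ht ht'
        refine hsum t t' fun heq => ?_
        have h1 : b t = j := by by_contra h1; simp [h1] at ht
        have h2 : b t' ∈ s := by by_contra h2; simp [h2] at ht'
        exact hj (h1 ▸ heq ▸ h2)
  simpa using key Finset.univ

end Approximation

/-- Lévy's uniqueness theorem for the joint law of the blocks. -/
lemma iIndepFun_of_vectorCharFun_eq_prod {Ω' : Type*} [MeasurableSpace Ω'] {P' : Measure Ω'}
    [IsProbabilityMeasure P'] {J : Type*} [Fintype J] [DecidableEq J] {I : J → ℕ}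
    {U : (j : J) → Ω' → Fin (I j) → ℝ} (hU : ∀ j, AEMeasurable (U j) P')
    (h : ∀ α : (Σ j, Fin (I j)) → ℝ, vectorCharFun P' (fun ω t => U t.1 ω t.2) α =
      ∏ j, vectorCharFun P' (fun ω t => U t.1 ω t.2) (fun t => if t.1 = j then α t else 0)) :
    iIndepFun U P' := by
  refine (iIndepFun_iff_charFunDual_pi hU).2 fun L => ?_
  let α : (Σ j, Fin (I j)) → ℝ := fun t => L (Pi.single t.1 (Pi.single t.2 1))
  have hblock : ∀ j (u : Fin (I j) → ℝ), L (Pi.single j u) = ∑ i, α ⟨j, i⟩ * u i := by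
    intro j u
    change (L.comp (.single ℝ _ j)) u = _
    conv_lhs => rw [← Finset.univ_sum_single u]
    rw [map_sum]
    refine Finset.sum_congr rfl fun i _ => ?_
    rw [← mul_one (u i), ← smul_eq_mul (u i) 1, Pi.single_smul', map_smul, smul_eq_mul, mul_comm,
      smul_eq_mul, mul_one]
    rfl
  have hfull : ∀ u : (j : J) → Fin (I j) → ℝ, L u = ∑ t, α t * u t.1 t.2 := by
    intro u
    conv_lhs => rw [← Finset.univ_sum_single u]
    rw [map_sum, Fintype.sum_sigma]
    exact Finset.sum_congr rfl fun j _ => hblock j (u j)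
  have hpi : AEMeasurable (fun ω j => U j ω) P' := aemeasurable_pi_lambda _ hU
  rw [charFunDual_apply, integral_map hpi (Continuous.aestronglyMeasurable (by fun_prop))]
  simp_rw [hfull]
  refine (h α).trans (Finset.prod_congr rfl fun j _ => ?_)
  rw [charFunDual_apply, integral_map (hU j) (Continuous.aestronglyMeasurable (by fun_prop))]
  refine integral_congr_ae (.of_forall fun ω => ?_)
  have : (L.comp (.single ℝ _ j)) (U j ω) =
      ∑ t : Σ j, Fin (I j), (if t.1 = j then α t else 0) * U t.1 ω t.2 := by
    rw [Fintype.sum_sigma, Finset.sum_eq_single j]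
    · simpa using hblock j (U j ω)
    · intro j' _ hj'
      simp [hj']
    · simp
  simp only [this]

theorem mainTheorem7 {Ω Ω' : Type*} [MeasurableSpace Ω] [MeasurableSpace Ω']
    (P : Measure Ω) [IsProbabilityMeasure P] (P' : Measure Ω') [IsProbabilityMeasure P']
    (μ : Measure ℝ) [SigmaFinite μ] [NullSingletonClass μ]
    (W : Set ℝ → Ω → ℝ) (hW : IsGaussianRandomMeasure W μ P)
    (J : ℕ) (I : Fin J → ℕ) (q : (j : Fin J) → Fin (I j) → ℕ)
    (f : (j : Fin J) → (i : Fin (I j)) → ℕ → (Fin (q j i) → ℝ) → ℝ)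
    (hf : ∀ j i N, MemLp (f j i N) 2 (Measure.pi fun _ : Fin (q j i) => μ))
    (hsymm : ∀ j i N, IsSymmetricKernel μ (q j i) (f j i N))
    (UN : ℕ → (j : Fin J) → Ω → Fin (I j) → ℝ)
    (hUN : ∀ N j i, IsWienerItoIntegral W μ P (q j i) (f j i N) (fun ω => UN N j ω i))
    (U : (j : Fin J) → Ω' → Fin (I j) → ℝ)
    (hconv : TendstoInDistribution (fun N ω => fun j : Fin J => UN N j ω) atTop
      (fun ω' => fun j : Fin J => U j ω') (fun _ : ℕ => P) P')
    (hcontr : ∀ (j₁ j₂ : Fin J), j₁ ≠ j₂ → ∀ (i₁ : Fin (I j₁)) (i₂ : Fin (I j₂)) (r : ℕ),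
      1 ≤ r → r ≤ min (q j₁ i₁) (q j₂ i₂) →
      Tendsto (fun N => contractionNorm μ (q j₁ i₁) (q j₂ i₂) r (f j₁ i₁ N) (f j₂ i₂ N))
        atTop (𝓝 0)) :
    (∀ k : (j : Fin J) → Fin (I j) → ℕ,
      Integrable (fun ω' => ∏ j, ∏ i, U j ω' i ^ k j i) P' ∧
      (∀ j, Integrable (fun ω' => ∏ i, U j ω' i ^ k j i) P') ∧
      ∫ ω', ∏ j, ∏ i, U j ω' i ^ k j i ∂P' = ∏ j, ∫ ω', ∏ i, U j ω' i ^ k j i ∂P') ∧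
    ((∀ j i, MomentDeterminate (P'.map fun ω' => U j ω' i)) → iIndepFun U P') := by
  have hflat : TendstoInDistribution (fun N ω (t : Σ j, Fin (I j)) => UN N t.1 ω t.2) atTop
      (fun ω' t => U t.1 ω' t.2) (fun _ : ℕ => P) P' :=
    hconv.continuous_comp (g := fun (u : (j : Fin J) → Fin (I j) → ℝ) (t : Σ j, Fin (I j)) =>
      u t.1 t.2) (by fun_prop)
  obtain ⟨hmem, hfac⟩ := memLp_and_vectorCharFun_eq_prod (q := fun t : Σ j, Fin (I j) => q t.1 t.2)
    (fun t => t.1) (f := fun t N => f t.1 t.2 N) (X := fun N t ω => UN N t.1 ω t.2)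
    hW (fun N t => hUN N t.1 t.2) (fun N t => hsymm t.1 t.2 N) hflat
    fun t t' htt' r => hcontr t.1 t'.1 htt' t.2 t'.2 r
  have hU : ∀ j, AEMeasurable (U j) P' := fun j =>
    (measurable_pi_apply j).comp_aemeasurable hconv.aemeasurable_limit
  have hindep : iIndepFun U P' := iIndepFun_of_vectorCharFun_eq_prod hU hfac
  refine ⟨fun k => ?_, fun _ => hindep⟩
  have hpow : ∀ j i (p : ℝ≥0∞), p ≠ ∞ → MemLp (fun ω' => U j ω' i ^ k j i) p P' := by
    intro j i p hp
    simpa using memLp_finsetProd (Finset.univ : Finset (Fin (k j i)))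
      (f := fun _ ω' => U j ω' i) (fun _ _ => hmem ⟨j, i⟩) p hp
  have hblock : ∀ j (p : ℝ≥0∞), p ≠ ∞ → MemLp (fun ω' => ∏ i, U j ω' i ^ k j i) p P' := fun j =>
    memLp_finsetProd Finset.univ fun i _ => hpow j i
  refine ⟨memLp_one_iff_integrable.1 (memLp_finsetProd Finset.univ (fun j _ => hblock j) 1
    (by simp)), fun j => memLp_one_iff_integrable.1 (hblock j 1 (by simp)), ?_⟩
  exact hindep.integral_fun_prod_comp hU (f := fun j u => ∏ i, u i ^ k j i)
    fun j => Continuous.aestronglyMeasurable (by fun_prop)
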